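/- Let $M$ be a (Hausdorff, pure-dimensional) complex manifold with structure sheaf $O_M$ and sheaf of differential operators $D_M$, let $n\ge 0$ and $R=\mathbb C[\hbar]/(\hbar^{n+1})$. A \emph{star product} on $O_U\otimes_{\mathbb C}R$ ($U\subset M$ open) is an associative $R$-bilinear product with $f\star g=\sum_{i=0}^{n}B_i(f,g)\hbar^i$ for $f,g\in O_U$, where the $B_i$ are bidifferential operators and $B_0(f,g)=fg$. A \emph{(neutralized) $\star$-quantization} $\widetilde M$ of $M$ is a sheaf $O_{\widetilde M}$ of unital $R$-algebras on $M$ that is locally isomorphic, as a sheaf of $R$-algebras, to $O_M\otimes R$ with some star product; then $O_{\widetilde M}/\hbar O_{\widetilde M}=O_M$ canonically. The $\star$-quantizations of $M$ form a groupoid whose morphisms are the isomorphisms of sheaves of $R$-algebras on $M$. For a $\star$-quantization $\widetilde M$ let $A_{\widetilde M}=\mathrm{Diff}_M(O_{\widetilde M};O_M\otimes R)$ be the sheaf of $R$-linear sheaf maps $A:O_{\widetilde M}\to O_M\otimes R$ such that locally there is an $N$ with $A_N=0$ for every sequence $A_0=A$, $A_k=f_kA_{k-1}-A_{k-1}s_k$,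 where the sections $f_k$ of $O_M\otimes R$ and $s_k$ of $O_{\widetilde M}$ have the same reduction modulo $\hbar$. It is a left $D_M\otimes R$-module by composition. Left $D_M\otimes R$-modules form a tensor category under the tensor product over $O_M\otimes R$, on which vector fields act by the Leibniz rule; a coalgebra in it is coassociative and counital, but not necessarily cocommutative. For $n=0$ this gives coalgebras in left $D_M$-modules, such as $D_M$ itself: its coproduct is characterized by $\Delta(P)=\sum P'\otimes P''$ if and only if $P(fg)=\sum P'(f)P''(g)$, and its counit is $P\mapsto P(1)$. An \emph{$R$-deformation of $D_M$ as a coalgebra in left $D_M$-modules} is a coalgebra $\widetilde A$ in the category of sheaves of left $D_M\otimes R$-modules, flat over $R$, together with an isomorphism $\widetilde A/\hbar\widetilde A\simeq D_M$ of coalgebras in left $D_M$-modules. These form a groupoid; its morphisms are the isomorphisms of coalgebras in left $D_M\otimes R$-modules that are compatible with the identifications modulo $\hbar$. Then for each $\star$-quantization $\widetilde M$ the $D_M\otimes R$-module $A_{\widetilde M}$ has a unique structure of an $R$-deformation of the coalgebra $D_M$ such that: $\Delta(A)=\sum A'\otimes A''$ implies $A(fg)=\sum A'(f)A''(g)$ for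 sections $f,g$ of $O_{\widetilde M}$; the counit is $A\mapsto A(1)$; and the isomorphism $A_{\widetilde M}/\hbar A_{\widetilde M}\simeq D_M$ sends the class of $A$ to the operator on $O_M$ that $A$ induces modulo $\hbar$. For each isomorphism $e:O_{\widetilde M}\to O_{\widetilde M'}$ of $\star$-quantizations, the map $A\mapsto A\circ e^{-1}$ is a morphism of these deformations. The resulting functor $\widetilde M\mapsto A_{\widetilde M}$ is an equivalence between the groupoid of $\star$-quantizations of $M$ and the groupoid of $R$-deformations of $D_M$ as a coalgebra in left $D_M$-modules. -/

import Mathlib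

open CategoryTheory TopologicalSpace Opposite
open scoped Manifold ContDiff TensorProduct

universe u

namespace StarQuant

noncomputable section

/-- The base ring `R = ℂ[ħ]/(ħ^(n+1))`. -/
def Base (n : ℕ) : Type :=
  Polynomial ℂ ⧸ Ideal.span {(Polynomial.X : Polynomial ℂ) ^ (n + 1)}

instance (n : ℕ) : CommRing (Base n) :=
  inferInstanceAs (CommRing (Polynomial ℂ ⧸ Ideal.span {(Polynomial.X : Polynomial ℂ) ^ (n + 1)}))

instance (n : ℕ) : Algebra ℂ (Base n) :=
  inferInstanceAs (Algebra ℂ (Polynomial ℂ ⧸ Ideal.span {(Polynomial.X : Polynomial ℂ) ^ (n + 1)}))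

/-- The class of `ħ` in `R`. -/
def hbar (n : ℕ) : Base n :=
  Ideal.Quotient.mk (Ideal.span {(Polynomial.X : Polynomial ℂ) ^ (n + 1)}) Polynomial.X

/-- The augmentation `R → ℂ`, `ħ ↦ 0`. -/
def aug (n : ℕ) : Base n →ₐ[ℂ] ℂ :=
  Ideal.Quotient.liftₐ (Ideal.span {(Polynomial.X : Polynomial ℂ) ^ (n + 1)})
    (Polynomial.aeval (0 : ℂ)) (by
    intro a ha
    obtain ⟨b, rfl⟩ := Ideal.mem_span_singleton.1 ha
    simp)

/-- Reduction modulo `ħ` of `R ⊗ A`, for a `ℂ`-algebra `A`. -/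
def red (n : ℕ) (A : Type u) [Ring A] [Algebra ℂ A] : Base n ⊗[ℂ] A →ₐ[ℂ] A :=
  (Algebra.TensorProduct.lid ℂ A).toAlgHom.comp
    (Algebra.TensorProduct.map (aug n) (AlgHom.id ℂ A))

section Killed

variable {k : Type*} [CommRing k] {P Q S : Type*} [AddCommGroup P] [Module k P]
  [AddCommGroup Q] [Module k Q] [AddCommGroup S] [Module k S]

/-- `Killed E N A` says that every `N`-fold iterated commutator of `A : P → Q` with elements of `E`
vanishes: whenever `A₀ = A` and `A_k = q_k ∘ A_{k-1} - A_{k-1} ∘ p_k` with `(p_k, q_k) ∈ E`, one has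
`A_N = 0`. -/
def Killed (E : Set (Module.End k P × Module.End k Q)) : ℕ → (P →ₗ[k] Q) → Prop
  | 0, A => A = 0
  | N + 1, A => ∀ p ∈ E, Killed E N (p.2 ∘ₗ A - A ∘ₗ p.1)

theorem Killed.zero (E : Set (Module.End k P × Module.End k Q)) (N : ℕ) :
    Killed E N (0 : P →ₗ[k] Q) := by
  induction N with
  | zero => rfl
  | succ N ih => intro p _; simpa using ih

theorem Killed.add {E : Set (Module.End k P × Module.End k Q)} {N : ℕ} {A B : P →ₗ[k] Q}
    (hA : Killed E N A) (hB : Killed E N B) : Killed E N (A + B) := by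
  induction N generalizing A B with
  | zero => simp_all [Killed]
  | succ N ih =>
    intro p hp
    have := ih (hA p hp) (hB p hp)
    convert this using 1
    rw [LinearMap.comp_add, LinearMap.add_comp]; abel

theorem Killed.smul {E : Set (Module.End k P × Module.End k Q)} {N : ℕ} {A : P →ₗ[k] Q}
    (r : k) (hA : Killed E N A) : Killed E N (r • A) := by
  induction N generalizing A with
  | zero => simp_all [Killed]
  | succ N ih =>
    intro p hp
    have := ih (hA p hp)
    convert this using 1
    rw [LinearMap.comp_smul, LinearMap.smul_comp, smul_sub]

theorem Killed.succ {E : Set (Module.End k P × Module.End k Q)} {N : ℕ} {A : P →ₗ[k] Q}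
    (hA : Killed E N A) : Killed E (N + 1) A := by
  induction N generalizing A with
  | zero => intro p _; simp_all [Killed]
  | succ N ih => intro p hp; exact ih (hA p hp)

theorem Killed.mono {E : Set (Module.End k P × Module.End k Q)} {N N' : ℕ} (h : N ≤ N')
    {A : P →ₗ[k] Q} (hA : Killed E N A) : Killed E N' A := by
  induction N', h using Nat.le_induction with
  | base => exact hA
  | succ _ _ ih => exact ih.succ

theorem Killed.comp {E₁ : Set (Module.End k P × Module.End k Q)}
    {E₂ : Set (Module.End k Q × Module.End k S)} {E₃ : Set (Module.End k P × Module.End k S)}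
    (hE : ∀ p ∈ E₃, ∃ q, (p.1, q) ∈ E₁ ∧ (q, p.2) ∈ E₂) {a b : ℕ}
    {A : P →ₗ[k] Q} {B : Q →ₗ[k] S} (hA : Killed E₁ a A) (hB : Killed E₂ b B) :
    Killed E₃ (a + b) (B ∘ₗ A) := by
  obtain ⟨m, hm⟩ : ∃ m, m = a + b := ⟨_, rfl⟩
  induction m generalizing a b A B with
  | zero =>
    obtain ⟨rfl, rfl⟩ : a = 0 ∧ b = 0 := by omega
    simp_all [Killed]
  | succ m ih =>
    rw [← hm]
    intro p hp
    obtain ⟨q, h1, h2⟩ := hE p hp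
    have key : p.2 ∘ₗ B ∘ₗ A - (B ∘ₗ A) ∘ₗ p.1 =
        (p.2 ∘ₗ B - B ∘ₗ q) ∘ₗ A + B ∘ₗ (q ∘ₗ A - A ∘ₗ p.1) := by
      ext x; simp
    rw [key]
    apply Killed.add
    · cases b with
      | zero =>
        have hB0 : B = 0 := hB
        subst hB0
        simpa using Killed.zero E₃ m
      | succ b =>
        obtain rfl : m = a + b := by omega
        exact ih hA (hB _ h2) rfl
    · cases a with
      | zero =>
        have hA0 : A = 0 := hA
        subst hA0
        simpa using Killed.zero E₃ m
      | succ a =>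
        obtain rfl : m = a + b := by omega
        exact ih (hA _ h1) hB rfl

end Killed

/-- The pairs (multiplication by `f`, multiplication by `f`); `Killed (mulPairs k A) (N + 1)` is the
condition of being a differential operator of order at most `N`. -/
def mulPairs (k A : Type*) [CommRing k] [CommRing A] [Algebra k A] :
    Set (Module.End k A × Module.End k A) :=
  Set.range fun f : A => (LinearMap.mulLeft k f, LinearMap.mulLeft k f)

theorem Killed.baseChange {R A : Type*} [CommRing R] [Algebra ℂ R] [CommRing A] [Algebra ℂ A]
    {N : ℕ} {D : A →ₗ[ℂ] A} (hD : Killed (mulPairs ℂ A) N D) :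
    Killed (mulPairs R (R ⊗[ℂ] A)) N (D.baseChange R) := by
  induction N generalizing D with
  | zero =>
    have hD0 : D = 0 := hD
    subst hD0
    exact LinearMap.baseChange_zero
  | succ N ih =>
    rintro _ ⟨F, rfl⟩
    induction F using TensorProduct.induction_on with
    | zero =>
      convert Killed.zero _ N using 1
      ext x
      simp
    | add F G hF hG =>
      convert hF.add hG using 1
      refine LinearMap.ext fun x => ?_
      simp only [LinearMap.sub_apply, LinearMap.comp_apply, LinearMap.add_apply,
        LinearMap.mulLeft_apply, add_mul, map_add]
      abel
    | tmul r f =>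
      convert (ih (hD _ ⟨f, rfl⟩)).smul r using 1
      ext x
      simp [TensorProduct.smul_tmul', smul_sub]

variable (d n : ℕ) {M : Type u} [TopologicalSpace M] [ChartedSpace (EuclideanSpace ℂ (Fin d)) M]

/-- Holomorphic functions on an open subset of the complex manifold `M`. -/
abbrev Hol (U : Opens M) : Type u :=
  C^ω⟮𝓘(ℂ, EuclideanSpace ℂ (Fin d)), U; 𝓘(ℂ), ℂ⟯

/-- Restriction of holomorphic functions. -/
def holRes {U V : Opens M} (h : V ≤ U) : Hol d U →ₐ[ℂ] Hol d V :=
  { ContMDiffMap.restrictRingHom 𝓘(ℂ, EuclideanSpace ℂ (Fin d)) 𝓘(ℂ) ℂ h with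
    commutes' := fun _ => rfl }

@[simp] theorem holRes_apply {U V : Opens M} (h : V ≤ U) (f : Hol d U) (x : V) :
    holRes d h f x = f ⟨x, h x.2⟩ := rfl


theorem holRes_res {U V W : Opens M} (h : V ≤ U) (h' : W ≤ V) (f : Hol d U) :
    holRes d h' (holRes d h f) = holRes d (h'.trans h) f := rfl

/-- Sections over `U` of `O_M ⊗ R`.  As `R` is finite dimensional over `ℂ`, this is already a sheaf. -/
abbrev HolR (U : Opens M) : Type u := Base n ⊗[ℂ] Hol d U

/-- Restriction maps of `O_M ⊗ R`. -/
def holRRes {U V : Opens M} (h : V ≤ U) : HolR d n U →ₐ[Base n] HolR d n V :=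
  Algebra.TensorProduct.map (AlgHom.id (Base n) (Base n)) (holRes d h)

@[simp] theorem holRRes_tmul {U V : Opens M} (h : V ≤ U) (r : Base n) (f : Hol d U) :
    holRRes d n h (r ⊗ₜ f) = r ⊗ₜ holRes d h f := rfl

theorem holRRes_self (U : Opens M) : holRRes d n (le_refl U) = AlgHom.id (Base n) _ :=
  Algebra.TensorProduct.map_id

theorem holRRes_comp {U V W : Opens M} (h : V ≤ U) (h' : W ≤ V) :
    (holRRes d n h').comp (holRRes d n h) = holRRes d n (h'.trans h) := by
  ext f; rfl

variable (M) in
/-- The structure sheaf `O_M ⊗ R`. -/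
def OR : TopCat.Presheaf CommRingCat.{u} (TopCat.of M) where
  obj U := CommRingCat.of (HolR d n (M := M) U.unop)
  map f := CommRingCat.ofHom (holRRes d n (M := M) (leOfHom f.unop)).toRingHom
  map_id U := by
    exact CommRingCat.hom_ext (RingHom.ext fun x =>
      DFunLike.congr_fun (holRRes_self d n (M := M) U.unop) x)
  map_comp f g := by
    exact CommRingCat.hom_ext (RingHom.ext fun x => (DFunLike.congr_fun
      (holRRes_comp d n (M := M) (leOfHom f.unop) (leOfHom g.unop)) x).symm)

/-- Sections over `U` of the sheaf `D_M` of differential operators: endomorphisms of the sheaf of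
`ℂ`-vector spaces `O_U` that are locally of finite order. -/
def DiffOp (U : Opens M) :
    Subalgebra ℂ (∀ V : {V : Opens M // V ≤ U}, Module.End ℂ (Hol d V.1)) where
  carrier := {P |
    (∀ (V W : {V : Opens M // V ≤ U}) (h : W.1 ≤ V.1) (f : Hol d V.1),
      holRes d h (P V f) = P W (holRes d h f)) ∧
    ∀ x ∈ U, ∃ W ≤ U, x ∈ W ∧ ∃ N : ℕ, ∀ V : {V : Opens M // V ≤ U}, V.1 ≤ W →
      Killed (mulPairs ℂ (Hol d V.1)) N (P V)}
  mul_mem' := by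
    rintro P Q ⟨hP, hP'⟩ ⟨hQ, hQ'⟩
    refine ⟨fun V W h f => ?_, fun x hx => ?_⟩
    · simp [Module.End.mul_apply, hP V W h, hQ V W h]
    · obtain ⟨W₁, h₁, hx₁, N₁, hN₁⟩ := hP' x hx
      obtain ⟨W₂, h₂, hx₂, N₂, hN₂⟩ := hQ' x hx
      refine ⟨W₁ ⊓ W₂, inf_le_left.trans h₁, ⟨hx₁, hx₂⟩, N₂ + N₁, fun V hV => ?_⟩
      refine Killed.comp ?_ (hN₂ V (hV.trans inf_le_right)) (hN₁ V (hV.trans inf_le_left))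
      rintro _ ⟨f, rfl⟩
      exact ⟨_, ⟨f, rfl⟩, ⟨f, rfl⟩⟩
  add_mem' := by
    rintro P Q ⟨hP, hP'⟩ ⟨hQ, hQ'⟩
    refine ⟨fun V W h f => ?_, fun x hx => ?_⟩
    · simp [hP V W h, hQ V W h]
    · obtain ⟨W₁, h₁, hx₁, N₁, hN₁⟩ := hP' x hx
      obtain ⟨W₂, h₂, hx₂, N₂, hN₂⟩ := hQ' x hx
      refine ⟨W₁ ⊓ W₂, inf_le_left.trans h₁, ⟨hx₁, hx₂⟩, max N₁ N₂, fun V hV => ?_⟩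
      exact ((hN₁ V (hV.trans inf_le_left)).mono (le_max_left _ _)).add
        ((hN₂ V (hV.trans inf_le_right)).mono (le_max_right _ _))
  algebraMap_mem' c := by
    refine ⟨fun V W h f => ?_, fun x hx => ⟨U, le_rfl, hx, 1, fun V _ => ?_⟩⟩
    · simp [Module.algebraMap_end_apply]
    · rintro _ ⟨f, rfl⟩
      change _ = _
      ext g
      simp [Module.algebraMap_end_apply]

/-- Restriction of differential operators. -/
def diffOpRes {U V : Opens M} (h : V ≤ U) : DiffOp d U →ₐ[ℂ] DiffOp d V where
  toFun P := ⟨fun W => P.1 ⟨W.1, W.2.trans h⟩,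
    fun V' W' h' f => P.2.1 ⟨V'.1, V'.2.trans h⟩ ⟨W'.1, W'.2.trans h⟩ h' f, fun x hx => by
      obtain ⟨W, hW, hxW, N, hN⟩ := P.2.2 x (h hx)
      exact ⟨W ⊓ V, inf_le_right, ⟨hxW, hx⟩, N,
        fun V' hV' => hN ⟨V'.1, V'.2.trans h⟩ (hV'.trans inf_le_left)⟩⟩
  map_one' := rfl
  map_mul' _ _ := rfl
  map_zero' := rfl
  map_add' _ _ := rfl
  commutes' _ := rfl

/-- Functions as differential operators of order zero. -/
def mulOp (U : Opens M) : Hol d U →ₐ[ℂ] DiffOp d U where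
  toFun f := ⟨fun V => LinearMap.mulLeft ℂ (holRes d V.2 f),
    fun V W h g => by simp [holRes_res],
    fun x hx => ⟨U, le_rfl, hx, 1, fun V _ => by
      rintro _ ⟨g, rfl⟩
      change _ = _
      ext h
      simp [mul_left_comm]⟩⟩
  map_one' := by ext V g; simp
  map_mul' f g := by ext V h; simp
  map_zero' := by ext V g; simp
  map_add' f g := by ext V h; simp [add_mul]
  commutes' c := by
    ext V g x
    simp [Algebra.algebraMap_eq_smul_one]

/-- Sections over `U` of `D_M ⊗ R`. -/
abbrev DiffOpR (U : Opens M) : Type u := Base n ⊗[ℂ] DiffOp d U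

/-- Restriction maps of `D_M ⊗ R`. -/
def diffOpRRes {U V : Opens M} (h : V ≤ U) : DiffOpR d n U →ₐ[Base n] DiffOpR d n V :=
  Algebra.TensorProduct.map (AlgHom.id (Base n) (Base n)) (diffOpRes d h)

theorem diffOpRRes_self (U : Opens M) : diffOpRRes d n (le_refl U) = AlgHom.id (Base n) _ :=
  Algebra.TensorProduct.map_id

theorem diffOpRRes_comp {U V W : Opens M} (h : V ≤ U) (h' : W ≤ V) :
    (diffOpRRes d n h').comp (diffOpRRes d n h) = diffOpRRes d n (h'.trans h) := by
  ext P; rfl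

variable (M) in
/-- The sheaf of rings `D_M ⊗ R`. -/
def DR : TopCat.Presheaf RingCat.{u} (TopCat.of M) where
  obj U := RingCat.of (DiffOpR d n (M := M) U.unop)
  map f := RingCat.ofHom (diffOpRRes d n (M := M) (leOfHom f.unop)).toRingHom
  map_id U := by
    exact RingCat.hom_ext (RingHom.ext fun x =>
      DFunLike.congr_fun (diffOpRRes_self d n (M := M) U.unop) x)
  map_comp f g := by
    exact RingCat.hom_ext (RingHom.ext fun x => (DFunLike.congr_fun
      (diffOpRRes_comp d n (M := M) (leOfHom f.unop) (leOfHom g.unop)) x).symm)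

variable (M) in
/-- The inclusion `O_M ⊗ R → D_M ⊗ R`. -/
def orToDR : OR d n M ⋙ forget₂ CommRingCat RingCat ⟶ DR d n M where
  app U := RingCat.ofHom (Algebra.TensorProduct.map (AlgHom.id (Base n) (Base n))
    (mulOp d (M := M) U.unop)).toRingHom
  naturality U V f := by
    refine RingCat.hom_ext (RingHom.ext fun x => ?_)
    refine DFunLike.congr_fun
      (f := (Algebra.TensorProduct.map (AlgHom.id (Base n) (Base n))
        (mulOp d (M := M) V.unop)).comp (holRRes d n (M := M) (leOfHom f.unop)))
      (g := (diffOpRRes d n (M := M) (leOfHom f.unop)).comp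
        (Algebra.TensorProduct.map (AlgHom.id (Base n) (Base n))
          (mulOp d (M := M) U.unop))) ?_ x
    ext P
    rfl

/-- The `R`-linear action of `D_M ⊗ R` on `O_M ⊗ R`, over an open subset `V` of `U`. -/
def act (U : Opens M) (V : {V : Opens M // V ≤ U}) :
    DiffOpR d n U →ₐ[Base n] Module.End (Base n) (HolR d n V.1) :=
  (LinearMap.tensorProductEnd ℂ (Base n) (Hol d V.1)).comp
    (Algebra.TensorProduct.map (AlgHom.id (Base n) (Base n))
      ((Pi.evalAlgHom ℂ _ V).comp (DiffOp d U).val))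

theorem act_tmul (U : Opens M) (V : {V : Opens M // V ≤ U}) (r : Base n) (P : DiffOp d U) :
    act d n U V (r ⊗ₜ P) = r • (P.1 V).baseChange (Base n) := rfl

/-! ### Stalks -/

variable (M) in
/-- The stalk of `O_M ⊗ R` at `x`. -/
def StalkOR (x : M) : Type u := (OR d n M).stalk (x : TopCat.of M)

instance (x : M) : CommRing (StalkOR d n M x) :=
  inferInstanceAs (CommRing ((OR d n M).stalk (x : TopCat.of M)))

/-- Germs of sections of `O_M ⊗ R`. -/
def germOR (U : Opens M) (x : M) (hx : x ∈ U) : HolR d n U →+* StalkOR d n M x :=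
  (TopCat.Presheaf.germ (OR d n M) U x hx).hom

instance (x : M) : Algebra (Base n) (StalkOR d n M x) :=
  ((germOR d n ⊤ x trivial).comp Algebra.TensorProduct.includeLeftRingHom).toAlgebra

variable {d n}

/-- An open subset of `M` as an object of the opposite of the category of opens. -/
abbrev opn (U : Opens M) : (Opens (TopCat.of M))ᵒᵖ := op U

/-- The arrow given by an inclusion of open subsets. -/
abbrev ophom {U V : Opens M} (h : V ≤ U) : opn U ⟶ opn V := Quiver.Hom.op (homOfLE h)

/-- A left `D_M ⊗ R`-module regarded as an `O_M ⊗ R`-module. -/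
def asO (F : PresheafOfModules.{u} (DR d n M)) :
    PresheafOfModules.{u} (OR d n M ⋙ forget₂ CommRingCat RingCat) :=
  (PresheafOfModules.restrictScalars (orToDR d n M)).obj F

/-- Sections of a `D_M ⊗ R`-module over `U`. -/
abbrev sec (F : PresheafOfModules.{u} (DR d n M)) (U : Opens M) : Type u :=
  F.obj (opn U)

instance (F : PresheafOfModules.{u} (DR d n M)) (U : Opens M) : Module (DiffOpR d n U) (sec F U) :=
  (F.obj (opn U)).isModule

/-- Restriction of sections. -/
def secRes (F : PresheafOfModules.{u} (DR d n M)) {U V : Opens M} (h : V ≤ U) :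
    sec F U →+ sec F V :=
  (F.presheaf.map (ophom h)).hom

theorem secRes_smul (F : PresheafOfModules.{u} (DR d n M)) {U V : Opens M} (h : V ≤ U)
    (t : DiffOpR d n U) (a : sec F U) :
    secRes F h (t • a) = diffOpRRes d n h t • secRes F h a :=
  F.map_smul (ophom h) t a

/-- The stalk at `x` of a `D_M ⊗ R`-module; it is a module over the local ring of `O_M ⊗ R` at `x`. -/
def Stalk (F : PresheafOfModules.{u} (DR d n M)) (x : M) : Type u :=
  ↑(TopCat.Presheaf.stalk (X := TopCat.of M) (asO F).presheaf x)

instance (F : PresheafOfModules.{u} (DR d n M)) (x : M) : AddCommGroup (Stalk F x) :=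
  inferInstanceAs (AddCommGroup ↑(TopCat.Presheaf.stalk (X := TopCat.of M) (asO F).presheaf x))

instance stalkModule {X : TopCat.{u}} {R : X.Presheaf CommRingCat.{u}}
    (P : PresheafOfModules.{u} (R ⋙ forget₂ CommRingCat RingCat)) (x : X) :
    Module (R.stalk x) ↑(TopCat.Presheaf.stalk P.presheaf x) := inferInstance

instance (F : PresheafOfModules.{u} (DR d n M)) (x : M) : Module (StalkOR d n M x) (Stalk F x) :=
  stalkModule (asO F) x

instance (F : PresheafOfModules.{u} (DR d n M)) (x : M) : Module (Base n) (Stalk F x) :=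
  Module.compHom _ (algebraMap (Base n) (StalkOR d n M x))

/-- Germs of sections. -/
def germ (F : PresheafOfModules.{u} (DR d n M)) (U : Opens M) (x : M) (hx : x ∈ U) :
    sec F U →+ Stalk F x :=
  (TopCat.Presheaf.germ (X := TopCat.of M) (asO F).presheaf U x hx).hom

/-- The inclusion `O_M ⊗ R → D_M ⊗ R` on sections over `U`. -/
def orToDRSec (U : Opens M) : HolR d n U →ₐ[Base n] DiffOpR d n U :=
  Algebra.TensorProduct.map (AlgHom.id (Base n) (Base n)) (mulOp d U)

theorem germ_smul (F : PresheafOfModules.{u} (DR d n M)) (U : Opens M) (x : M) (hx : x ∈ U)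
    (s : HolR d n U) (a : sec F U) :
    germ F U x hx (orToDRSec U s • a) = germOR d n U x hx s • germ F U x hx a :=
  PresheafOfModules.germ_smul (asO F) x U hx s a

/-! ### Quantizations -/

variable (d n) in
/-- Bidifferential operators on `U`: `ℂ`-bilinear sheaf maps `O_U × O_U → O_U` for which, locally,
there is a bound `N` such that fixing one argument gives a differential operator of order less than
`N` in the other one. -/
structure BidiffOp (U : Opens M) where
  app : ∀ V : Opens M, V ≤ U → (Hol d V →ₗ[ℂ] Hol d V →ₗ[ℂ] Hol d V)
  res_app : ∀ (V W : Opens M) (hV : V ≤ U) (h : W ≤ V) (f g : Hol d V),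
    holRes d h (app V hV f g) = app W (h.trans hV) (holRes d h f) (holRes d h g)
  order : ∀ x ∈ U, ∃ W ≤ U, x ∈ W ∧ ∃ N : ℕ, ∀ (V : Opens M) (hV : V ≤ U), V ≤ W →
    ∀ f : Hol d V, Killed (mulPairs ℂ (Hol d V)) N (app V hV f) ∧
      Killed (mulPairs ℂ (Hol d V)) N ((app V hV).flip f)

variable (d n) in
/-- A star product on `O_U ⊗ R`: an associative `R`-bilinear product with
`f ⋆ g = ∑_i B_i(f, g) ħ^i`, where the `B_i` are bidifferential operators and `B_0(f, g) = f g`.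
The function `1` is not required to be the unit. -/
structure StarProduct (U : Opens M) where
  coeff : Fin (n + 1) → BidiffOp d U
  coeff_zero : ∀ (V : Opens M) (hV : V ≤ U) (f g : Hol d V), (coeff 0).app V hV f g = f * g
  mul : ∀ V : Opens M, V ≤ U → (HolR d n V →ₗ[Base n] HolR d n V →ₗ[Base n] HolR d n V)
  mul_tmul : ∀ (V : Opens M) (hV : V ≤ U) (f g : Hol d V),
    mul V hV (1 ⊗ₜ f) (1 ⊗ₜ g) = ∑ i : Fin (n + 1), (hbar n ^ (i : ℕ)) ⊗ₜ (coeff i).app V hV f g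
  assoc : ∀ (V : Opens M) (hV : V ≤ U) (f g h : HolR d n V),
    mul V hV (mul V hV f g) h = mul V hV f (mul V hV g h)

variable (n M) in
/-- Sheaves of associative unital `R`-algebras on `M`. -/
abbrev AlgSheaf : Type (u + 1) := TopCat.Sheaf (AlgCat.{u} (Base n)) (TopCat.of M)

/-- Sections of a sheaf of `R`-algebras. -/
abbrev asec (𝒜 : AlgSheaf n M) (U : Opens M) : Type u :=
  𝒜.presheaf.obj (opn U)

/-- Restriction of sections of a sheaf of `R`-algebras. -/
def ares (𝒜 : AlgSheaf n M) {U V : Opens M} (h : V ≤ U) : asec 𝒜 U →ₐ[Base n] asec 𝒜 V :=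
  (𝒜.presheaf.map (ophom h)).hom

theorem ares_ares (𝒜 : AlgSheaf n M) {U V W : Opens M} (h : V ≤ U) (h' : W ≤ V) (s : asec 𝒜 U) :
    ares 𝒜 h' (ares 𝒜 h s) = ares 𝒜 (h'.trans h) s := by
  have := 𝒜.presheaf.map_comp
    (ophom h)
    (ophom h')
  exact (DFunLike.congr_fun (congrArg AlgCat.Hom.hom this) s).symm

/-- An isomorphism of sheaves of `R`-algebras on sections over `U`. -/
def isoApp {𝒜 ℬ : AlgSheaf n M} (e : 𝒜 ≅ ℬ) (U : Opens M) : asec 𝒜 U ≃ₐ[Base n] asec ℬ U :=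
  AlgEquiv.ofAlgHom (e.hom.hom.app (opn U)).hom
    (e.inv.hom.app (opn U)).hom
    (by
      have := congrArg (fun f => f.hom.app (opn U)) e.inv_hom_id
      exact congrArg AlgCat.Hom.hom this)
    (by
      have := congrArg (fun f => f.hom.app (opn U)) e.hom_inv_id
      exact congrArg AlgCat.Hom.hom this)

theorem isoApp_res {𝒜 ℬ : AlgSheaf n M} (e : 𝒜 ≅ ℬ) {U V : Opens M} (h : V ≤ U) (s : asec 𝒜 U) :
    ares ℬ h (isoApp e U s) = isoApp e V (ares 𝒜 h s) := by
  have := e.hom.hom.naturality (ophom h)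
  exact (DFunLike.congr_fun (congrArg AlgCat.Hom.hom this) s).symm

variable (d) in
/-- An isomorphism, over `U`, of a sheaf of `R`-algebras with `O_U ⊗ R` equipped with a star product.
(A multiplicative bijection automatically matches the units.) -/
structure Trivialization (𝒜 : AlgSheaf n M) (U : Opens M) where
  star : StarProduct d n U
  equiv : ∀ V : Opens M, V ≤ U → (HolR d n V ≃ₗ[Base n] asec 𝒜 V)
  res_equiv : ∀ (V W : Opens M) (hV : V ≤ U) (h : W ≤ V) (f : HolR d n V),
    ares 𝒜 h (equiv V hV f) = equiv W (h.trans hV) (holRRes d n h f)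
  equiv_mul : ∀ (V : Opens M) (hV : V ≤ U) (f g : HolR d n V),
    equiv V hV (star.mul V hV f g) = equiv V hV f * equiv V hV g

variable (d) in
/-- A (neutralized) `⋆`-quantization of `M` is a sheaf of `R`-algebras that is locally isomorphic to
`O_M ⊗ R` with a star product. -/
def IsStarQuantization (𝒜 : AlgSheaf n M) : Prop :=
  ∀ x : M, ∃ U : Opens M, x ∈ U ∧ Nonempty (Trivialization d 𝒜 U)

variable (d n M) in
/-- The category of (neutralized) `⋆`-quantizations; its morphisms are those of sheaves of
`R`-algebras. -/
abbrev StarQuantization : Type (u + 1) :=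
  ObjectProperty.FullSubcategory (fun 𝒜 : AlgSheaf n M => IsStarQuantization d 𝒜)

/-- The section `s` of the quantization and the section `f` of `O_M ⊗ R` have the same reduction in
`O_M`.  The reduction of `s` is computed in local trivializations; it does not depend on them. -/
def EqModHbar (𝒜 : AlgSheaf n M) (V : Opens M) (s : asec 𝒜 V) (f : HolR d n V) : Prop :=
  ∀ x ∈ V, ∃ (W : Opens M) (hW : W ≤ V), x ∈ W ∧ ∃ T : Trivialization d 𝒜 W,
    red n (Hol d W) ((T.equiv W le_rfl).symm (ares 𝒜 hW s)) =
      red n (Hol d W) (holRRes d n hW f)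

def Trivialization.congr {𝒜 ℬ : AlgSheaf n M} {U : Opens M} (T : Trivialization d 𝒜 U)
    (e : 𝒜 ≅ ℬ) : Trivialization d ℬ U where
  star := T.star
  equiv V hV := (T.equiv V hV).trans (isoApp e V).toLinearEquiv
  res_equiv V W hV h f := by
    simp [isoApp_res, T.res_equiv V W hV h]
  equiv_mul V hV f g := by simp [T.equiv_mul]

theorem EqModHbar.congr {𝒜 ℬ : AlgSheaf n M} (e : 𝒜 ≅ ℬ) {V : Opens M} {s : asec 𝒜 V}
    {f : HolR d n V} (h : EqModHbar 𝒜 V s f) : EqModHbar ℬ V (isoApp e V s) f := by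
  intro x hx
  obtain ⟨W, hW, hxW, T, hT⟩ := h x hx
  refine ⟨W, hW, hxW, T.congr e, ?_⟩
  rw [← hT, isoApp_res]
  simp [Trivialization.congr]

variable (d) in
/-- The pairs (left multiplication by `s`, multiplication by `f`), where the section `s` of the
quantization and `f` of `O_M ⊗ R` agree modulo `ħ`. -/
def quantPairs (𝒜 : AlgSheaf n M) (V : Opens M) :
    Set (Module.End (Base n) (asec 𝒜 V) × Module.End (Base n) (HolR d n V)) :=
  {p | ∃ (s : asec 𝒜 V) (f : HolR d n V), EqModHbar 𝒜 V s f ∧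
    p = (LinearMap.mulLeft (Base n) s, LinearMap.mulLeft (Base n) f)}

variable (d) in
/-- Differential operators over `U` from the quantization `𝒜` to `O_M ⊗ R`: `R`-linear maps of sheaves
`A : 𝒜|_U → O_U ⊗ R` such that locally there is an `N` with `A_N = 0` for every sequence
`A_0 = A`, `A_k = f_k A_{k-1} - A_{k-1} s_k`, where `s_k` and `f_k` agree modulo `ħ`. -/
def diffSubgroup (𝒜 : AlgSheaf n M) (U : Opens M) :
    AddSubgroup (∀ V : {V : Opens M // V ≤ U}, asec 𝒜 V.1 →ₗ[Base n] HolR d n V.1) where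
  carrier := {A |
    (∀ (V W : {V : Opens M // V ≤ U}) (h : W.1 ≤ V.1) (s : asec 𝒜 V.1),
      holRRes d n h (A V s) = A W (ares 𝒜 h s)) ∧
    ∀ x ∈ U, ∃ W ≤ U, x ∈ W ∧ ∃ N : ℕ, ∀ V : {V : Opens M // V ≤ U}, V.1 ≤ W →
      Killed (quantPairs d 𝒜 V.1) N (A V)}
  add_mem' := by
    rintro P Q ⟨hP, hP'⟩ ⟨hQ, hQ'⟩
    refine ⟨fun V W h f => ?_, fun x hx => ?_⟩
    · simp [hP V W h, hQ V W h]
    · obtain ⟨W₁, h₁, hx₁, N₁, hN₁⟩ := hP' x hx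
      obtain ⟨W₂, h₂, hx₂, N₂, hN₂⟩ := hQ' x hx
      refine ⟨W₁ ⊓ W₂, inf_le_left.trans h₁, ⟨hx₁, hx₂⟩, max N₁ N₂, fun V hV => ?_⟩
      exact ((hN₁ V (hV.trans inf_le_left)).mono (le_max_left _ _)).add
        ((hN₂ V (hV.trans inf_le_right)).mono (le_max_right _ _))
  zero_mem' := ⟨fun _ _ _ _ => by simp, fun _ hx => ⟨U, le_rfl, hx, 0, fun _ _ => rfl⟩⟩
  neg_mem' := by
    rintro P ⟨hP, hP'⟩
    refine ⟨fun V W h f => ?_, fun x hx => ?_⟩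
    · simp [hP V W h]
    · obtain ⟨W₁, h₁, hx₁, N₁, hN₁⟩ := hP' x hx
      exact ⟨W₁, h₁, hx₁, N₁, fun V hV => by
        rw [Pi.neg_apply, ← neg_one_smul (Base n) (P V)]; exact (hN₁ V hV).smul _⟩

variable (d) in
/-- Sections over `U` of the sheaf `Diff_M(𝒜; O_M ⊗ R)`. -/
def DiffSec (𝒜 : AlgSheaf n M) (U : Opens M) : Type u := ↥(diffSubgroup d 𝒜 U)

instance (𝒜 : AlgSheaf n M) (U : Opens M) : AddCommGroup (DiffSec d 𝒜 U) :=
  inferInstanceAs (AddCommGroup ↥(diffSubgroup d 𝒜 U))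

theorem act_res {U : Opens M} (t : DiffOpR d n U) (V W : {V : Opens M // V ≤ U}) (h : W.1 ≤ V.1)
    (f : HolR d n V.1) : holRRes d n h (act d n U V t f) = act d n U W t (holRRes d n h f) := by
  induction t using TensorProduct.induction_on with
  | zero => simp
  | add t t' ht ht' => simp [ht, ht']
  | tmul r P =>
    induction f using TensorProduct.induction_on with
    | zero => simp
    | add f f' hf hf' => simp [hf, hf']
    | tmul r' f => simp [act_tmul, P.2.1 V W h, TensorProduct.smul_tmul']

theorem act_order {U : Opens M} (t : DiffOpR d n U) (x : M) (hx : x ∈ U) :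
    ∃ W ≤ U, x ∈ W ∧ ∃ N : ℕ, ∀ V : {V : Opens M // V ≤ U}, V.1 ≤ W →
      Killed (mulPairs (Base n) (HolR d n V.1)) N (act d n U V t) := by
  induction t using TensorProduct.induction_on with
  | zero => exact ⟨U, le_rfl, hx, 0, fun V _ => by rw [map_zero]; rfl⟩
  | add t t' ht ht' =>
    obtain ⟨W₁, h₁, hx₁, N₁, hN₁⟩ := ht
    obtain ⟨W₂, h₂, hx₂, N₂, hN₂⟩ := ht'
    refine ⟨W₁ ⊓ W₂, inf_le_left.trans h₁, ⟨hx₁, hx₂⟩, max N₁ N₂, fun V hV => ?_⟩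
    rw [map_add]
    exact ((hN₁ V (hV.trans inf_le_left)).mono (le_max_left _ _)).add
      ((hN₂ V (hV.trans inf_le_right)).mono (le_max_right _ _))
  | tmul r P =>
    obtain ⟨W, hW, hxW, N, hN⟩ := P.2.2 x hx
    exact ⟨W, hW, hxW, N, fun V hV => by
      rw [act_tmul]; exact ((hN V hV).baseChange).smul r⟩

instance (𝒜 : AlgSheaf n M) (U : Opens M) : SMul (DiffOpR d n U) (DiffSec d 𝒜 U) where
  smul t A := ⟨fun V => act d n U V t ∘ₗ A.1 V, fun V W h s => by
      simp [act_res t V W h, A.2.1 V W h], fun x hx => by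
      obtain ⟨W₁, h₁, hx₁, N₁, hN₁⟩ := A.2.2 x hx
      obtain ⟨W₂, h₂, hx₂, N₂, hN₂⟩ := act_order t x hx
      refine ⟨W₁ ⊓ W₂, inf_le_left.trans h₁, ⟨hx₁, hx₂⟩, N₁ + N₂, fun V hV => ?_⟩
      refine Killed.comp ?_ (hN₁ V (hV.trans inf_le_left)) (hN₂ V (hV.trans inf_le_right))
      rintro _ ⟨s, f, hsf, rfl⟩
      exact ⟨_, ⟨s, f, hsf, rfl⟩, ⟨f, rfl⟩⟩⟩

theorem diffSec_smul_apply (𝒜 : AlgSheaf n M) (U : Opens M) (t : DiffOpR d n U)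
    (A : DiffSec d 𝒜 U) (V : {V : Opens M // V ≤ U}) (s : asec 𝒜 V.1) :
    (t • A).1 V s = act d n U V t (A.1 V s) := rfl

theorem diffSec_ext {𝒜 : AlgSheaf n M} {U : Opens M} {A B : DiffSec d 𝒜 U}
    (h : ∀ V s, A.1 V s = B.1 V s) : A = B :=
  Subtype.ext (funext fun V => LinearMap.ext (h V))

instance (𝒜 : AlgSheaf n M) (U : Opens M) : Module (DiffOpR d n U) (DiffSec d 𝒜 U) where
  one_smul A := diffSec_ext fun V s => by
    rw [diffSec_smul_apply, map_one]; rfl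
  mul_smul t t' A := diffSec_ext fun V s => by
    rw [diffSec_smul_apply, map_mul]; rfl
  smul_zero t := diffSec_ext fun V s => map_zero (act d n U V t)
  zero_smul A := diffSec_ext fun V s => by
    rw [diffSec_smul_apply, map_zero]; rfl
  smul_add t A B := diffSec_ext fun V s => map_add (act d n U V t) (A.1 V s) (B.1 V s)
  add_smul t t' A := diffSec_ext fun V s => by
    rw [diffSec_smul_apply, map_add]; rfl

/-- Restriction maps of `Diff_M(𝒜; O_M ⊗ R)`. -/
def diffRes (𝒜 : AlgSheaf n M) {U V : Opens M} (h : V ≤ U) : DiffSec d 𝒜 U →+ DiffSec d 𝒜 V where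
  toFun A := ⟨fun W => A.1 ⟨W.1, W.2.trans h⟩,
    fun V' W' h' f => A.2.1 ⟨V'.1, V'.2.trans h⟩ ⟨W'.1, W'.2.trans h⟩ h' f, fun x hx => by
      obtain ⟨W, hW, hxW, N, hN⟩ := A.2.2 x (h hx)
      exact ⟨W ⊓ V, inf_le_right, ⟨hxW, hx⟩, N,
        fun V' hV' => hN ⟨V'.1, V'.2.trans h⟩ (hV'.trans inf_le_left)⟩⟩
  map_zero' := rfl
  map_add' _ _ := rfl

theorem act_diffOpRRes {U V : Opens M} (h : V ≤ U) (t : DiffOpR d n U)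
    (W : {W : Opens M // W ≤ V}) :
    act d n V W (diffOpRRes d n h t) = act d n U ⟨W.1, W.2.trans h⟩ t := by
  have key : (act d n V W).comp (diffOpRRes d n h) = act d n U ⟨W.1, W.2.trans h⟩ := by
    ext P
    rfl
  exact DFunLike.congr_fun key t

theorem diffRes_smul (𝒜 : AlgSheaf n M) {U V : Opens M} (h : V ≤ U) (t : DiffOpR d n U)
    (A : DiffSec d 𝒜 U) : diffRes 𝒜 h (t • A) = diffOpRRes d n h t • diffRes 𝒜 h A :=
  diffSec_ext fun W s => by
    rw [diffSec_smul_apply, act_diffOpRRes]; rfl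

variable (d) in
/-- `Diff_M(𝒜; O_M ⊗ R)` as a presheaf of abelian groups. -/
def diffPresheaf (𝒜 : AlgSheaf n M) : (Opens (TopCat.of M))ᵒᵖ ⥤ Ab.{u} where
  obj U := AddCommGrpCat.of (DiffSec d 𝒜 (U.unop : Opens M))
  map f := AddCommGrpCat.ofHom (diffRes 𝒜 (leOfHom f.unop))
  map_id _ := rfl
  map_comp _ _ := rfl

instance (𝒜 : AlgSheaf n M) (U : (Opens (TopCat.of M))ᵒᵖ) :
    Module ((DR d n M).obj U) ((diffPresheaf d 𝒜).obj U) :=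
  inferInstanceAs (Module (DiffOpR d n (U.unop : Opens M))
    (DiffSec d 𝒜 (U.unop : Opens M)))

variable (d) in
/-- `Diff_M(𝒜; O_M ⊗ R)` as a left module over `D_M ⊗ R`, which acts by composition. -/
def diffModule (𝒜 : AlgSheaf n M) : PresheafOfModules.{u} (DR d n M) :=
  PresheafOfModules.ofPresheaf (diffPresheaf d 𝒜)
    (fun _ _ f t A => diffRes_smul 𝒜 (leOfHom f.unop) t A)

/-- The map `A ↦ A ∘ e⁻¹` on sections. -/
def diffCongrSec {𝒜 ℬ : AlgSheaf n M} (e : 𝒜 ≅ ℬ) (U : Opens M) :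
    DiffSec d 𝒜 U →ₗ[DiffOpR d n U] DiffSec d ℬ U where
  toFun A := ⟨fun V => A.1 V ∘ₗ (isoApp e.symm V.1).toLinearMap, fun V W h s => by
      simp [A.2.1 V W h, isoApp_res], fun x hx => by
      obtain ⟨W, hW, hxW, N, hN⟩ := A.2.2 x hx
      refine ⟨W, hW, hxW, 1 + N, fun V hV => ?_⟩
      refine Killed.comp (E₁ := {p | p.2 ∘ₗ (isoApp e.symm V.1).toLinearMap -
        (isoApp e.symm V.1).toLinearMap ∘ₗ p.1 = 0}) ?_ (fun p hp => hp) (hN V hV)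
      rintro _ ⟨s, f, hsf, rfl⟩
      refine ⟨_, ?_, ⟨_, f, hsf.congr e.symm, rfl⟩⟩
      ext s'
      simp⟩
  map_add' _ _ := rfl
  map_smul' _ _ := rfl

/-- The map `A ↦ A ∘ e⁻¹` induced by an isomorphism `e` of quantizations. -/
def diffCongr {𝒜 ℬ : AlgSheaf n M} (e : 𝒜 ≅ ℬ) : diffModule d 𝒜 ⟶ diffModule d ℬ :=
  PresheafOfModules.homMk
    { app := fun U => AddCommGrpCat.ofHom
        (diffCongrSec e (U.unop : Opens M)).toAddMonoidHom }
    (fun U t A => (diffCongrSec (d := d) e (U.unop : Opens M)).map_smul t A)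

/-! ### Coalgebras in left D-modules and their deformations -/

section Coalgebras

variable (F : PresheafOfModules.{u} (DR d n M))

/-- Over `U`, the coproduct of the section `a` is the section `∑ p ⊗ q`, `(p, q) ∈ l`, of the tensor
product over `O_M ⊗ R`. -/
def ComulRep (C : ∀ x : M, Coalgebra (StalkOR d n M x) (Stalk F x)) {U : Opens M} (a : sec F U)
    (l : List (sec F U × sec F U)) : Prop :=
  ∀ (x : M) (hx : x ∈ U), (C x).comul (germ F U x hx a) =
    (l.map fun p => germ F U x hx p.1 ⊗ₜ[StalkOR d n M x] germ F U x hx p.2).sum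

/-- Over `U`, the counit of the section `a` is the function `e`. -/
def CounitRep (C : ∀ x : M, Coalgebra (StalkOR d n M x) (Stalk F x)) {U : Opens M} (a : sec F U)
    (e : HolR d n U) : Prop :=
  ∀ (x : M) (hx : x ∈ U), (C x).counit (germ F U x hx a) = germOR d n U x hx e

/-- Vector fields, that is, derivations of `O_U`. -/
def IsVectorField {U : Opens M} (τ : DiffOp d U) : Prop :=
  ∀ (V : {V : Opens M // V ≤ U}) (f g : Hol d V.1),
    τ.1 V (f * g) = τ.1 V f * g + f * τ.1 V g

/-- The structure of a coalgebra in the tensor category of left `D_M ⊗ R`-modules (with tensor product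
over `O_M ⊗ R`, and unit object `O_M ⊗ R`) on `F`.  The coproduct `F → F ⊗ F` and the counit
`F → O_M ⊗ R` are sheaf maps linear over `O_M ⊗ R`; they are given by the maps on stalks (the
stalk of the sheaf tensor product being the tensor product of the stalks), which have to send germs of
sections to germs of sections (`comul_local`, `counit_local`).  The coproduct is linear over
`D_M ⊗ R`: since `D_M` is generated by functions and vector fields, and a vector field acts on the
tensor product by the Leibniz rule, this is `comul_leibniz`.  The counit is linear over `D_M ⊗ R` by
`counit_linear`.  Coassociativity and the counit axioms are those of `Coalgebra`; cocommutativity is not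
required. -/
structure DCoalgebra where
  isSheaf : TopCat.Presheaf.IsSheaf (X := TopCat.of M) F.presheaf
  coalg : ∀ x : M, Coalgebra (StalkOR d n M x) (Stalk F x)
  comul_local : ∀ (U : Opens M) (a : sec F U), ∀ x ∈ U, ∃ (V : Opens M) (h : V ≤ U), x ∈ V ∧
    ∃ l, ComulRep F coalg (secRes F h a) l
  counit_local : ∀ (U : Opens M) (a : sec F U), ∀ x ∈ U, ∃ (V : Opens M) (h : V ≤ U), x ∈ V ∧
    ∃ e, CounitRep F coalg (secRes F h a) e
  comul_leibniz : ∀ (U : Opens M) (τ : DiffOp d U), IsVectorField τ →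
    ∀ (a : sec F U) (l : List (sec F U × sec F U)), ComulRep F coalg a l →
      ComulRep F coalg (((1 : Base n) ⊗ₜ[ℂ] τ : DiffOpR d n U) • a)
        (l.flatMap fun p => [(((1 : Base n) ⊗ₜ[ℂ] τ : DiffOpR d n U) • p.1, p.2),
          (p.1, ((1 : Base n) ⊗ₜ[ℂ] τ : DiffOpR d n U) • p.2)])
  counit_linear : ∀ (U : Opens M) (t : DiffOpR d n U) (a : sec F U) (e : HolR d n U),
    CounitRep F coalg a e → CounitRep F coalg (t • a) (act d n U ⟨U, le_rfl⟩ t e)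

/-- The structure on `F` of an `R`-deformation of the coalgebra `D_M`: a coalgebra in left
`D_M ⊗ R`-modules, flat over `R`, with an isomorphism `F/ħF ≃ D_M` of coalgebras in left
`D_M`-modules, given as an epimorphism of sheaves `reduce : F → D_M` with kernel `ħF`.  The coproduct of
`D_M` is the one for which `Δ(P) = ∑ P' ⊗ P''` means `P(f g) = ∑ P'(f) P''(g)`, and the counit of `D_M` is
`P ↦ P(1)`. -/
structure Deformation extends DCoalgebra F where
  flat : ∀ x : M, Module.Flat (Base n) (Stalk F x)
  reduce : ∀ U : Opens M, sec F U →+ DiffOp d U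
  reduce_res : ∀ (U V : Opens M) (h : V ≤ U) (a : sec F U),
    reduce V (secRes F h a) = diffOpRes d h (reduce U a)
  reduce_smul : ∀ (U : Opens M) (t : DiffOpR d n U) (a : sec F U),
    reduce U (t • a) = red n (DiffOp d U) t * reduce U a
  reduce_surj : ∀ (U : Opens M) (P : DiffOp d U), ∀ x ∈ U, ∃ (V : Opens M) (h : V ≤ U), x ∈ V ∧
    ∃ a : sec F V, reduce V a = diffOpRes d h P
  reduce_ker : ∀ (U : Opens M) (a : sec F U), reduce U a = 0 →
    ∀ x ∈ U, ∃ (V : Opens M) (h : V ≤ U), x ∈ V ∧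
      ∃ b : sec F V, secRes F h a = (hbar n ⊗ₜ[ℂ] (1 : DiffOp d V) : DiffOpR d n V) • b
  reduce_comul : ∀ (U : Opens M) (a : sec F U) (l : List (sec F U × sec F U)),
    ComulRep F coalg a l → ∀ (V : {V : Opens M // V ≤ U}) (f g : Hol d V.1),
      (reduce U a).1 V (f * g) =
        (l.map fun p => (reduce U p.1).1 V f * (reduce U p.2).1 V g).sum
  reduce_counit : ∀ (U : Opens M) (a : sec F U) (e : HolR d n U), CounitRep F coalg a e →
    (reduce U a).1 ⟨U, le_rfl⟩ 1 = red n (Hol d U) e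

end Coalgebras

/-- A morphism of modules on sections over `U`. -/
def homSec {F G : PresheafOfModules.{u} (DR d n M)} (f : F ⟶ G) (U : Opens M) :
    sec F U →+ sec G U :=
  (f.app (opn U)).hom.toAddMonoidHom

/-- A morphism of `D_M ⊗ R`-modules is a morphism of `R`-deformations if it is compatible with the
coproducts, the counits and the identifications of the reductions with `D_M`. -/
structure IsDeformationHom {F G : PresheafOfModules.{u} (DR d n M)} (S : Deformation F)
    (T : Deformation G) (f : F ⟶ G) : Prop where
  comul : ∀ (U : Opens M) (a : sec F U) (l : List (sec F U × sec F U)),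
    ComulRep F S.coalg a l →
      ComulRep G T.coalg (homSec f U a) (l.map fun p => (homSec f U p.1, homSec f U p.2))
  counit : ∀ (U : Opens M) (a : sec F U) (e : HolR d n U),
    CounitRep F S.coalg a e → CounitRep G T.coalg (homSec f U a) e
  reduce : ∀ (U : Opens M) (a : sec F U), T.reduce U (homSec f U a) = S.reduce U a

theorem IsDeformationHom.id {F : PresheafOfModules.{u} (DR d n M)} (S : Deformation F) :
    IsDeformationHom S S (𝟙 F) where
  comul U a l h := by
    have e : (l.map fun p => (homSec (𝟙 F) U p.1, homSec (𝟙 F) U p.2)) = l := List.map_id l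
    rw [e]; exact h
  counit U a e h := h
  reduce U a := rfl

theorem IsDeformationHom.comp {F G H : PresheafOfModules.{u} (DR d n M)} {S : Deformation F}
    {T : Deformation G} {Q : Deformation H} {f : F ⟶ G} {g : G ⟶ H}
    (hf : IsDeformationHom S T f) (hg : IsDeformationHom T Q g) :
    IsDeformationHom S Q (f ≫ g) where
  comul U a l h := by
    have := hg.comul U _ _ (hf.comul U a l h)
    rw [List.map_map] at this
    exact this
  counit U a e h := hg.counit U _ e (hf.counit U a e h)
  reduce U a := (hg.reduce U _).trans (hf.reduce U a)

variable (d n M) in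
/-- `R`-deformations of `D_M` as a coalgebra in left `D_M`-modules. -/
structure CoalgDeformation where
  carrier : PresheafOfModules.{u} (DR d n M)
  str : Deformation carrier

instance : Category (CoalgDeformation d n M) where
  Hom X Y := {f : X.carrier ⟶ Y.carrier // IsDeformationHom X.str Y.str f}
  id X := ⟨𝟙 _, IsDeformationHom.id X.str⟩
  comp f g := ⟨f.1 ≫ g.1, f.2.comp g.2⟩

/-! ### The functor -/

/-- The natural structure of an `R`-deformation of `D_M` on `Diff_M(𝒜; O_M ⊗ R)`: the coproduct is
the composition with the multiplication of `𝒜`, i.e. `Δ(A) = ∑ A' ⊗ A''` means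
`A(f g) = ∑ A'(f) A''(g)`, the counit is `A ↦ A(1)`, and the reduction sends `A` to the operator on `O_M`
that `A` induces modulo `ħ`. -/
structure IsCanonical (𝒜 : AlgSheaf n M) (S : Deformation (diffModule d 𝒜)) : Prop where
  comul : ∀ (U : Opens M) (A : DiffSec d 𝒜 U) (l : List (DiffSec d 𝒜 U × DiffSec d 𝒜 U)),
    ComulRep (diffModule d 𝒜) S.coalg (U := U) A l →
      ∀ (V : {V : Opens M // V ≤ U}) (f g : asec 𝒜 V.1),
        A.1 V (f * g) = (l.map fun p => p.1.1 V f * p.2.1 V g).sum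
  counit : ∀ (U : Opens M) (A : DiffSec d 𝒜 U) (e : HolR d n U),
    CounitRep (diffModule d 𝒜) S.coalg (U := U) A e → e = A.1 ⟨U, le_rfl⟩ 1
  reduce : ∀ (U : Opens M) (A : DiffSec d 𝒜 U) (V : {V : Opens M // V ≤ U}) (s : asec 𝒜 V.1)
    (f : HolR d n V.1), EqModHbar 𝒜 V.1 s f →
      (S.reduce U A).1 V (red n (Hol d V.1) f) = red n (Hol d V.1) (A.1 V s)

theorem diffCongr_id (𝒜 : AlgSheaf n M) :
    diffCongr (d := d) (Iso.refl 𝒜) = 𝟙 (diffModule d 𝒜) := by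
  rfl

theorem diffCongr_comp {𝒜 ℬ 𝒞 : AlgSheaf n M} (e : 𝒜 ≅ ℬ) (e' : ℬ ≅ 𝒞) :
    diffCongr (d := d) (e ≪≫ e') = diffCongr e ≫ diffCongr e' := by
  rfl

variable (d n M) in
/-- An isomorphism of quantizations as an isomorphism of sheaves of `R`-algebras. -/
def quantIso {X Y : StarQuantization d n M} (φ : X ≅ Y) : X.obj ≅ Y.obj :=
  (ObjectProperty.ι _).mapIso φ

/-- The functor `𝒜 ↦ Diff_M(𝒜; O_M ⊗ R)`, `e ↦ (A ↦ A ∘ e⁻¹)` from the groupoid of `⋆`-quantizations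
to the groupoid of `R`-deformations of the coalgebra `D_M`. -/
def quantFunctor (S : ∀ X : StarQuantization d n M, Deformation (diffModule d X.obj))
    (h : ∀ (X Y : StarQuantization d n M) (φ : X ≅ Y),
      IsDeformationHom (S X) (S Y) (diffCongr (quantIso d n M φ))) :
    Core (StarQuantization d n M) ⥤ Core (CoalgDeformation d n M) :=
  Core.functorToCore
    { obj X := ⟨diffModule d X.of.obj, S X.of⟩
      map φ := ⟨diffCongr (quantIso d n M φ.iso), h _ _ φ.iso⟩
      map_id X := Subtype.ext (diffCongr_id X.of.obj)
      map_comp φ ψ := Subtype.ext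
        (diffCongr_comp (quantIso d n M φ.iso) (quantIso d n M ψ.iso)) }

end

end StarQuant

/-!
A star product deforms the multiplication of functions, and dually the coproduct of `D_M`.  The proof
makes this duality precise, in both directions.

*From a quantization to a deformation.*  In a trivialization of the quantization `𝒜`, the multiplication
by a section differs from the multiplication by a function only by `ħ` times an operator of bounded
order.  As `ħ` is nilpotent, being of finite order with respect to the one or the other multiplication
is the same condition (`exists_killed_perturbed`, `exists_killed_of_perturbed`).  Hence the inverse of the
trivialization is a free generator of the `D_M ⊗ R`-module `Diff_M(𝒜; O_M ⊗ R)`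
(`Trivialization.isGen_gen`).  In coordinates the coefficients of a differential operator are
combinations of finitely many of its values (`Coordinates.taylor`).  So the evaluations at sections of
`𝒜` separate the germs of operators, and even of tensors (`Separates`, `IsGen.separates`), and there is at
most one coproduct dual to the multiplication of `𝒜`.  It exists, because the operator `(f, g) ↦ t(f ⋆ g)` is
a bidifferential operator, which by the Taylor expansion is a sum of products of differential operators
(`BidiffOp.exists_factor`, `exists_canRep`).  The axioms of a coalgebra are the associativity and the unit
of `𝒜`.  This gives the unique canonical structure (`exists_isCanonical`, `IsCanonical.eq`).

*Full faithfulness.*  A `D_M ⊗ R`-linear map `Diff_M(𝒜; O_M ⊗ R) → O_M ⊗ R` is determined by its value at a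
free generator, and is therefore the evaluation at a section of `𝒜` (`exists_dval_eq`, `asec_ext`).  So
`𝒜` is recovered as the `D_M ⊗ R`-linear dual of its module of differential operators, its
multiplication being the convolution; isomorphisms of deformations are the same as isomorphisms of
quantizations (`exists_diffCongr_eq`, `diffCongr_injective`).

*From a deformation to a quantization.*  A local lift of `1 ∈ D_M` to a deformation `F` is a free
generator: it generates since `ħ` is nilpotent, and it is free since `F` is flat over `R`
(`Deformation.isGen`).  The `D_M ⊗ R`-linear maps `F → O_M ⊗ R` form a sheaf of algebras under
convolution (`dualSheaf`).  The value at the generator `ε` identifies it locally with `O_M ⊗ R`, and if the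
coproduct of `ε` is `∑ t ε ⊗ t' ε`, the multiplication becomes the star product
`(f, g) ↦ ∑ t(f) t'(g)` (`exists_dualTrivialization`).  Finally `F` is isomorphic to the module of
differential operators on its dual: both are free on corresponding generators
(`isDeformationHom_bidualHom`, `IsDeformationHom.nonempty_iso`).
-/

namespace StarQuant

noncomputable section

/-! ### The base ring and expansions in powers of `ħ` -/

theorem hbar_pow_eq_zero (n k : ℕ) (h : n + 1 ≤ k) : hbar n ^ k = 0 := by
  refine pow_eq_zero_of_le h ?_
  exact Ideal.Quotient.eq_zero_iff_mem.2 (Ideal.mem_span_singleton_self _)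

/-- `R` as a monogenic extension of `ℂ`. -/
def adjoinRootEquiv (n : ℕ) : AdjoinRoot ((Polynomial.X : Polynomial ℂ) ^ (n + 1)) ≃ₗ[ℂ] Base n where
  toFun x := x
  invFun x := x
  map_add' _ _ := rfl
  map_smul' _ _ := rfl
  left_inv _ := rfl
  right_inv _ := rfl

/-- The basis `1, ħ, …, ħⁿ` of `R` over `ℂ`. -/
def baseBasis (n : ℕ) : Module.Basis (Fin (n + 1)) ℂ (Base n) :=
  (((AdjoinRoot.powerBasis' (Polynomial.monic_X_pow (R := ℂ) (n + 1))).basis).reindex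
    (finCongr (by rw [AdjoinRoot.powerBasis'_dim, Polynomial.natDegree_X_pow]))).map
    (adjoinRootEquiv n)

theorem baseBasis_apply (n : ℕ) (i : Fin (n + 1)) : baseBasis n i = hbar n ^ (i : ℕ) := by
  rw [baseBasis, Module.Basis.map_apply, Module.Basis.reindex_apply, PowerBasis.basis_eq_pow]
  rfl

section Coef

variable {n : ℕ} {A B : Type*} [AddCommMonoid A] [Module ℂ A] [AddCommMonoid B] [Module ℂ B]

/-- The coefficient of `ħ^i` of an element of `R ⊗ A`. -/
def coef (i : Fin (n + 1)) : Base n ⊗[ℂ] A →ₗ[ℂ] A :=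
  (TensorProduct.lid ℂ A).toLinearMap ∘ₗ LinearMap.rTensor A ((baseBasis n).coord i)

theorem coef_tmul (i : Fin (n + 1)) (r : Base n) (a : A) :
    coef i (r ⊗ₜ[ℂ] a) = (baseBasis n).coord i r • a := rfl

theorem coef_hbar_tmul (i j : Fin (n + 1)) (a : A) :
    coef i ((hbar n ^ (j : ℕ)) ⊗ₜ[ℂ] a) = if j = i then a else 0 := by
  rw [coef_tmul, ← baseBasis_apply, Module.Basis.coord_apply, Module.Basis.repr_self,
    Finsupp.single_apply]
  split_ifs <;> simp

theorem sum_coef (t : Base n ⊗[ℂ] A) :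
    ∑ i : Fin (n + 1), (hbar n ^ (i : ℕ)) ⊗ₜ[ℂ] coef i t = t := by
  induction t using TensorProduct.induction_on with
  | zero => simp
  | add t t' h h' =>
    conv_rhs => rw [← h, ← h']
    rw [← Finset.sum_add_distrib]
    exact Finset.sum_congr rfl fun i _ => by rw [map_add, TensorProduct.tmul_add]
  | tmul r a =>
    conv_rhs => rw [← (baseBasis n).sum_repr r, TensorProduct.sum_tmul]
    refine Finset.sum_congr rfl fun i _ => ?_
    rw [coef_tmul, baseBasis_apply, TensorProduct.tmul_smul, TensorProduct.smul_tmul']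
    rfl

theorem coef_sum (a : Fin (n + 1) → A) (i : Fin (n + 1)) :
    coef i (∑ j : Fin (n + 1), (hbar n ^ (j : ℕ)) ⊗ₜ[ℂ] a j) = a i := by
  rw [map_sum]
  simp only [coef_hbar_tmul]
  simp

theorem coef_ext {t t' : Base n ⊗[ℂ] A} (h : ∀ i, coef i t = coef i t') : t = t' := by
  rw [← sum_coef t, ← sum_coef t']
  simp only [h]

theorem coef_lTensor (f : A →ₗ[ℂ] B) (i : Fin (n + 1)) (t : Base n ⊗[ℂ] A) :
    coef i (f.lTensor (Base n) t) = f (coef i t) := by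
  induction t using TensorProduct.induction_on with
  | zero => simp
  | add t t' h h' => simp only [map_add, h, h']
  | tmul r a => simp [coef_tmul]

/-- An element with constant term zero is divisible by `ħ`. -/
theorem eq_hbar_smul_of_coef_zero {t : Base n ⊗[ℂ] A} (h : coef 0 t = 0) :
    ∃ t' : Base n ⊗[ℂ] A, t = hbar n • t' := by
  refine ⟨∑ i : Fin n, (hbar n ^ (i : ℕ)) ⊗ₜ[ℂ] coef i.succ t, ?_⟩
  conv_lhs => rw [← sum_coef t]
  rw [Fin.sum_univ_succ, h, TensorProduct.tmul_zero, zero_add, Finset.smul_sum]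
  refine Finset.sum_congr rfl fun i _ => ?_
  rw [TensorProduct.smul_tmul', Fin.val_succ, pow_succ', smul_eq_mul]

end Coef

theorem aug_eq_coord (n : ℕ) (r : Base n) : aug n r = (baseBasis n).coord 0 r := by
  have : (aug n).toLinearMap = (baseBasis n).coord 0 := by
    refine (baseBasis n).ext fun i => ?_
    rw [Module.Basis.coord_apply, Module.Basis.repr_self, baseBasis_apply]
    have h : aug n (hbar n) = 0 := by
      change Polynomial.aeval (0 : ℂ) Polynomial.X = 0
      simp
    rw [AlgHom.toLinearMap_apply, map_pow, h, Finsupp.single_apply]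
    by_cases hi : i = 0
    · subst hi
      rw [if_pos rfl, Fin.val_zero, pow_zero]
    · rw [if_neg hi, zero_pow (fun h => hi (Fin.ext h))]
  exact DFunLike.congr_fun this r

section Red

variable {n : ℕ} {A : Type u} [Ring A] [Algebra ℂ A]

theorem red_tmul (r : Base n) (a : A) : red n A (r ⊗ₜ[ℂ] a) = aug n r • a := rfl

theorem red_eq_coef (t : Base n ⊗[ℂ] A) : red n A t = coef 0 t := by
  induction t using TensorProduct.induction_on with
  | zero => simp
  | add t t' h h' => simp only [map_add, h, h']
  | tmul r a => rw [red_tmul, coef_tmul, aug_eq_coord]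

theorem aug_hbar : aug n (hbar n) = 0 := by
  change Polynomial.aeval (0 : ℂ) Polynomial.X = 0
  simp

theorem red_smul (r : Base n) (t : Base n ⊗[ℂ] A) : red n A (r • t) = aug n r • red n A t := by
  induction t using TensorProduct.induction_on with
  | zero => simp
  | add t t' h h' => rw [smul_add, map_add, h, h', map_add, smul_add]
  | tmul s a => rw [TensorProduct.smul_tmul', red_tmul, red_tmul, smul_eq_mul, map_mul, mul_smul]

theorem red_hbar_smul (t : Base n ⊗[ℂ] A) : red n A (hbar n • t) = 0 := by
  rw [red_smul, aug_hbar, zero_smul]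

theorem red_one_tmul (a : A) : red n A ((1 : Base n) ⊗ₜ[ℂ] a) = a := by
  rw [red_tmul, map_one, one_smul]

theorem eq_hbar_smul_of_red_eq {t t' : Base n ⊗[ℂ] A} (h : red n A t = red n A t') :
    ∃ q : Base n ⊗[ℂ] A, t = t' + hbar n • q := by
  obtain ⟨q, hq⟩ := eq_hbar_smul_of_coef_zero (t := t - t')
    (by rw [← red_eq_coef, map_sub, h, sub_self])
  exact ⟨q, by rw [← hq]; abel⟩

end Red

/-! ### Iterated commutators -/

section Killed

variable {k : Type*} [CommRing k] {P Q S : Type*} [AddCommGroup P] [Module k P]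
  [AddCommGroup Q] [Module k Q] [AddCommGroup S] [Module k S]

theorem Killed.neg {E : Set (Module.End k P × Module.End k Q)} {N : ℕ} {A : P →ₗ[k] Q}
    (hA : Killed E N A) : Killed E N (-A) := by
  rw [← neg_one_smul k A]
  exact hA.smul _

theorem Killed.sub {E : Set (Module.End k P × Module.End k Q)} {N : ℕ} {A B : P →ₗ[k] Q}
    (hA : Killed E N A) (hB : Killed E N B) : Killed E N (A - B) := by
  rw [sub_eq_add_neg]
  exact hA.add hB.neg

theorem Killed.sum {ι : Type*} {E : Set (Module.End k P × Module.End k Q)} {N : ℕ}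
    (s : Finset ι) {A : ι → (P →ₗ[k] Q)} (hA : ∀ i ∈ s, Killed E N (A i)) :
    Killed E N (∑ i ∈ s, A i) :=
  Finset.sum_induction _ (Killed E N) (fun _ _ => Killed.add) (Killed.zero E N) hA

/-- Composition on the right with a map intertwining the first components. -/
theorem Killed.comp_right {E : Set (Module.End k Q × Module.End k S)}
    {E' : Set (Module.End k P × Module.End k S)} (T : P →ₗ[k] Q)
    (h : ∀ p ∈ E', ∃ q, T ∘ₗ p.1 = q ∘ₗ T ∧ (q, p.2) ∈ E) {N : ℕ} {A : Q →ₗ[k] S}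
    (hA : Killed E N A) : Killed E' N (A ∘ₗ T) := by
  induction N generalizing A with
  | zero =>
    have hA0 : A = 0 := hA
    subst hA0
    exact LinearMap.zero_comp T
  | succ N ih =>
    intro p hp
    obtain ⟨q, h1, h2⟩ := h p hp
    have := ih (hA _ h2)
    rw [LinearMap.sub_comp, LinearMap.comp_assoc, LinearMap.comp_assoc, ← h1,
      ← LinearMap.comp_assoc] at this
    exact this

end Killed

section MulKilled

variable {k A : Type*} [CommRing k] [CommRing A] [Algebra k A]

/-- The orders of differential operators add under composition. -/
theorem Killed.mulPairs_comp {a b : ℕ} {P Q : Module.End k A} (hP : Killed (mulPairs k A) a P)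
    (hQ : Killed (mulPairs k A) b Q) : Killed (mulPairs k A) (a + b) (Q ∘ₗ P) := by
  refine Killed.comp ?_ hP hQ
  rintro _ ⟨f, rfl⟩
  exact ⟨_, ⟨f, rfl⟩, ⟨f, rfl⟩⟩

theorem killed_mulLeft (f : A) : Killed (mulPairs k A) 1 (LinearMap.mulLeft k f) := by
  rintro _ ⟨g, rfl⟩
  change _ = _
  ext h
  simp [mul_left_comm]

end MulKilled

/-- An operator of finite order for multiplication operators stays of finite order when the
multiplication operators are perturbed by `ħ` times operators of bounded order.  The power `ħ^k` makes
the induction work: a commutator either lowers the order or raises the power of `ħ`. -/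
theorem exists_killed_perturbed (n N k m : ℕ) : ∃ c : ℕ, ∀ (A : Type u) [CommRing A]
    [Algebra (Base n) A] (E : Set (Module.End (Base n) A × Module.End (Base n) A)),
    (∀ p ∈ E, ∃ (f : A) (Q₁ Q₂ : Module.End (Base n) A), Killed (mulPairs (Base n) A) N Q₁ ∧
      Killed (mulPairs (Base n) A) N Q₂ ∧ p = (LinearMap.mulLeft (Base n) f + hbar n • Q₁,
        LinearMap.mulLeft (Base n) f + hbar n • Q₂)) →
    ∀ Q : Module.End (Base n) A, Killed (mulPairs (Base n) A) m Q → Killed E c (hbar n ^ k • Q) := by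
  obtain ⟨j, hj⟩ : ∃ j, n + 1 ≤ k + j := ⟨n + 1, by omega⟩
  induction j generalizing k m with
  | zero =>
    refine ⟨0, fun A _ _ E _ Q _ => ?_⟩
    rw [hbar_pow_eq_zero n k (by omega), zero_smul]
    exact Killed.zero E 0
  | succ j ihj =>
    induction m with
    | zero =>
      refine ⟨0, fun A _ _ E _ Q hQ => ?_⟩
      have hQ0 : Q = 0 := hQ
      rw [hQ0, smul_zero]
      exact Killed.zero E 0
    | succ m ihm =>
      obtain ⟨c₁, hc₁⟩ := ihm
      obtain ⟨c₂, hc₂⟩ := ihj (k + 1) (m + 1 + N) (by omega)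
      refine ⟨max c₁ c₂ + 1, fun A _ _ E hE Q hQ p hp => ?_⟩
      obtain ⟨f, Q₁, Q₂, h₁, h₂, rfl⟩ := hE p hp
      -- The commutator of `ħ^k Q` is `ħ^k [f, Q]`, of lower order, plus a multiple of `ħ^(k+1)`.
      have key : (LinearMap.mulLeft (Base n) f + hbar n • Q₂) ∘ₗ (hbar n ^ k • Q) -
          (hbar n ^ k • Q) ∘ₗ (LinearMap.mulLeft (Base n) f + hbar n • Q₁) =
          hbar n ^ k • (LinearMap.mulLeft (Base n) f ∘ₗ Q - Q ∘ₗ LinearMap.mulLeft (Base n) f) +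
          hbar n ^ (k + 1) • (Q₂ ∘ₗ Q - Q ∘ₗ Q₁) := by
        simp only [LinearMap.add_comp, LinearMap.comp_add, LinearMap.smul_comp, LinearMap.comp_smul,
          smul_sub, smul_smul, smul_add, pow_succ]
        rw [mul_comm (hbar n) (hbar n ^ k)]
        abel
      rw [key]
      refine Killed.add ((hc₁ A E hE _ (hQ _ ⟨f, rfl⟩)).mono (le_max_left _ _))
        ((hc₂ A E hE _ ?_).mono (le_max_right _ _))
      refine Killed.sub (hQ.mulPairs_comp h₂) ?_
      rw [add_comm (m + 1) N]
      exact h₁.mulPairs_comp hQ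

section CoefOp

variable {n : ℕ} {A : Type u} [CommRing A] [Algebra ℂ A]

/-- The coefficient of `ħ^i` of an `R`-linear endomorphism of `R ⊗ A`. -/
def coefOp (i : Fin (n + 1)) (Q : Module.End (Base n) (Base n ⊗[ℂ] A)) : Module.End ℂ A :=
  coef i ∘ₗ Q.restrictScalars ℂ ∘ₗ TensorProduct.mk ℂ (Base n) A 1

theorem coefOp_apply (i : Fin (n + 1)) (Q : Module.End (Base n) (Base n ⊗[ℂ] A)) (f : A) :
    coefOp i Q f = coef i (Q ((1 : Base n) ⊗ₜ[ℂ] f)) := rfl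

theorem coef_one_tmul_mul (i : Fin (n + 1)) (f : A) (t : Base n ⊗[ℂ] A) :
    coef i (((1 : Base n) ⊗ₜ[ℂ] f) * t) = f * coef i t := by
  induction t using TensorProduct.induction_on with
  | zero => simp
  | add t t' h h' => rw [mul_add, map_add, h, h', map_add, mul_add]
  | tmul r a => rw [Algebra.TensorProduct.tmul_mul_tmul, coef_tmul, coef_tmul, one_mul,
      mul_smul_comm]

/-- The coefficients of an operator of finite order are of finite order. -/
theorem killed_coefOp {N : ℕ} {Q : Module.End (Base n) (Base n ⊗[ℂ] A)}
    (hQ : Killed (mulPairs (Base n) (Base n ⊗[ℂ] A)) N Q) (i : Fin (n + 1)) :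
    Killed (mulPairs ℂ A) N (coefOp i Q) := by
  induction N generalizing Q with
  | zero =>
    have hQ0 : Q = 0 := hQ
    subst hQ0
    change _ = _
    ext f
    simp [coefOp_apply]
  | succ N ih =>
    rintro _ ⟨f, rfl⟩
    have := ih (hQ _ ⟨(1 : Base n) ⊗ₜ[ℂ] f, rfl⟩)
    convert this using 1
    ext g
    simp only [LinearMap.sub_apply, LinearMap.comp_apply, LinearMap.mulLeft_apply, coefOp_apply,
      map_sub, coef_one_tmul_mul, Algebra.TensorProduct.tmul_mul_tmul, one_mul]

theorem tmul_linear_ext {B : Type*} [AddCommGroup B] [Module (Base n) B]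
    {Q Q' : Base n ⊗[ℂ] A →ₗ[Base n] B}
    (h : ∀ f : A, Q ((1 : Base n) ⊗ₜ[ℂ] f) = Q' ((1 : Base n) ⊗ₜ[ℂ] f)) : Q = Q' := by
  refine LinearMap.ext fun t => ?_
  induction t using TensorProduct.induction_on with
  | zero => simp
  | add t t' h h' => rw [map_add, h, h', map_add]
  | tmul r f =>
    have e : r ⊗ₜ[ℂ] f = r • ((1 : Base n) ⊗ₜ[ℂ] f) := by
      rw [TensorProduct.smul_tmul', smul_eq_mul, mul_one]
    rw [e, map_smul, map_smul, h]

end CoefOp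

/-! ### Gluing -/

/-- The sheaf condition for a family of sets indexed by the open subsets, with restriction maps,
in terms of covers of `U` by a neighbourhood of each of its points. -/
structure SheafLike {M : Type u} [TopologicalSpace M] (P : Opens M → Type*)
    (res : ∀ {U V : Opens M}, V ≤ U → P U → P V) : Prop where
  res_self : ∀ (U : Opens M) (a : P U), res le_rfl a = a
  res_res : ∀ {U V W : Opens M} (h : V ≤ U) (h' : W ≤ V) (a : P U),
    res h' (res h a) = res (h'.trans h) a
  sep : ∀ (U : Opens M) (a b : P U),
    (∀ x ∈ U, ∃ (V : Opens M) (h : V ≤ U), x ∈ V ∧ res h a = res h b) → a = b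
  glue : ∀ (U : Opens M) (V : U → Opens M) (_ : ∀ x, V x ≤ U) (_ : ∀ x : U, x.1 ∈ V x)
    (a : ∀ x, P (V x)),
    (∀ x y (W : Opens M) (h : W ≤ V x) (h' : W ≤ V y), res h (a x) = res h' (a y)) →
    ∃ b : P U, ∀ x (h : V x ≤ U), res h b = a x

section

variable {M : Type u} [TopologicalSpace M]

/-- Locally existing, unique sections with a property stable under restriction glue. -/
theorem SheafLike.exists_of_locally {P : Opens M → Type*}
    {res : ∀ {U V : Opens M}, V ≤ U → P U → P V} (S : SheafLike P res) {U : Opens M}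
    (Q : ∀ V : Opens M, V ≤ U → P V → Prop)
    (stable : ∀ (V W : Opens M) (hV : V ≤ U) (h : W ≤ V) (a : P V),
      Q V hV a → Q W (h.trans hV) (res h a))
    (uniq : ∀ (V : Opens M) (hV : V ≤ U) (a b : P V), Q V hV a → Q V hV b → a = b)
    (ex : ∀ x ∈ U, ∃ (V : Opens M) (hV : V ≤ U), x ∈ V ∧ ∃ a, Q V hV a) :
    ∃ b : P U, ∀ x ∈ U, ∃ (V : Opens M) (hV : V ≤ U), x ∈ V ∧ Q V hV (res hV b) := by
  choose V hV hx a ha using fun x : U => ex x.1 x.2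
  obtain ⟨b, hb⟩ := S.glue U V hV hx a fun x y W h h' =>
    uniq W (h.trans (hV x)) _ _ (stable _ _ _ h _ (ha x)) (stable _ _ _ h' _ (ha y))
  exact ⟨b, fun x hxU => ⟨V ⟨x, hxU⟩, hV _, hx ⟨x, hxU⟩, by rw [hb]; exact ha _⟩⟩

/-- `R ⊗ P` satisfies the sheaf condition if `P` does. -/
theorem SheafLike.baseChange {n : ℕ} {P : Opens M → Type*} [∀ U, AddCommGroup (P U)]
    [∀ U, Module ℂ (P U)] (ρ : ∀ {U V : Opens M}, V ≤ U → (P U →ₗ[ℂ] P V))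
    (S : SheafLike P (fun h a => ρ h a)) :
    SheafLike (fun U => Base n ⊗[ℂ] P U) (fun h a => (ρ h).lTensor (Base n) a) where
  res_self U a := coef_ext fun i => by rw [coef_lTensor]; exact S.res_self U _
  res_res h h' a := coef_ext fun i => by
    rw [coef_lTensor, coef_lTensor, coef_lTensor]; exact S.res_res h h' _
  sep U a b hab := coef_ext fun i => S.sep U _ _ fun x hx => by
    obtain ⟨V, h, hxV, e⟩ := hab x hx
    exact ⟨V, h, hxV, by rw [← coef_lTensor, ← coef_lTensor, e]⟩
  glue U V hV hx a ha := by
    choose b hb using fun i => S.glue U V hV hx (fun x => coef i (a x)) fun x y W h h' => by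
      rw [← coef_lTensor, ← coef_lTensor, ha x y W h h']
    refine ⟨∑ i : Fin (n + 1), (hbar n ^ (i : ℕ)) ⊗ₜ[ℂ] b i, fun x h => coef_ext fun i => ?_⟩
    rw [coef_lTensor, coef_sum, hb]

/-- Maps of presheaves defined on the members of a cover, and agreeing on overlaps, glue. -/
theorem SheafLike.glue_linear {k : Type*} [CommRing k] {P Q : Opens M → Type*}
    [∀ U, AddCommGroup (P U)] [∀ U, Module k (P U)] [∀ U, AddCommGroup (Q U)] [∀ U, Module k (Q U)]
    (ρ : ∀ {U V : Opens M}, V ≤ U → (P U →ₗ[k] P V))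
    (σ : ∀ {U V : Opens M}, V ≤ U → (Q U →ₗ[k] Q V))
    (hρ : ∀ {U V W : Opens M} (h : V ≤ U) (h' : W ≤ V) (a : P U), ρ h' (ρ h a) = ρ (h'.trans h) a)
    (S : SheafLike Q (fun h a => σ h a)) (U : Opens M) (V : U → Opens M) (hV : ∀ x, V x ≤ U)
    (hx : ∀ x : U, x.1 ∈ V x)
    (A : ∀ (x : U) (W : {W : Opens M // W ≤ V x}), P W.1 →ₗ[k] Q W.1)
    (hA : ∀ (x : U) (W W' : {W : Opens M // W ≤ V x}) (h : W'.1 ≤ W.1) (a : P W.1),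
      σ h (A x W a) = A x W' (ρ h a))
    (hAA : ∀ (x y : U) (W : Opens M) (h : W ≤ V x) (h' : W ≤ V y), A x ⟨W, h⟩ = A y ⟨W, h'⟩) :
    ∃ B : ∀ W : {W : Opens M // W ≤ U}, P W.1 →ₗ[k] Q W.1,
      (∀ (W W' : {W : Opens M // W ≤ U}) (h : W'.1 ≤ W.1) (a : P W.1),
        σ h (B W a) = B W' (ρ h a)) ∧
      ∀ (x : U) (W : Opens M) (h : W ≤ V x), B ⟨W, h.trans (hV x)⟩ = A x ⟨W, h⟩ := by
  have ex : ∀ (W : {W : Opens M // W ≤ U}) (a : P W.1), ∃ b : Q W.1, ∀ (x : U) (W' : Opens M)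
      (h : W' ≤ W.1) (h' : W' ≤ V x), σ h b = A x ⟨W', h'⟩ (ρ h a) := by
    intro W a
    obtain ⟨b, hb⟩ := S.glue W.1 (fun y => W.1 ⊓ V ⟨y.1, W.2 y.2⟩) (fun y => inf_le_left)
      (fun y => ⟨y.2, hx ⟨y.1, W.2 y.2⟩⟩)
      (fun y => A ⟨y.1, W.2 y.2⟩ ⟨_, inf_le_right⟩ (ρ inf_le_left a)) (by
        intro x y W' h h'
        rw [hA _ ⟨_, inf_le_right⟩ ⟨W', h.trans inf_le_right⟩ h,
          hA _ ⟨_, inf_le_right⟩ ⟨W', h'.trans inf_le_right⟩ h', hρ, hρ]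
        rw [hAA _ ⟨y.1, W.2 y.2⟩ W' (h.trans inf_le_right) (h'.trans inf_le_right)])
    refine ⟨b, fun x W' h h' => S.sep W' _ _ fun y hy => ?_⟩
    refine ⟨W' ⊓ (W.1 ⊓ V ⟨y, W.2 (h hy)⟩), inf_le_left,
      ⟨hy, h hy, hx ⟨y, W.2 (h hy)⟩⟩, ?_⟩
    have e := hb ⟨y, h hy⟩ inf_le_left
    have e' := congrArg (σ (inf_le_right : W' ⊓ (W.1 ⊓ V ⟨y, W.2 (h hy)⟩) ≤ _)) e
    rw [hA _ ⟨_, inf_le_right⟩ ⟨W' ⊓ (W.1 ⊓ V ⟨y, W.2 (h hy)⟩),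
      inf_le_right.trans inf_le_right⟩ inf_le_right, hρ] at e'
    rw [hA _ ⟨W', h'⟩ ⟨W' ⊓ (W.1 ⊓ V ⟨y, W.2 (h hy)⟩), inf_le_left.trans h'⟩ inf_le_left, hρ,
      hAA x ⟨y, W.2 (h hy)⟩ _ _ (inf_le_right.trans inf_le_right), ← e']
    exact (S.res_res _ _ _).trans (S.res_res _ _ _).symm
  choose b hb using ex
  have uniq : ∀ (W : {W : Opens M // W ≤ U}) (c c' : Q W.1),
      (∀ (x : U) (W' : Opens M) (h : W' ≤ W.1) (_ : W' ≤ V x), σ h c = σ h c') → c = c' :=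
    fun W c c' hc => S.sep _ _ _ fun y hy => ⟨W.1 ⊓ V ⟨y, W.2 hy⟩, inf_le_left,
      ⟨hy, hx ⟨y, W.2 hy⟩⟩, hc _ _ _ inf_le_right⟩
  refine ⟨fun W => { toFun := b W, map_add' := fun a a' => ?_, map_smul' := fun r a => ?_ },
    fun W W' h a => ?_, fun x W h => LinearMap.ext fun a => ?_⟩
  · refine uniq W _ _ fun x W' h h' => ?_
    rw [map_add, hb _ _ x W' h h', hb _ _ x W' h h', hb _ _ x W' h h', map_add, map_add]
  · refine uniq W _ _ fun x W' h h' => ?_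
    rw [RingHom.id_apply, map_smul, hb _ _ x W' h h', hb _ _ x W' h h', map_smul, map_smul]
  · refine uniq W' _ _ fun x W'' h' h'' => ?_
    change σ h' (σ h (b W a)) = σ h' (b W' _)
    rw [hb _ _ x W'' h' h'', hρ, ← hb W a x W'' (h'.trans h) h'']
    exact S.res_res _ _ _
  · have := hb ⟨W, h.trans (hV x)⟩ a x W le_rfl h
    have e : σ le_rfl (b ⟨W, h.trans (hV x)⟩ a) = b ⟨W, h.trans (hV x)⟩ a := S.res_self _ _
    rw [e] at this
    change b ⟨W, h.trans (hV x)⟩ a = _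
    rw [this, ← hA x ⟨W, h⟩ ⟨W, h⟩ le_rfl]
    exact S.res_self _ _

section Concrete

variable {C : Type*} [Category* C] {FC : C → C → Type*} {CC : C → Type*}
  [∀ X Y, FunLike (FC X Y) (CC X) (CC Y)] [ConcreteCategory C FC]
  [Limits.HasLimitsOfSize.{u, u} C] [(forget C).ReflectsIsomorphisms]
  [Limits.PreservesLimitsOfSize.{u, u} (forget C)]

/-- The sheaf condition on sections, from the categorical one. -/
theorem sheafLike_of_isSheaf (F : TopCat.Presheaf C (TopCat.of M)) (h : F.IsSheaf) :
    SheafLike (M := M) (fun U => ToType (F.obj (opn U))) (fun h a => F.map (ophom h) a) where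
  res_self U a := by
    have : F.map (ophom (le_refl U)) = 𝟙 _ := F.map_id _
    rw [this]; exact ConcreteCategory.id_apply _
  res_res h h' a := by
    rw [← ConcreteCategory.comp_apply, ← F.map_comp]; rfl
  sep U a b hab := by
    choose V hV hx e using hab
    refine TopCat.Sheaf.eq_of_locally_eq' ⟨F, h⟩ (fun x : U => V x.1 x.2) U
      (fun x => homOfLE (hV x.1 x.2)) ?_ a b fun x => e x.1 x.2
    exact fun x hxU => Opens.mem_iSup.2 ⟨⟨x, hxU⟩, hx x hxU⟩
  glue U V hV hx a ha := by
    obtain ⟨b, hb, -⟩ := TopCat.Sheaf.existsUnique_gluing' ⟨F, h⟩ V U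
      (fun x => homOfLE (hV x)) (fun x hxU => Opens.mem_iSup.2 ⟨⟨x, hxU⟩, hx ⟨x, hxU⟩⟩) a
      (fun x y => ha x y _ inf_le_left inf_le_right)
    exact ⟨b, fun x _ => hb x⟩

theorem isSheaf_of_sheafLike (F : TopCat.Presheaf C (TopCat.of M))
    (S : SheafLike (M := M) (fun U => ToType (F.obj (opn U))) (fun h a => F.map (ophom h) a)) :
    F.IsSheaf := by
  rw [TopCat.Presheaf.isSheaf_iff_isSheafUniqueGluing]
  intro ι U sf hsf
  have hmem : ∀ x : (iSup U : Opens M), ∃ i, x.1 ∈ U i := fun x => Opens.mem_iSup.1 x.2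
  choose i hi using hmem
  have compat : ∀ (j k : ι) (W : Opens M) (h : W ≤ U j) (h' : W ≤ U k),
      F.map (ophom h) (sf j) = F.map (ophom h') (sf k) := by
    intro j k W h h'
    have := congrArg (F.map (ophom (le_inf h h'))) (hsf j k)
    exact (S.res_res inf_le_left (le_inf h h') (sf j)).symm.trans
      (this.trans (S.res_res inf_le_right (le_inf h h') (sf k)))
  obtain ⟨b, hb⟩ := S.glue (iSup U) (fun x => U (i x)) (fun x => le_iSup U (i x)) hi
    (fun x => sf (i x)) (fun x y W h h' => compat _ _ W h h')
  refine ⟨b, fun j => ?_, fun b' hb' => S.sep _ _ _ fun x hx => ?_⟩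
  · refine S.sep (U j) _ _ fun x hx => ?_
    let y : (iSup U : Opens M) := ⟨x, le_iSup U j hx⟩
    refine ⟨U j ⊓ U (i y), inf_le_left, ⟨hx, hi y⟩, ?_⟩
    refine (S.res_res (le_iSup U j) inf_le_left b).trans ?_
    refine (S.res_res (le_iSup U (i y)) inf_le_right b).symm.trans ?_
    have := congrArg (F.map (ophom (inf_le_right : U j ⊓ U (i y) ≤ U (i y)))) (hb y (le_iSup U (i y)))
    exact this.trans (compat _ _ _ _ _)
  · exact ⟨U (i ⟨x, hx⟩), le_iSup U _, hi ⟨x, hx⟩, (hb' _).trans (hb ⟨x, hx⟩ _).symm⟩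

end Concrete

end

section Structure

variable {d n : ℕ} {M : Type u} [TopologicalSpace M] [ChartedSpace (EuclideanSpace ℂ (Fin d)) M]

theorem sheafLike_asec (𝒜 : AlgSheaf n M) :
    SheafLike (fun U => asec 𝒜 U) (fun h s => ares 𝒜 h s) :=
  sheafLike_of_isSheaf 𝒜.1 𝒜.2

theorem sheafLike_sec (F : PresheafOfModules.{u} (DR d n M))
    (h : TopCat.Presheaf.IsSheaf (X := TopCat.of M) F.presheaf) :
    SheafLike (fun U => sec F U) (fun h a => secRes F h a) :=
  sheafLike_of_isSheaf F.presheaf h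

end Structure

/-! ### Holomorphic functions -/

/-- Hadamard's lemma: the power series of an analytic function, divided by the first power. -/
theorem exists_analytic_quotient {E : Type*} [NormedAddCommGroup E] [NormedSpace ℂ E] {f : E → ℂ}
    {p : E} (hf : AnalyticAt ℂ f p) : ∃ s ∈ nhds p, IsOpen s ∧ ∃ g : E → E →L[ℂ] ℂ,
      (∀ v ∈ s, AnalyticAt ℂ g v) ∧ ∀ v ∈ s, f v = f p + g v (v - p) := by
  obtain ⟨q, r, hq⟩ := hf
  have hr : 0 < q.shift.radius := by
    rw [FormalMultilinearSeries.radius_shift]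
    exact hq.r_pos.trans_le hq.r_le
  have hg := (q.shift.hasFPowerSeriesOnBall hr).comp_sub p
  rw [zero_add, FormalMultilinearSeries.radius_shift] at hg
  refine ⟨Metric.eball p r, Metric.isOpen_eball.mem_nhds (Metric.mem_eball_self hq.r_pos),
    Metric.isOpen_eball, fun v => q.shift.sum (v - p), fun v hv => ?_, fun v hv => ?_⟩
  · exact hg.analyticAt_of_mem (Metric.eball_subset_eball hq.r_le hv)
  · have hv0 : v - p ∈ Metric.eball (0 : E) r := by
      rw [Metric.mem_eball, edist_zero_right]
      rw [Metric.mem_eball, edist_eq_enorm_sub] at hv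
      exact hv
    have h1 := hq.hasSum hv0
    rw [add_sub_cancel] at h1
    have h2 := q.shift.hasSum (x := v - p) (Metric.eball_subset_eball
      (by rw [FormalMultilinearSeries.radius_shift]; exact hq.r_le) hv0)
    have h3 := (hasSum_nat_add_iff' 1).2 h1
    have h4 := h2.mapL (ContinuousLinearMap.apply ℂ ℂ (v - p))
    have h5 : HasSum (fun n => q (n + 1) fun _ => v - p) (q.shift.sum (v - p) (v - p)) := by
      have e : ∀ m, q (m + 1) (fun _ => v - p) = q.shift m (fun _ => v - p) (v - p) := by
        intro m
        have := ContinuousMultilinearMap.curryRight_apply (q m.succ) (fun _ => v - p) (v - p)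
        refine Eq.trans (congrArg (q (m + 1)) ?_) this.symm
        ext i
        refine Fin.lastCases ?_ (fun j => ?_) i <;> simp
      rw [funext e]
      exact h4
    have h6 := h3.unique h5
    rw [Finset.range_one, Finset.sum_singleton, hq.coeff_zero] at h6
    exact sub_eq_iff_eq_add'.1 h6

variable {d n : ℕ} {M : Type u} [TopologicalSpace M] [ChartedSpace (EuclideanSpace ℂ (Fin d)) M]

/-- Extension by zero of a holomorphic function. -/
def holExt {U : Opens M} (f : Hol d U) (y : M) : ℂ := by
  classical exact if h : y ∈ U then f ⟨y, h⟩ else 0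

theorem holExt_of_mem {U : Opens M} (f : Hol d U) {y : M} (h : y ∈ U) :
    holExt f y = f ⟨y, h⟩ := dif_pos h

theorem contMDiffAt_holExt {U : Opens M} (f : Hol d U) {y : M} (h : y ∈ U) :
    ContMDiffAt 𝓘(ℂ, EuclideanSpace ℂ (Fin d)) 𝓘(ℂ) ω (holExt f) y := by
  refine (contMDiffAt_subtype_iff (U := U) (x := ⟨y, h⟩)).1 ?_
  have : (fun x : U => holExt f x) = f := funext fun x => holExt_of_mem f x.2
  rw [this]
  exact f.contMDiff _

/-- The restriction to `U` of a function holomorphic near every point of `U`. -/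
def holOf {U : Opens M} (g : M → ℂ)
    (hg : ∀ y ∈ U, ContMDiffAt 𝓘(ℂ, EuclideanSpace ℂ (Fin d)) 𝓘(ℂ) ω g y) : Hol d U :=
  ⟨fun y => g y, fun y => contMDiffAt_subtype_iff.2 (hg y y.2)⟩

theorem hol_ext {U : Opens M} {f g : Hol d U} (h : ∀ y, f y = g y) : f = g := DFunLike.ext _ _ h

theorem sheafLike_hol :
    SheafLike (fun U : Opens M => Hol d U) (fun h f => (holRes d h).toLinearMap f) where
  res_self _ _ := rfl
  res_res _ _ _ := rfl
  sep U f g h := hol_ext fun y => by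
    obtain ⟨V, hV, hy, e⟩ := h y.1 y.2
    exact DFunLike.congr_fun e (⟨y.1, hy⟩ : V)
  glue U V hV hx a ha := by
    classical
    let g : M → ℂ := fun y => if h : y ∈ U then holExt (a ⟨y, h⟩) y else 0
    have key : ∀ (x : U) (y : M), y ∈ V x → g y = holExt (a x) y := by
      intro x y hy
      have hyU : y ∈ U := hV x hy
      have e := ha x ⟨y, hyU⟩ (V x ⊓ V ⟨y, hyU⟩) inf_le_left inf_le_right
      have := DFunLike.congr_fun e (⟨y, hy, hx ⟨y, hyU⟩⟩ : (V x ⊓ V ⟨y, hyU⟩ : Opens M))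
      change dite _ _ _ = _
      rw [dif_pos hyU, holExt_of_mem _ (hx ⟨y, hyU⟩), holExt_of_mem _ hy]
      exact this.symm
    refine ⟨holOf g fun y hy => ?_, fun x h => hol_ext fun y => ?_⟩
    · refine (contMDiffAt_holExt (a ⟨y, hy⟩) (hx ⟨y, hy⟩)).congr_of_eventuallyEq ?_
      filter_upwards [(V ⟨y, hy⟩).isOpen.mem_nhds (hx ⟨y, hy⟩)] with y' hy'
      exact key _ _ hy'
    · exact (key x y.1 y.2).trans (holExt_of_mem _ y.2)

theorem sheafLike_holR :
    SheafLike (fun U : Opens M => HolR d n U) (fun h f => holRRes d n h f) :=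
  sheafLike_hol.baseChange (n := n) (fun {U V : Opens M} (h : V ≤ U) => (holRes d h).toLinearMap)

/-- A holomorphic function that does not vanish at a point is invertible near that point. -/
theorem exists_hol_inverse {U : Opens M} (f : Hol d U) {x : M} (hx : x ∈ U) (hf : f ⟨x, hx⟩ ≠ 0) :
    ∃ (V : Opens M) (h : V ≤ U), x ∈ V ∧ ∃ g : Hol d V, holRes d h f * g = 1 := by
  have hc : ContinuousOn (holExt f) U := fun y hy =>
    (contMDiffAt_holExt f hy).continuousAt.continuousWithinAt
  let V : Opens M := ⟨U ∩ holExt f ⁻¹' {0}ᶜ, hc.isOpen_inter_preimage U.isOpen isOpen_compl_singleton⟩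
  have hV : ∀ y ∈ V, holExt f y ≠ 0 := fun y hy => hy.2
  refine ⟨V, fun y hy => hy.1, ⟨hx, ?_⟩, holOf (fun y => (holExt f y)⁻¹) fun y hy => ?_, ?_⟩
  · change holExt f x ≠ 0
    rwa [holExt_of_mem f hx]
  · exact (contMDiffAt_holExt f hy.1).inv₀ (hV y hy)
  · refine hol_ext fun y => ?_
    have h1 : holExt f y = f ⟨y.1, y.2.1⟩ := holExt_of_mem f y.2.1
    change f ⟨y.1, _⟩ * (holExt f y)⁻¹ = 1
    rw [← h1]
    exact mul_inv_cancel₀ (hV y y.2)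

/-! ### Local coordinates -/

/-- Holomorphic coordinates on `U`: functions `z i` and commuting vector fields `∂ i` dual to them, such
that every holomorphic function vanishing at a point `y` is near `y` a combination of the functions
`z i - z i (y)`. -/
structure Coordinates (U : Opens M) where
  z : Fin d → Hol d U
  del : Fin d → DiffOp d U
  vectorField : ∀ i, IsVectorField (del i)
  del_z : ∀ i j, (del i).1 ⟨U, le_rfl⟩ (z j) = if i = j then 1 else 0
  del_comm : ∀ i j, del i * del j = del j * del i
  hadamard : ∀ (V : Opens M) (h : V ≤ U) (f : Hol d V) (y : M) (hy : y ∈ V), f ⟨y, hy⟩ = 0 →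
    ∃ (W : Opens M) (hW : W ≤ V) (g : Fin d → Hol d W), y ∈ W ∧
      holRes d hW f =
        ∑ i, (holRes d (hW.trans h) (z i) - algebraMap ℂ _ (z i ⟨y, h hy⟩)) * g i

section Chart

variable (x₀ : M)

/-- The domain of the preferred chart at a point. -/
def chartOpen (d : ℕ) {M : Type u} [TopologicalSpace M]
    [ChartedSpace (EuclideanSpace ℂ (Fin d)) M] (x₀ : M) : Opens M :=
  ⟨(chartAt (EuclideanSpace ℂ (Fin d)) x₀).source, (chartAt _ x₀).open_source⟩

/-- A holomorphic function read in the preferred chart at `x₀`. -/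
def chartFun {V : Opens M} (f : Hol d V) : EuclideanSpace ℂ (Fin d) → ℂ :=
  holExt f ∘ (chartAt (EuclideanSpace ℂ (Fin d)) x₀).symm

theorem chartFun_apply {V : Opens M} (hV : V ≤ chartOpen d x₀) (f : Hol d V) (y : V) :
    chartFun x₀ f (chartAt _ x₀ y.1) = f y := by
  change holExt f ((chartAt (EuclideanSpace ℂ (Fin d)) x₀).symm (chartAt _ x₀ y.1)) = f y
  rw [(chartAt (EuclideanSpace ℂ (Fin d)) x₀).left_inv (hV y.2), holExt_of_mem f y.2]

theorem chartFun_eventuallyEq {V : Opens M} (hV : V ≤ chartOpen d x₀) (f : Hol d V)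
    (g : EuclideanSpace ℂ (Fin d) → ℂ) (hg : ∀ y : V, g (chartAt _ x₀ y.1) = f y) {y : M} (hy : y ∈ V) :
    chartFun x₀ f =ᶠ[nhds (chartAt (EuclideanSpace ℂ (Fin d)) x₀ y)] g := by
  let e := chartAt (EuclideanSpace ℂ (Fin d)) x₀
  have hc : ContinuousAt e.symm (e y) := e.continuousAt_symm (e.map_source (hV hy))
  have h1 : ∀ᶠ p in nhds (e y), e.symm p ∈ V := by
    refine hc.eventually_mem (V.isOpen.mem_nhds ?_)
    rw [e.left_inv (hV hy)]; exact hy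
  filter_upwards [h1, e.open_target.mem_nhds (e.map_source (hV hy))] with p hp hpt
  have := hg ⟨e.symm p, hp⟩
  change g (e (e.symm p)) = _ at this
  rw [e.right_inv hpt] at this
  rw [this]
  exact holExt_of_mem f hp

variable [IsManifold 𝓘(ℂ, EuclideanSpace ℂ (Fin d)) ω M]

theorem analyticAt_chartFun {V : Opens M} (hV : V ≤ chartOpen d x₀) (f : Hol d V) {y : M}
    (hy : y ∈ V) : AnalyticAt ℂ (chartFun x₀ f) (chartAt _ x₀ y) := by
  let e := chartAt (EuclideanSpace ℂ (Fin d)) x₀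
  refine ContDiffAt.analyticAt (contMDiffAt_iff_contDiffAt.1 ?_)
  refine ContMDiffAt.comp (I' := 𝓘(ℂ, EuclideanSpace ℂ (Fin d))) (e y) ?_ ?_
  · have : e.symm (e y) = y := e.left_inv (hV hy)
    change ContMDiffAt _ _ _ _ (e.symm (e y))
    rw [this]
    exact contMDiffAt_holExt f hy
  · exact contMDiffOn_chart_symm.contMDiffAt (e.open_target.mem_nhds (e.map_source (hV hy)))

/-- The holomorphic function on `V` that reads as `g` in the preferred chart at `x₀`. -/
def ofChart {V : Opens M} (hV : V ≤ chartOpen d x₀) (g : EuclideanSpace ℂ (Fin d) → ℂ)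
    (hg : ∀ y ∈ V, AnalyticAt ℂ g (chartAt _ x₀ y)) : Hol d V :=
  holOf (g ∘ chartAt _ x₀) fun y hy => by
    refine ContMDiffAt.comp (I' := 𝓘(ℂ, EuclideanSpace ℂ (Fin d))) y ?_ ?_
    · exact contMDiffAt_iff_contDiffAt.2 (hg y hy).contDiffAt
    · exact contMDiffOn_chart.contMDiffAt ((chartAt _ x₀).open_source.mem_nhds (hV hy))

theorem ofChart_apply {V : Opens M} (hV : V ≤ chartOpen d x₀) (g : EuclideanSpace ℂ (Fin d) → ℂ)
    (hg : ∀ y ∈ V, AnalyticAt ℂ g (chartAt _ x₀ y)) (y : V) :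
    ofChart x₀ hV g hg y = g (chartAt _ x₀ y.1) := rfl

theorem analyticAt_partial (i : Fin d) {V : Opens M} (hV : V ≤ chartOpen d x₀) (f : Hol d V) {y : M}
    (hy : y ∈ V) : AnalyticAt ℂ (fun p => fderiv ℂ (chartFun x₀ f) p (EuclideanSpace.single i 1))
      (chartAt _ x₀ y) :=
  (ContinuousLinearMap.apply ℂ ℂ (EuclideanSpace.single i (1 : ℂ))).analyticAt _ |>.comp
    (analyticAt_chartFun x₀ hV f hy).fderiv

/-- The partial derivative in a coordinate direction. -/
def partialFun (i : Fin d) {V : Opens M} (hV : V ≤ chartOpen d x₀) (f : Hol d V) : Hol d V :=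
  ofChart x₀ hV (fun p => fderiv ℂ (chartFun x₀ f) p (EuclideanSpace.single i 1)) fun _ hy =>
    analyticAt_partial x₀ i hV f hy

theorem partialFun_apply (i : Fin d) {V : Opens M} (hV : V ≤ chartOpen d x₀) (f : Hol d V)
    (g : EuclideanSpace ℂ (Fin d) → ℂ) (hg : ∀ y : V, g (chartAt _ x₀ y.1) = f y) (y : V) :
    partialFun x₀ i hV f y = fderiv ℂ g (chartAt _ x₀ y.1) (EuclideanSpace.single i 1) := by
  rw [partialFun, ofChart_apply, (chartFun_eventuallyEq x₀ hV f g hg y.2).fderiv_eq]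

theorem partialFun_mul (i : Fin d) {V : Opens M} (hV : V ≤ chartOpen d x₀) (f g : Hol d V) :
    partialFun x₀ i hV (f * g) = partialFun x₀ i hV f * g + f * partialFun x₀ i hV g := by
  refine hol_ext fun y => ?_
  have hf := (analyticAt_chartFun x₀ hV f y.2).differentiableAt
  have hg := (analyticAt_chartFun x₀ hV g y.2).differentiableAt
  rw [partialFun_apply x₀ i hV (f * g) (chartFun x₀ f * chartFun x₀ g)
    (fun y => by rw [Pi.mul_apply, chartFun_apply x₀ hV, chartFun_apply x₀ hV]; rfl),
    fderiv_mul hf hg, chartFun_apply x₀ hV, chartFun_apply x₀ hV]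
  change f y * _ + g y * _ = _ * g y + f y * _
  rw [add_comm, mul_comm (g y)]
  rfl

/-- The partial derivative in a coordinate direction, as a linear map. -/
def partialLin (i : Fin d) {V : Opens M} (hV : V ≤ chartOpen d x₀) : Hol d V →ₗ[ℂ] Hol d V where
  toFun := partialFun x₀ i hV
  map_add' f g := hol_ext fun y => by
    have hf := (analyticAt_chartFun x₀ hV f y.2).differentiableAt
    have hg := (analyticAt_chartFun x₀ hV g y.2).differentiableAt
    rw [partialFun_apply x₀ i hV (f + g) (chartFun x₀ f + chartFun x₀ g)
      (fun y => by rw [Pi.add_apply, chartFun_apply x₀ hV, chartFun_apply x₀ hV]; rfl),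
      fderiv_add hf hg]
    rfl
  map_smul' c f := hol_ext fun y => by
    have hf := (analyticAt_chartFun x₀ hV f y.2).differentiableAt
    rw [partialFun_apply x₀ i hV (c • f) (c • chartFun x₀ f)
      (fun y => by rw [Pi.smul_apply, chartFun_apply x₀ hV]; rfl), fderiv_const_smul hf]
    rfl

theorem killed_partialLin (i : Fin d) {V : Opens M} (hV : V ≤ chartOpen d x₀) :
    Killed (mulPairs ℂ (Hol d V)) 2 (partialLin x₀ i hV) := by
  rintro _ ⟨f, rfl⟩
  have e : LinearMap.mulLeft ℂ f ∘ₗ partialLin x₀ i hV - partialLin x₀ i hV ∘ₗ LinearMap.mulLeft ℂ f =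
      LinearMap.mulLeft ℂ (-partialFun x₀ i hV f) := by
    refine LinearMap.ext fun g => ?_
    change f * partialFun x₀ i hV g - partialFun x₀ i hV (f * g) = -partialFun x₀ i hV f * g
    rw [partialFun_mul]
    ring
  exact e ▸ killed_mulLeft _

/-- The partial derivative in a coordinate direction, as a differential operator. -/
def partialOp (i : Fin d) : DiffOp d (chartOpen d x₀) :=
  ⟨fun V => partialLin x₀ i V.2,
    fun V W h f => hol_ext fun y => by
      change partialFun x₀ i V.2 f ⟨y.1, h y.2⟩ = partialFun x₀ i W.2 (holRes d h f) y
      rw [partialFun_apply x₀ i W.2 (holRes d h f) (chartFun x₀ f)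
        (fun y => chartFun_apply x₀ V.2 f ⟨y.1, h y.2⟩)]
      rfl,
    fun x hx => ⟨_, le_rfl, hx, 2, fun V _ => killed_partialLin x₀ i V.2⟩⟩

theorem partialOp_apply (i : Fin d) (V : {V : Opens M // V ≤ chartOpen d x₀}) (f : Hol d V.1) :
    (partialOp x₀ i).1 V f = partialFun x₀ i V.2 f := rfl

/-- The coordinates given by the preferred chart at `x₀`. -/
def chartCoordinates : Coordinates (d := d) (chartOpen d x₀) where
  z i := ofChart x₀ le_rfl (fun p => p i)
    fun _ _ => (EuclideanSpace.proj (𝕜 := ℂ) i).analyticAt _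
  del := partialOp x₀
  vectorField i V f g := partialFun_mul x₀ i V.2 f g
  del_z i j := by
    refine hol_ext fun y => ?_
    rw [partialOp_apply, partialFun_apply x₀ i le_rfl _ (EuclideanSpace.proj (𝕜 := ℂ) j)
      (fun y => rfl), ContinuousLinearMap.fderiv]
    change (EuclideanSpace.single i (1 : ℂ)) j = _
    rw [PiLp.single_apply]
    split_ifs with h1 h2 h2
    · rfl
    · exact absurd h1.symm h2
    · exact absurd h2.symm h1
    · rfl
  del_comm i j := by
    refine Subtype.ext (funext fun V => LinearMap.ext fun f => hol_ext fun y => ?_)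
    change partialFun x₀ i V.2 (partialFun x₀ j V.2 f) y = partialFun x₀ j V.2 (partialFun x₀ i V.2 f) y
    rw [partialFun_apply x₀ i V.2 _ (fun p => fderiv ℂ (chartFun x₀ f) p (EuclideanSpace.single j 1))
      (fun y => rfl), partialFun_apply x₀ j V.2 _
        (fun p => fderiv ℂ (chartFun x₀ f) p (EuclideanSpace.single i 1)) (fun y => rfl)]
    have ha := analyticAt_chartFun x₀ V.2 f y.2
    -- The second derivative is symmetric.
    have hs := (ha.contDiffAt (n := ω)).isSymmSndFDerivAt_of_omega
    have hd := ha.fderiv.differentiableAt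
    rw [fderiv_clm_apply hd (differentiableAt_const _), fderiv_clm_apply hd (differentiableAt_const _)]
    simp only [fderiv_fun_const, Pi.zero_apply, ContinuousLinearMap.comp_zero, zero_add,
      ContinuousLinearMap.flip_apply]
    exact hs _ _
  hadamard V h f y hy hf := by
    -- The coefficients are the components of the quotient in Hadamard's lemma.
    obtain ⟨s, hs, hso, g, hg, hfg⟩ := exists_analytic_quotient (analyticAt_chartFun x₀ h f hy)
    let e := chartAt (EuclideanSpace ℂ (Fin d)) x₀
    let W : Opens M := V ⊓ ⟨e.source ∩ e ⁻¹' s, e.continuousOn.isOpen_inter_preimage e.open_source hso⟩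
    have hW : W ≤ V := inf_le_left
    refine ⟨W, hW, fun i => ofChart x₀ (hW.trans h) (fun p => g p (EuclideanSpace.single i 1))
      fun y' hy' => (ContinuousLinearMap.apply ℂ ℂ (EuclideanSpace.single i (1 : ℂ))).analyticAt _
        |>.comp (hg _ hy'.2.2), ⟨hy, h hy, mem_of_mem_nhds (x := e y) hs⟩, hol_ext fun y' => ?_⟩
    have h1 := hfg (e y'.1) y'.2.2.2
    rw [chartFun_apply x₀ h f ⟨y, hy⟩, chartFun_apply x₀ h f ⟨y'.1, hW y'.2⟩, hf, zero_add] at h1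
    have h2 : ∀ v : EuclideanSpace ℂ (Fin d), v = ∑ i, v i • EuclideanSpace.single i (1 : ℂ) := by
      intro v
      ext j
      simp [Finset.sum_apply, Pi.single_apply]
    rw [h2 (e y'.1 - e y), map_sum] at h1
    have hsum : ∀ F : Fin d → Hol d W, (∑ i, F i) y' = ∑ i, F i y' := fun F =>
      map_sum (⟨⟨fun G : Hol d W => G y', rfl⟩, fun _ _ => rfl⟩ : Hol d W →+ ℂ) F _
    rw [hsum]
    refine h1.trans (Finset.sum_congr rfl fun i _ => ?_)
    rw [map_smul]
    rfl

end Chart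

theorem exists_coordinates [IsManifold 𝓘(ℂ, EuclideanSpace ℂ (Fin d)) ω M] (x : M) :
    ∃ U : Opens M, x ∈ U ∧ Nonempty (Coordinates (d := d) U) :=
  ⟨chartOpen d x, mem_chart_source _ x, ⟨chartCoordinates x⟩⟩

/-! ### Commutators with coordinates in an algebra -/

section AdWord

variable {ι A : Type*} [Ring A] [Algebra ℂ A]

/-- The commutator `P ↦ P z - z P`. -/
def adBy (z : A) : A →ₗ[ℂ] A := LinearMap.mulRight ℂ z - LinearMap.mulLeft ℂ z

theorem adBy_apply (z P : A) : adBy z P = P * z - z * P := rfl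

theorem adBy_mul (z P Q : A) : adBy z (P * Q) = adBy z P * Q + P * adBy z Q := by
  simp only [adBy_apply]; noncomm_ring

theorem adBy_comm {z w : A} (h : z * w = w * z) (P : A) : adBy z (adBy w P) = adBy w (adBy z P) := by
  simp only [adBy_apply, sub_mul, mul_sub, mul_assoc, h]
  rw [← mul_assoc z w P, ← mul_assoc w z P, h]
  abel

/-- The iterated commutator with the elements `z i`, for the letters `i` of a word. -/
def adWord (z : ι → A) : List ι → (A →ₗ[ℂ] A)
  | [] => LinearMap.id
  | i :: w => adWord z w ∘ₗ adBy (z i)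

theorem adWord_perm {z : ι → A} (hz : ∀ i j, z i * z j = z j * z i) {w w' : List ι}
    (h : w.Perm w') : adWord z w = adWord z w' := by
  induction h with
  | nil => rfl
  | cons i _ ih => simp only [adWord, ih]
  | swap i j w =>
    refine LinearMap.ext fun P => ?_
    simp only [adWord, LinearMap.comp_apply]
    rw [adBy_comm (hz i j)]
  | trans _ _ h1 h2 => exact h1.trans h2

theorem adWord_mul_of_comm {z : ι → A} {f : A} (hf : ∀ i, z i * f = f * z i) (w : List ι) (P : A) :
    adWord z w (f * P) = f * adWord z w P := by
  induction w generalizing P with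
  | nil => rfl
  | cons i w ih =>
    have h0 : adBy (z i) f = 0 := by rw [adBy_apply, hf, sub_self]
    simp only [adWord, LinearMap.comp_apply]
    rw [adBy_mul, h0, zero_mul, zero_add, ih]

open scoped IsMulCommutative in
/-- The operator `p(∂)` for a polynomial `p` and commuting operators `∂ i`. -/
def polyOp (del : ι → A) (hdel : ∀ i j, del i * del j = del j * del i) :
    MvPolynomial ι ℂ →ₐ[ℂ] A :=
  haveI := Algebra.isMulCommutative_adjoin ℂ (s := Set.range del) (by
    rintro _ ⟨i, rfl⟩ _ ⟨j, rfl⟩; exact hdel i j)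
  (Algebra.adjoin ℂ (Set.range del)).val.comp
    (MvPolynomial.aeval fun i => (⟨del i, Algebra.subset_adjoin ⟨i, rfl⟩⟩ :
      Algebra.adjoin ℂ (Set.range del)))

open scoped IsMulCommutative in
theorem polyOp_X (del : ι → A) (hdel : ∀ i j, del i * del j = del j * del i) (i : ι) :
    polyOp del hdel (MvPolynomial.X i) = del i := by
  simp [polyOp]

theorem map_polyOp {B : Type*} [Ring B] [Algebra ℂ B] (φ : A →ₐ[ℂ] B) (del : ι → A)
    (hdel : ∀ i j, del i * del j = del j * del i) (del' : ι → B)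
    (hdel' : ∀ i j, del' i * del' j = del' j * del' i) (h : ∀ i, φ (del i) = del' i)
    (p : MvPolynomial ι ℂ) : φ (polyOp del hdel p) = polyOp del' hdel' p := by
  induction p using MvPolynomial.induction_on with
  | C c => rw [← MvPolynomial.algebraMap_eq, AlgHom.commutes, AlgHom.commutes, AlgHom.commutes]
  | add p q hp hq => rw [map_add, map_add, hp, hq, map_add]
  | mul_X p j hp => rw [map_mul, map_mul, hp, map_mul, polyOp_X, polyOp_X, h]

theorem adBy_polyOp [DecidableEq ι] (z del : ι → A) (hdel : ∀ i j, del i * del j = del j * del i)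
    (h : ∀ i j, adBy (z i) (del j) = if i = j then 1 else 0) (i : ι) (p : MvPolynomial ι ℂ) :
    adBy (z i) (polyOp del hdel p) = polyOp del hdel (MvPolynomial.pderiv i p) := by
  induction p using MvPolynomial.induction_on with
  | C c =>
    rw [MvPolynomial.pderiv_C, map_zero, ← MvPolynomial.algebraMap_eq, AlgHom.commutes, adBy_apply,
      Algebra.commutes, sub_self]
  | add p q hp hq => rw [map_add, map_add, map_add, map_add, hp, hq]
  | mul_X p j hp =>
    rw [map_mul, adBy_mul, hp, polyOp_X, h, Derivation.leibniz, MvPolynomial.pderiv_X, map_add,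
      smul_eq_mul, smul_eq_mul, mul_comm (MvPolynomial.X j), map_mul, map_mul, polyOp_X, add_comm,
      Pi.single_apply]
    by_cases hij : i = j
    · rw [if_pos hij, if_pos hij.symm, map_one]
    · rw [if_neg hij, if_neg (Ne.symm hij), map_zero]

/-- The divided power `∂^α / α!`. -/
def dividedDel [Fintype ι] (del : ι → A) (hdel : ∀ i j, del i * del j = del j * del i) (α : ι →₀ ℕ) : A :=
  polyOp del hdel (MvPolynomial.monomial α (∏ i, ((α i).factorial : ℂ)⁻¹))

theorem adBy_dividedDel [Fintype ι] [DecidableEq ι] (z del : ι → A)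
    (hdel : ∀ i j, del i * del j = del j * del i)
    (h : ∀ i j, adBy (z i) (del j) = if i = j then 1 else 0) (i : ι) (α : ι →₀ ℕ) :
    adBy (z i) (dividedDel del hdel α) =
      if α i = 0 then 0 else dividedDel del hdel (α - Finsupp.single i 1) := by
  rw [dividedDel, adBy_polyOp z del hdel h, MvPolynomial.pderiv_monomial]
  split_ifs with h0
  · rw [h0, Nat.cast_zero, mul_zero, map_zero, map_zero]
  · rw [dividedDel]
    congr 2
    rw [← Finset.prod_erase_mul _ _ (Finset.mem_univ i), ← Finset.prod_erase_mul Finset.univ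
      (fun j => (((α - Finsupp.single i 1 : ι →₀ ℕ) j).factorial : ℂ)⁻¹) (Finset.mem_univ i),
      mul_assoc]
    congr 1
    · refine Finset.prod_congr rfl fun j hj => ?_
      rw [Finsupp.tsub_apply, Finsupp.single_eq_of_ne (Finset.ne_of_mem_erase hj), tsub_zero]
    · obtain ⟨m, hm⟩ := Nat.exists_eq_succ_of_ne_zero h0
      rw [Finsupp.tsub_apply, Finsupp.single_eq_same, hm, Nat.succ_sub_one, Nat.factorial_succ]
      have := Nat.factorial_ne_zero m
      have h2 : ((m : ℂ) + 1) ≠ 0 := by exact_mod_cast Nat.succ_ne_zero m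
      push_cast
      field_simp

section Index

variable [DecidableEq ι]

/-- The multi-index of a word. -/
def wordIndex (w : List ι) : ι →₀ ℕ := Multiset.toFinsupp (w : Multiset ι)

theorem wordIndex_cons (i : ι) (w : List ι) :
    wordIndex (i :: w) = Finsupp.single i 1 + wordIndex w := by
  rw [wordIndex, ← Multiset.cons_coe, ← Multiset.singleton_add, map_add,
    Multiset.toFinsupp_singleton]
  rfl

/-- A word with a given multi-index. -/
def indexWord (α : ι →₀ ℕ) : List ι := (Finsupp.toMultiset α).toList

theorem perm_indexWord (w : List ι) : w.Perm (indexWord (wordIndex w)) := by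
  rw [← Multiset.coe_eq_coe, indexWord, Multiset.coe_toList, wordIndex,
    Multiset.toFinsupp_toMultiset]

end Index

variable [Fintype ι] [DecidableEq ι]

/-- The multi-indices with all components at most `N`. -/
def boxIndex (ι : Type*) [Fintype ι] [DecidableEq ι] (N : ℕ) : Finset (ι →₀ ℕ) :=
  Finset.Icc 0 (Finsupp.equivFunOnFinite.symm fun _ => N)

theorem wordIndex_mem_boxIndex {w : List ι} {N : ℕ} (h : w.length ≤ N) :
    wordIndex w ∈ boxIndex ι N := by
  refine Finset.mem_Icc.2 ⟨zero_le, fun i => ?_⟩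
  rw [wordIndex, Multiset.toFinsupp_apply, Multiset.coe_count]
  exact List.count_le_length.trans h

/-- The functionals `φ ∘ adWord w` are dual to the divided powers, if `φ` is the evaluation of the
constant term. -/
theorem adWord_dividedDel (z del : ι → A) (hdel : ∀ i j, del i * del j = del j * del i)
    (h : ∀ i j, adBy (z i) (del j) = if i = j then 1 else 0) {B : Type*} [Ring B] [Algebra ℂ B]
    (φ : A →ₗ[ℂ] B)
    (hφ : ∀ p, φ (polyOp del hdel p) = algebraMap ℂ B (MvPolynomial.constantCoeff p))
    (w : List ι) (α : ι →₀ ℕ) :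
    φ (adWord z w (dividedDel del hdel α)) = if wordIndex w = α then 1 else 0 := by
  induction w generalizing α with
  | nil =>
    have h0 : wordIndex ([] : List ι) = 0 := by rw [wordIndex, Multiset.coe_nil, map_zero]
    change φ (dividedDel del hdel α) = _
    rw [h0, dividedDel, hφ, MvPolynomial.constantCoeff_monomial]
    by_cases hα : α = 0
    · subst hα; simp
    · rw [if_neg hα, if_neg (Ne.symm hα), map_zero]
  | cons i w ih =>
    simp only [adWord, LinearMap.comp_apply]
    rw [adBy_dividedDel z del hdel h, wordIndex_cons]
    split_ifs with h1 h2 h2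
    · exact absurd (DFunLike.congr_fun h2 i) (by simp [h1])
    · rw [map_zero, map_zero]
    · rw [ih, if_pos]
      rw [← h2, add_tsub_cancel_left]
    · rw [ih, if_neg]
      rintro h3
      refine h2 ?_
      rw [h3, add_tsub_cancel_of_le]
      exact Finsupp.single_le_iff.2 (Nat.one_le_iff_ne_zero.2 h1)

end AdWord

/-! ### Differential operators in coordinates -/

section DiffOps

variable {d n : ℕ} {M : Type u} [TopologicalSpace M] [ChartedSpace (EuclideanSpace ℂ (Fin d)) M]

instance instRingDiffOp (U : Opens M) : Ring (DiffOp d U) := inferInstance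
instance instAlgebraDiffOp (U : Opens M) : Algebra ℂ (DiffOp d U) := inferInstance

theorem diffOp_ext {U : Opens M} {P Q : DiffOp d U} (h : ∀ V f, P.1 V f = Q.1 V f) : P = Q :=
  Subtype.ext (funext fun V => LinearMap.ext (h V))

theorem diffOpRes_apply {U V : Opens M} (h : V ≤ U) (P : DiffOp d U) (W : {W : Opens M // W ≤ V})
    (f : Hol d W.1) : (diffOpRes d h P).1 W f = P.1 ⟨W.1, W.2.trans h⟩ f := rfl

theorem diffOp_sum_apply {ι : Type*} {U : Opens M} (s : Finset ι) (P : ι → DiffOp d U)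
    (V : {V : Opens M // V ≤ U}) (f : Hol d V.1) :
    (∑ i ∈ s, P i).1 V f = ∑ i ∈ s, (P i).1 V f := by
  have h : (∑ i ∈ s, P i).1 = ∑ i ∈ s, (P i).1 := map_sum (DiffOp d U).val P s
  rw [h, Finset.sum_apply, LinearMap.sum_apply]

theorem sheafLike_diffOp :
    SheafLike (fun U : Opens M => DiffOp d U) (fun h P => (diffOpRes d h).toLinearMap P) where
  res_self _ _ := rfl
  res_res _ _ _ := rfl
  sep U P Q h := diffOp_ext fun V f => sheafLike_hol.sep _ _ _ fun x hx => by
    obtain ⟨W, hW, hxW, e⟩ := h x (V.2 hx)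
    refine ⟨V.1 ⊓ W, inf_le_left, ⟨hx, hxW⟩, ?_⟩
    have e' := DFunLike.congr_fun (congrFun (congrArg Subtype.val e) ⟨V.1 ⊓ W, inf_le_right⟩)
      (holRes d inf_le_left f)
    exact (P.2.1 V ⟨_, inf_le_left.trans V.2⟩ inf_le_left f).trans
      (e'.trans (Q.2.1 V ⟨_, inf_le_left.trans V.2⟩ inf_le_left f).symm)
  glue U V hV hx P hP := by
    obtain ⟨B, hB, hBP⟩ := sheafLike_hol.glue_linear
      (fun {U V : Opens M} (h : V ≤ U) => (holRes d h).toLinearMap)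
      (fun {U V : Opens M} (h : V ≤ U) => (holRes d h).toLinearMap) (fun _ _ _ => rfl) U V hV hx
      (fun x W => (P x).1 W) (fun x => (P x).2.1) (fun x y W h h' =>
        congrFun (congrArg Subtype.val (hP x y W h h')) ⟨W, le_rfl⟩)
    refine ⟨⟨B, hB, fun x hxU => ?_⟩, fun x h => Subtype.ext (funext fun W => hBP x W.1 W.2)⟩
    obtain ⟨W, hW, hxW, N, hN⟩ := (P ⟨x, hxU⟩).2.2 x (hx ⟨x, hxU⟩)
    refine ⟨W, hW.trans (hV _), hxW, N, fun V' hV' => ?_⟩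
    have := hN ⟨V'.1, hV'.trans hW⟩ hV'
    rwa [← hBP] at this

/-- A bound for the order of a differential operator on all open subsets. -/
def OrderLT {U : Opens M} (N : ℕ) (P : DiffOp d U) : Prop :=
  ∀ V, Killed (mulPairs ℂ (Hol d V.1)) N (P.1 V)

theorem OrderLT.mul {U : Opens M} {a b : ℕ} {P Q : DiffOp d U} (hP : OrderLT a P)
    (hQ : OrderLT b Q) : OrderLT (b + a) (P * Q) :=
  fun V => (hQ V).mulPairs_comp (hP V)

theorem orderLT_mulOp {U : Opens M} (f : Hol d U) : OrderLT 1 (mulOp d U f) :=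
  fun _ => killed_mulLeft _

theorem IsVectorField.map_one {U : Opens M} {τ : DiffOp d U} (h : IsVectorField τ)
    (V : {V : Opens M // V ≤ U}) : τ.1 V 1 = 0 := by
  have := h V 1 1
  rw [mul_one, one_mul, mul_one] at this
  exact left_eq_add.1 this

theorem IsVectorField.orderLT {U : Opens M} {τ : DiffOp d U} (h : IsVectorField τ) :
    OrderLT 2 τ := by
  rintro V _ ⟨f, rfl⟩
  have e : LinearMap.mulLeft ℂ f ∘ₗ τ.1 V - τ.1 V ∘ₗ LinearMap.mulLeft ℂ f =
      LinearMap.mulLeft ℂ (-τ.1 V f) := by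
    refine LinearMap.ext fun g => ?_
    change f * τ.1 V g - τ.1 V (f * g) = -τ.1 V f * g
    rw [h]
    ring
  exact e ▸ killed_mulLeft _

theorem IsVectorField.res {U V : Opens M} {τ : DiffOp d U} (h : IsVectorField τ) (hV : V ≤ U) :
    IsVectorField (diffOpRes d hV τ) := fun W => h ⟨W.1, W.2.trans hV⟩

theorem adBy_vectorField {U : Opens M} {τ : DiffOp d U} (h : IsVectorField τ) (f : Hol d U) :
    adBy (mulOp d U f) τ = mulOp d U (τ.1 ⟨U, le_rfl⟩ f) := by
  refine diffOp_ext fun V g => ?_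
  change τ.1 V (holRes d V.2 f * g) - holRes d V.2 f * τ.1 V g = holRes d V.2 _ * g
  rw [h, τ.2.1 ⟨U, le_rfl⟩ V V.2]
  ring

/-- Coordinates restrict to smaller open subsets. -/
def Coordinates.restrict {U V : Opens M} (C : Coordinates (d := d) U) (h : V ≤ U) :
    Coordinates (d := d) V where
  z i := holRes d h (C.z i)
  del i := diffOpRes d h (C.del i)
  vectorField i := (C.vectorField i).res h
  del_z i j := by
    rw [diffOpRes_apply]
    refine ((C.del i).2.1 ⟨U, le_rfl⟩ ⟨V, h⟩ h (C.z j)).symm.trans ?_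
    rw [C.del_z]
    split_ifs
    · exact map_one _
    · exact map_zero _
  del_comm i j := by rw [← map_mul, ← map_mul, C.del_comm]
  hadamard W hW f y hy hf := by
    obtain ⟨W', hW', g, hyW', e⟩ := C.hadamard W (hW.trans h) f y hy hf
    exact ⟨W', hW', g, hyW', e⟩

section Taylor

variable {U : Opens M} (C : Coordinates (d := d) U)

/-- The operators of multiplication by the coordinates. -/
def Coordinates.zOp (i : Fin d) : DiffOp d U := mulOp d U (C.z i)

theorem Coordinates.zOp_comm (i j : Fin d) : C.zOp i * C.zOp j = C.zOp j * C.zOp i := by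
  rw [zOp, zOp, ← map_mul, ← map_mul, mul_comm]

theorem Coordinates.adBy_del (i j : Fin d) :
    adBy (C.zOp i) (C.del j) = if i = j then 1 else 0 := by
  rw [zOp, adBy_vectorField (C.vectorField j), C.del_z]
  by_cases h : i = j
  · rw [if_pos h, if_pos h.symm, map_one]
  · rw [if_neg h, if_neg (Ne.symm h), map_zero]

/-- The divided powers `∂^α / α!` in coordinates. -/
def Coordinates.e (α : Fin d →₀ ℕ) : DiffOp d U := dividedDel C.del C.del_comm α

/-- Evaluation of an operator at the function `1`. -/
def evalOne (U : Opens M) : DiffOp d U →ₗ[ℂ] Hol d U where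
  toFun P := P.1 ⟨U, le_rfl⟩ 1
  map_add' _ _ := rfl
  map_smul' _ _ := rfl

theorem evalOne_res {V : Opens M} (P : DiffOp d U) (h : V ≤ U) :
    P.1 ⟨V, h⟩ 1 = holRes d h (evalOne U P) := by
  exact (congrArg (P.1 ⟨V, h⟩) (map_one (holRes d h)).symm).trans
    (P.2.1 ⟨U, le_rfl⟩ ⟨V, h⟩ h 1).symm

theorem Coordinates.evalOne_polyOp (p : MvPolynomial (Fin d) ℂ) :
    evalOne U (polyOp C.del C.del_comm p) = algebraMap ℂ _ (MvPolynomial.constantCoeff p) := by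
  induction p using MvPolynomial.induction_on with
  | C c =>
    rw [MvPolynomial.constantCoeff_C, ← MvPolynomial.algebraMap_eq, AlgHom.commutes,
      Algebra.algebraMap_eq_smul_one, map_smul, Algebra.algebraMap_eq_smul_one]
    rfl
  | add p q hp hq => rw [map_add, map_add, hp, hq, map_add, map_add]
  | mul_X p j hp =>
    rw [map_mul MvPolynomial.constantCoeff, MvPolynomial.constantCoeff_X, mul_zero, map_zero,
      map_mul (polyOp C.del C.del_comm), polyOp_X]
    change (polyOp C.del C.del_comm p).1 _ ((C.del j).1 ⟨U, le_rfl⟩ 1) = 0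
    rw [(C.vectorField j).map_one, map_zero]

theorem Coordinates.exists_orderLT_polyOp (p : MvPolynomial (Fin d) ℂ) :
    ∃ N, OrderLT N (polyOp C.del C.del_comm p) := by
  induction p using MvPolynomial.induction_on with
  | C c =>
    refine ⟨1, ?_⟩
    rw [← MvPolynomial.algebraMap_eq, AlgHom.commutes, ← (mulOp d U).commutes]
    exact orderLT_mulOp _
  | add p q hp hq =>
    obtain ⟨N, hN⟩ := hp
    obtain ⟨N', hN'⟩ := hq
    refine ⟨max N N', fun V => ?_⟩
    rw [map_add]
    exact ((hN V).mono (le_max_left _ _)).add ((hN' V).mono (le_max_right _ _))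
  | mul_X p j hp =>
    obtain ⟨N, hN⟩ := hp
    rw [map_mul, polyOp_X]
    exact ⟨_, hN.mul (C.vectorField j).orderLT⟩

theorem Coordinates.orderLT_adBy {N : ℕ} {P : DiffOp d U} (hP : OrderLT (N + 1) P) (i : Fin d) :
    OrderLT N (adBy (C.zOp i) P) := by
  intro V
  have := (hP V _ ⟨holRes d V.2 (C.z i), rfl⟩).neg
  rwa [neg_sub] at this

theorem Coordinates.adWord_eq_zero {N : ℕ} {P : DiffOp d U} (hP : OrderLT N P) {w : List (Fin d)}
    (hw : N ≤ w.length) : adWord C.zOp w P = 0 := by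
  induction w generalizing N P with
  | nil =>
    obtain rfl : N = 0 := Nat.le_zero.1 hw
    exact Subtype.ext (funext fun V => hP V)
  | cons i w ih =>
    refine ih (N := N - 1) ?_ (Nat.sub_le_of_le_add hw)
    cases N with
    | zero => exact C.orderLT_adBy (fun V => (hP V).succ) i
    | succ N => exact C.orderLT_adBy hP i

/-- A differential operator of finite order vanishes if all its iterated commutators with the
coordinates kill the function `1`: by induction on the order it commutes with the coordinates, so by
Hadamard's lemma it vanishes. -/
theorem Coordinates.eq_zero_of_evalOne {N : ℕ} {P : DiffOp d U} (hP : OrderLT N P)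
    (h : ∀ w, evalOne U (adWord C.zOp w P) = 0) : P = 0 := by
  induction N generalizing P with
  | zero => exact Subtype.ext (funext fun V => hP V)
  | succ N ih =>
    -- The commutators with the coordinates have lower order and satisfy the same hypothesis.
    have h0 : ∀ i, adBy (C.zOp i) P = 0 := fun i =>
      ih (C.orderLT_adBy hP i) fun w => h (i :: w)
    have h1 : ∀ (V : {V : Opens M // V ≤ U}) (i : Fin d) (f : Hol d V.1),
        P.1 V (holRes d V.2 (C.z i) * f) = holRes d V.2 (C.z i) * P.1 V f := fun V i f =>
      sub_eq_zero.1 (DFunLike.congr_fun (congrFun (congrArg Subtype.val (h0 i)) V) f)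
    have h2 : ∀ V (hV : V ≤ U), P.1 ⟨V, hV⟩ 1 = 0 := fun V hV => by
      rw [evalOne_res, show evalOne U P = 0 from h [], map_zero]
    refine diffOp_ext fun V f => hol_ext fun y => ?_
    -- As `P` commutes with the coordinates, it maps
    -- `∑ (z i - z i (y)) g i` to `∑ (z i - z i (y)) P (g i)`.
    have key : ∀ f : Hol d V.1, f y = 0 → P.1 V f y = 0 := by
      intro f hf
      obtain ⟨W, hW, g, hyW, e⟩ := C.hadamard V.1 V.2 f y.1 y.2 hf
      have e1 : P.1 V f y = holRes d hW (P.1 V f) ⟨y.1, hyW⟩ := rfl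
      rw [e1, P.2.1 V ⟨W, hW.trans V.2⟩ hW, e, map_sum]
      have hsum : ∀ F : Fin d → Hol d W, (∑ i, F i) ⟨y.1, hyW⟩ = ∑ i, F i ⟨y.1, hyW⟩ := fun F =>
        map_sum (⟨⟨fun G : Hol d W => G ⟨y.1, hyW⟩, rfl⟩, fun _ _ => rfl⟩ : Hol d W →+ ℂ) F _
      rw [hsum]
      refine Finset.sum_eq_zero fun i _ => ?_
      rw [sub_mul, map_sub, h1 ⟨W, hW.trans V.2⟩ i, ← Algebra.smul_def, map_smul, Algebra.smul_def,
        ← sub_mul]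
      change (C.z i ⟨y.1, _⟩ - C.z i ⟨y.1, _⟩) * _ = (0 : ℂ)
      rw [sub_self, zero_mul]
    -- Subtracting the constant `f y`, which `P` kills, reduces to functions vanishing at `y`.
    have h3 := key (f - algebraMap ℂ _ (f y)) (sub_self _)
    rw [map_sub, Algebra.algebraMap_eq_smul_one, map_smul, h2 V.1 V.2, smul_zero, sub_zero] at h3
    exact h3

/-- The Taylor expansion of differential operators: the iterated commutators of both sides with the
coordinates agree at the function `1`. -/
theorem Coordinates.taylor_evalOne {N : ℕ} {P : DiffOp d U} (hP : OrderLT N P) :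
    P = ∑ α ∈ boxIndex (Fin d) N,
      mulOp d U (evalOne U (adWord C.zOp (indexWord α) P)) * C.e α := by
  choose N' hN' using fun α => C.exists_orderLT_polyOp (MvPolynomial.monomial α
    (∏ i, ((α i).factorial : ℂ)⁻¹))
  rw [← sub_eq_zero]
  refine C.eq_zero_of_evalOne (N := max N ((boxIndex (Fin d) N).sup fun α => N' α + 1))
    (fun V => Killed.sub ((hP V).mono (le_max_left _ _)) ?_) fun w => ?_
  · have e : (∑ α ∈ boxIndex (Fin d) N,
        mulOp d U (evalOne U (adWord C.zOp (indexWord α) P)) * C.e α).1 V =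
        ∑ α ∈ boxIndex (Fin d) N,
          (mulOp d U (evalOne U (adWord C.zOp (indexWord α) P)) * C.e α).1 V :=
      LinearMap.ext fun f => by rw [diffOp_sum_apply, LinearMap.sum_apply]
    rw [e]
    refine Killed.sum _ fun α hα => Killed.mono ?_ ((orderLT_mulOp _).mul (hN' α) V)
    exact le_max_of_le_right (Finset.le_sup (f := fun α => N' α + 1) hα)
  · have hz : ∀ (f : Hol d U) (i : Fin d), C.zOp i * mulOp d U f = mulOp d U f * C.zOp i :=
      fun f i => by rw [zOp, ← map_mul, ← map_mul, mul_comm]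
    rw [map_sub, map_sub, map_sum, map_sum]
    have hm : ∀ f Q, evalOne U (adWord C.zOp w (mulOp d U f * Q)) =
        f * evalOne U (adWord C.zOp w Q) := fun f Q =>
      congrArg (evalOne U) (adWord_mul_of_comm (hz f) w Q)
    simp only [hm]
    have hd : ∀ α, evalOne U (adWord C.zOp w (C.e α)) = if wordIndex w = α then 1 else 0 := fun α =>
      adWord_dividedDel C.zOp C.del C.del_comm C.adBy_del (evalOne U) C.evalOne_polyOp w α
    simp only [hd, mul_ite, mul_one, mul_zero]
    rw [Finset.sum_ite_eq]
    split_ifs with hw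
    -- Words with the same multi-index have the same iterated commutator.
    · rw [← adWord_perm C.zOp_comm (perm_indexWord w), sub_self]
    -- A word whose multi-index is outside the box is at least as long as the order of `P`.
    · rw [C.adWord_eq_zero hP, map_zero, sub_zero]
      by_contra hlt
      exact hw (wordIndex_mem_boxIndex (not_le.1 hlt).le)

/-- The iterated commutators with the coordinates, applied to a function, are combinations of values of
the operator. -/
theorem Coordinates.exists_adWord_eval (w : List (Fin d)) (g : Hol d U) :
    ∃ l : List (Hol d U × Hol d U), ∀ (V : Opens M) (h : V ≤ U) (P : DiffOp d V),
      (adWord (C.restrict h).zOp w P).1 ⟨V, le_rfl⟩ (holRes d h g) =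
        (l.map fun p => holRes d h p.1 * P.1 ⟨V, le_rfl⟩ (holRes d h p.2)).sum := by
  induction w with
  | nil => exact ⟨[(1, g)], fun V h P => by
      simp only [List.map_cons, List.map_nil, List.sum_cons, List.sum_nil, map_one, one_mul,
        add_zero]
      rfl⟩
  | cons i w ih =>
    obtain ⟨l, hl⟩ := ih
    refine ⟨l.flatMap fun p => [(p.1, C.z i * p.2), (-(p.1 * C.z i), p.2)], fun V h P => ?_⟩
    refine (hl V h (adBy ((C.restrict h).zOp i) P)).trans ?_
    clear hl
    induction l with
    | nil => rfl
    | cons p l ihl =>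
      rw [List.map_cons, List.sum_cons, ihl, List.flatMap_cons, List.map_append, List.sum_append]
      congr 1
      simp only [List.map_cons, List.map_nil, List.sum_cons, List.sum_nil, add_zero, map_neg,
        map_mul]
      change holRes d h p.1 * (P.1 ⟨V, le_rfl⟩ (holRes d h (C.z i) * holRes d h p.2) -
        holRes d h (C.z i) * P.1 ⟨V, le_rfl⟩ (holRes d h p.2)) = _
      ring

/-- The Taylor expansion of differential operators: the coefficients of `∂^α / α!` are fixed
combinations of values of the operator. -/
theorem Coordinates.taylor (α : Fin d →₀ ℕ) : ∃ l : List (Hol d U × Hol d U),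
    ∀ (V : Opens M) (h : V ≤ U) (P : DiffOp d V),
      evalOne V (adWord (C.restrict h).zOp (indexWord α) P) =
        (l.map fun p => holRes d h p.1 * P.1 ⟨V, le_rfl⟩ (holRes d h p.2)).sum := by
  obtain ⟨l, hl⟩ := C.exists_adWord_eval (indexWord α) 1
  refine ⟨l, fun V h P => ?_⟩
  rw [← hl V h P, map_one]
  rfl

/-- The functions giving the Taylor coefficients. -/
def Coordinates.taylorList (α : Fin d →₀ ℕ) : List (Hol d U × Hol d U) := (C.taylor α).choose

/-- The Taylor expansion on open subsets, with the functions `taylorList` independent of the subset. -/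
theorem Coordinates.eq_sum_taylorList {V : Opens M} (h : V ≤ U) {N : ℕ} {P : DiffOp d V}
    (hP : OrderLT N P) : P = ∑ α ∈ boxIndex (Fin d) N,
      mulOp d V (((C.taylorList α).map fun p =>
        holRes d h p.1 * P.1 ⟨V, le_rfl⟩ (holRes d h p.2)).sum) * diffOpRes d h (C.e α) := by
  conv_lhs => rw [(C.restrict h).taylor_evalOne hP]
  refine Finset.sum_congr rfl fun α _ => ?_
  have h2 : (C.restrict h).e α = diffOpRes d h (C.e α) :=
    (map_polyOp (A := DiffOp d U) (B := DiffOp d V) (diffOpRes d h) C.del C.del_comm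
      (C.restrict h).del (C.restrict h).del_comm (fun _ => rfl) _).symm
  rw [(C.taylor α).choose_spec V h P, h2]
  rfl

/-- Differential operators are generated by functions and vector fields. -/
theorem Coordinates.diffOp_mem_of_orderLT (C : Coordinates (d := d) U) (A : Subring (DiffOp d U))
    (h0 : ∀ f, mulOp d U f ∈ A)
    (h1 : ∀ τ, IsVectorField τ → τ ∈ A) {N : ℕ} {P : DiffOp d U} (hP : OrderLT N P) : P ∈ A := by
  rw [C.taylor_evalOne hP]
  refine sum_mem fun α _ => mul_mem (h0 _) ?_
  rw [e, dividedDel]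
  induction MvPolynomial.monomial α (∏ i, ((α i).factorial : ℂ)⁻¹) using
    MvPolynomial.induction_on with
  | C c =>
    rw [← MvPolynomial.algebraMap_eq, AlgHom.commutes, ← (mulOp d U).commutes]
    exact h0 _
  | add p q hp hq => rw [map_add]; exact add_mem hp hq
  | mul_X p j hp => rw [map_mul, polyOp_X]; exact mul_mem hp (h1 _ (C.vectorField j))

end Taylor

theorem list_sum_apply {ι : Type*} {U : Opens M} (l : List ι) (P : ι → DiffOp d U)
    (V : {V : Opens M // V ≤ U}) (f : Hol d V.1) :
    ((l.map P).sum).1 V f = (l.map fun i => (P i).1 V f).sum := by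
  induction l with
  | nil => rfl
  | cons i l ih => rw [List.map_cons, List.sum_cons, List.map_cons, List.sum_cons, ← ih]; rfl

/-- A bidifferential operator with the first argument fixed. -/
def BidiffOp.left {U : Opens M} (B : BidiffOp d U) (f : Hol d U) : DiffOp d U :=
  ⟨fun V => B.app V.1 V.2 (holRes d V.2 f), fun V W h g => by rw [B.res_app V.1 W.1 V.2 h]; rfl,
    fun x hx => by
      obtain ⟨W, hW, hxW, N, hN⟩ := B.order x hx
      exact ⟨W, hW, hxW, N, fun V hV => (hN V.1 V.2 hV _).1⟩⟩

/-- A bidifferential operator with the second argument fixed. -/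
def BidiffOp.right {U : Opens M} (B : BidiffOp d U) (g : Hol d U) : DiffOp d U :=
  ⟨fun V => (B.app V.1 V.2).flip (holRes d V.2 g),
    fun V W h f => by
      rw [LinearMap.flip_apply, LinearMap.flip_apply, B.res_app V.1 W.1 V.2 h]; rfl,
    fun x hx => by
      obtain ⟨W, hW, hxW, N, hN⟩ := B.order x hx
      exact ⟨W, hW, hxW, N, fun V hV => (hN V.1 V.2 hV _).2⟩⟩

/-- Restriction of bidifferential operators. -/
def BidiffOp.restrict {U V : Opens M} (B : BidiffOp d U) (h : V ≤ U) : BidiffOp d V where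
  app W hW := B.app W (hW.trans h)
  res_app W W' hW := B.res_app W W' (hW.trans h)
  order x hx := by
    obtain ⟨W, hW, hxW, N, hN⟩ := B.order x (h hx)
    exact ⟨W ⊓ V, inf_le_right, ⟨hxW, hx⟩, N, fun V' hV' hle =>
      hN V' (hV'.trans h) (hle.trans inf_le_left)⟩

/-- A bidifferential operator is locally a sum of products of differential operators: apply the Taylor
expansion in the second argument; its coefficients are differential operators in the first. -/
theorem BidiffOp.exists_factor [IsManifold 𝓘(ℂ, EuclideanSpace ℂ (Fin d)) ω M] {U : Opens M}
    (B : BidiffOp d U) {x : M} (hx : x ∈ U) : ∃ (W : Opens M) (hW : W ≤ U), x ∈ W ∧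
      ∃ l : List (DiffOp d W × DiffOp d W), ∀ (V : Opens M) (hV : V ≤ W) (f g : Hol d V),
        B.app V (hV.trans hW) f g = (l.map fun p => p.1.1 ⟨V, hV⟩ f * p.2.1 ⟨V, hV⟩ g).sum := by
  obtain ⟨U', hxU', ⟨C⟩⟩ := exists_coordinates (d := d) x
  obtain ⟨U'', hU'', hxU'', N, hN⟩ := B.order x hx
  let W : Opens M := U' ⊓ U''
  have hWU' : W ≤ U' := inf_le_left
  have hW : W ≤ U := inf_le_right.trans hU''
  let C' := C.restrict hWU'
  refine ⟨W, hW, ⟨hxU', hxU''⟩, (boxIndex (Fin d) N).toList.map fun α =>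
    (((C'.taylorList α).map fun p => mulOp d W p.1 * (B.restrict hW).right p.2).sum, C'.e α),
    fun V hV f g => ?_⟩
  have hP : OrderLT N ((B.restrict (hV.trans hW)).left f) := fun V' =>
    (hN V'.1 (V'.2.trans (hV.trans hW)) (V'.2.trans (hV.trans inf_le_right)) _).1
  have h1 := congrArg (fun P : DiffOp d V => P.1 ⟨V, le_rfl⟩ g) (C'.eq_sum_taylorList hV hP)
  refine Eq.trans ?_ (h1.trans ?_)
  · rfl
  · rw [diffOp_sum_apply, List.map_map, Finset.sum_map_toList]
    refine Finset.sum_congr rfl fun α _ => ?_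
    rw [Function.comp_apply, list_sum_apply]
    rfl

end DiffOps

/-! ### Operators with coefficients in `R` -/

theorem coef_mul_one_tmul {n : ℕ} {A : Type u} [Semiring A] [Algebra ℂ A] (i : Fin (n + 1))
    (u : Base n ⊗[ℂ] A) (e : A) :
    coef i (u * ((1 : Base n) ⊗ₜ[ℂ] e)) = coef i u * e := by
  induction u using TensorProduct.induction_on with
  | zero => rw [zero_mul, map_zero, zero_mul]
  | add t t' h h' => rw [add_mul, map_add, h, h', map_add, add_mul]
  | tmul r a => rw [Algebra.TensorProduct.tmul_mul_tmul, coef_tmul, coef_tmul, mul_one,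
      smul_mul_assoc]

theorem coef_tensorProductEnd {n : ℕ} {A H : Type u} [Semiring A] [Algebra ℂ A] [CommRing H]
    [Algebra ℂ H] (φ : A →ₐ[ℂ] Module.End ℂ H) (t : Base n ⊗[ℂ] A) (f : H) (i : Fin (n + 1)) :
    coef i (((LinearMap.tensorProductEnd ℂ (Base n) H).comp
      (Algebra.TensorProduct.map (AlgHom.id (Base n) (Base n)) φ)) t ((1 : Base n) ⊗ₜ[ℂ] f)) =
      φ (coef i t) f := by
  induction t using TensorProduct.induction_on with
  | zero => rw [map_zero, LinearMap.zero_apply, map_zero, map_zero, map_zero]; rfl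
  | add t t' h h' => rw [map_add, LinearMap.add_apply, map_add, h, h', map_add, map_add]; rfl
  | tmul r a =>
    change coef i (r • (φ a).baseChange (Base n) ((1 : Base n) ⊗ₜ[ℂ] f)) = _
    rw [LinearMap.baseChange_tmul, TensorProduct.smul_tmul', smul_eq_mul, mul_one, coef_tmul,
      coef_tmul, map_smul]
    rfl

theorem red_linearMap {n : ℕ} {A : Type u} [CommRing A] [Algebra ℂ A]
    (Q : Module.End (Base n) (Base n ⊗[ℂ] A)) (f : Base n ⊗[ℂ] A) :
    red n A (Q f) = coef 0 (Q ((1 : Base n) ⊗ₜ[ℂ] red n A f)) := by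
  obtain ⟨q, hq⟩ := eq_hbar_smul_of_red_eq (t := f) (t' := (1 : Base n) ⊗ₜ[ℂ] red n A f)
    (by rw [red_one_tmul])
  conv_lhs => rw [hq]
  rw [map_add, map_smul, map_add, red_hbar_smul, add_zero, red_eq_coef]

section OpsR

variable {d n : ℕ} {M : Type u} [TopologicalSpace M] [ChartedSpace (EuclideanSpace ℂ (Fin d)) M]

instance instRingDiffOpR (U : Opens M) : Ring (DiffOpR d n U) := inferInstance
instance instCommRingHolR (U : Opens M) : CommRing (HolR d n U) := inferInstance

theorem sheafLike_diffOpR :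
    SheafLike (fun U : Opens M => DiffOpR d n U) (fun h t => diffOpRRes d n h t) :=
  sheafLike_diffOp.baseChange (n := n) (fun {U V : Opens M} (h : V ≤ U) => (diffOpRes d h).toLinearMap)

theorem coef_holRRes {U V : Opens M} (h : V ≤ U) (f : HolR d n U) (i : Fin (n + 1)) :
    coef i (holRRes d n h f) = holRes d h (coef i f) :=
  coef_lTensor (holRes d h).toLinearMap i f

theorem coef_diffOpRRes {U V : Opens M} (h : V ≤ U) (t : DiffOpR d n U) (i : Fin (n + 1)) :
    coef i (diffOpRRes d n h t) = diffOpRes d h (coef i t) :=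
  coef_lTensor (diffOpRes d h).toLinearMap i t

theorem coef_orToDRSec {U : Opens M} (f : HolR d n U) (i : Fin (n + 1)) :
    coef i (orToDRSec (d := d) (n := n) U f) = mulOp d U (coef i f) :=
  coef_lTensor (mulOp d U).toLinearMap i f

theorem red_holRRes {U V : Opens M} (h : V ≤ U) (f : HolR d n U) :
    red n (Hol d V) (holRRes d n h f) = holRes d h (red n (Hol d U) f) := by
  rw [red_eq_coef, red_eq_coef, coef_holRRes]

theorem red_diffOpRRes {U V : Opens M} (h : V ≤ U) (t : DiffOpR d n U) :
    red n (DiffOp d V) (diffOpRRes d n h t) = diffOpRes d h (red n (DiffOp d U) t) :=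
  (red_eq_coef (A := DiffOp d V) _).trans ((coef_diffOpRRes h t 0).trans
    (congrArg (diffOpRes d h) (red_eq_coef (A := DiffOp d U) t).symm))

theorem coef_act {U : Opens M} (t : DiffOpR d n U) (V : {V : Opens M // V ≤ U}) (f : Hol d V.1)
    (i : Fin (n + 1)) : coef i (act d n U V t ((1 : Base n) ⊗ₜ[ℂ] f)) = (coef i t).1 V f :=
  coef_tensorProductEnd ((Pi.evalAlgHom ℂ _ V).comp (DiffOp d U).val) t f i

theorem act_injective {U : Opens M} {t t' : DiffOpR d n U}
    (h : ∀ V f, act d n U V t ((1 : Base n) ⊗ₜ[ℂ] f) = act d n U V t' ((1 : Base n) ⊗ₜ[ℂ] f)) :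
    t = t' :=
  coef_ext fun i => diffOp_ext fun V f => by rw [← coef_act, ← coef_act, h]

/-- An `R`-linear endomorphism of the sheaf `O_M ⊗ R` of locally finite order is the action of a section
of `D_M ⊗ R`. -/
theorem exists_act_eq {U : Opens M}
    (B : ∀ V : {V : Opens M // V ≤ U}, Module.End (Base n) (HolR d n V.1))
    (hres : ∀ (V W : {V : Opens M // V ≤ U}) (h : W.1 ≤ V.1) (f : HolR d n V.1),
      holRRes d n h (B V f) = B W (holRRes d n h f))
    (hord : ∀ x ∈ U, ∃ W ≤ U, x ∈ W ∧ ∃ N : ℕ, ∀ V : {V : Opens M // V ≤ U}, V.1 ≤ W →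
      Killed (mulPairs (Base n) (HolR d n V.1)) N (B V)) :
    ∃ t : DiffOpR d n U, ∀ V, act d n U V t = B V := by
  let P : Fin (n + 1) → DiffOp d U := fun i => ⟨fun V => coefOp i (B V), fun V W h f => by
      rw [coefOp_apply, coefOp_apply, ← coef_holRRes, hres V W h]
      rfl, fun x hx => by
      obtain ⟨W, hW, hxW, N, hN⟩ := hord x hx
      exact ⟨W, hW, hxW, N, fun V hV => killed_coefOp (hN V hV) i⟩⟩
  refine ⟨∑ i : Fin (n + 1), (hbar n ^ (i : ℕ)) ⊗ₜ[ℂ] P i, fun V => tmul_linear_ext fun f =>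
    coef_ext fun i => ?_⟩
  rw [coef_act, coef_sum]
  rfl

theorem red_act {U : Opens M} (t : DiffOpR d n U) (V : {V : Opens M // V ≤ U}) (f : HolR d n V.1) :
    red n (Hol d V.1) (act d n U V t f) = (red n (DiffOp d U) t).1 V (red n (Hol d V.1) f) :=
  (red_linearMap _ f).trans ((coef_act t V _ 0).trans
    (congrArg (fun P : DiffOp d U => P.1 V _) (red_eq_coef (A := DiffOp d U) t).symm))

theorem act_orToDRSec {U : Opens M} (s : HolR d n U) (V : {V : Opens M // V ≤ U})
    (f : HolR d n V.1) : act d n U V (orToDRSec (d := d) (n := n) U s) f = holRRes d n V.2 s * f := by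
  have key : act d n U V (orToDRSec (d := d) (n := n) U s) =
      LinearMap.mulLeft (Base n) (holRRes d n V.2 s) :=
    tmul_linear_ext fun g => coef_ext fun i => (coef_act _ V g i).trans
      ((congrArg (fun P : DiffOp d U => P.1 V g) (coef_orToDRSec s i)).trans
        ((congrArg (· * g) (coef_holRRes V.2 s i).symm).trans (coef_mul_one_tmul i _ g).symm))
  rw [key, LinearMap.mulLeft_apply]

/-- A bound for the orders of all coefficients of an operator can be found locally. -/
theorem exists_orderLT_coef {U : Opens M} (t : DiffOpR d n U) {x : M} (hx : x ∈ U) :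
    ∃ (V : Opens M) (h : V ≤ U), x ∈ V ∧ ∃ N, ∀ i, OrderLT N (coef i (diffOpRRes d n h t)) := by
  obtain ⟨V, h, hxV, N, hN⟩ := act_order t x hx
  refine ⟨V, h, hxV, N, fun i W => ?_⟩
  have e : (coef i (diffOpRRes d n h t)).1 W = coefOp i (act d n U ⟨W.1, W.2.trans h⟩ t) :=
    LinearMap.ext fun f => by
      refine Eq.trans ?_ (coef_act t ⟨W.1, W.2.trans h⟩ f i).symm
      rw [coef_diffOpRRes]; rfl
  rw [e]
  exact killed_coefOp (hN ⟨W.1, W.2.trans h⟩ W.2) i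

theorem OrderLT.mono {U : Opens M} {P : DiffOp d U} {N N' : ℕ} (hP : OrderLT N P) (h : N ≤ N') :
    OrderLT N' P := fun V => (hP V).mono h

/-- The Taylor expansion of operators with coefficients in `R`. -/
theorem Coordinates.eq_sum_taylorList_coef {U V : Opens M} (C : Coordinates (d := d) U) (h : V ≤ U)
    {N : ℕ} {t : DiffOpR d n V} (ht : ∀ i, OrderLT N (coef i t)) :
    t = ∑ α ∈ boxIndex (Fin d) N, orToDRSec (d := d) (n := n) V (((C.taylorList α).map fun p =>
      ((1 : Base n) ⊗ₜ[ℂ] holRes d h p.1 : HolR d n V) *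
        act d n V ⟨V, le_rfl⟩ t ((1 : Base n) ⊗ₜ[ℂ] holRes d h p.2)).sum) *
      ((1 : Base n) ⊗ₜ[ℂ] diffOpRes d h (C.e α) : DiffOpR d n V) := by
  refine coef_ext fun i => ?_
  conv_lhs => rw [C.eq_sum_taylorList h (ht i)]
  rw [map_sum]
  refine Finset.sum_congr rfl fun α _ => ?_
  rw [coef_mul_one_tmul, coef_orToDRSec]
  congr 2
  generalize C.taylorList α = l
  induction l with
  | nil => rw [List.map_nil, List.map_nil, List.sum_nil, List.sum_nil, map_zero]
  | cons p l ih =>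
    rw [List.map_cons, List.map_cons, List.sum_cons, List.sum_cons, map_add, ih,
      coef_one_tmul_mul]
    exact congrArg (_ * · + _) (coef_act t ⟨V, le_rfl⟩ (holRes d h p.2) i).symm

end OpsR

/-! ### Separating families of functionals -/

section Separates

variable {A : Type*} [CommRing A] {P : Type*} [AddCommGroup P] [Module A P]

/-- A set of functionals separates if some sequence of finite rank endomorphisms `∑ φ(·) • e`, with
functionals `φ` in its span, is eventually the identity on each element. -/
def Separates (Λ : Set (Module.Dual A P)) : Prop :=
  ∃ l : ℕ → List (Module.Dual A P × P), (∀ N, ∀ p ∈ l N, p.1 ∈ Submodule.span A Λ) ∧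
    ∀ a : P, ∃ N₀, ∀ N, N₀ ≤ N → a = ((l N).map fun p => p.1 a • p.2).sum

/-- Contraction of the first factor of a tensor with a functional. -/
def contract (φ : Module.Dual A P) (Q : Type*) [AddCommGroup Q] [Module A Q] :
    TensorProduct A P Q →ₗ[A] Q :=
  (TensorProduct.lid A Q).toLinearMap ∘ₗ LinearMap.rTensor Q φ

theorem contract_tmul (φ : Module.Dual A P) {Q : Type*} [AddCommGroup Q] [Module A Q] (p : P) (q : Q) :
    contract φ Q (p ⊗ₜ[A] q) = φ p • q := rfl

/-- A tensor is determined by its contractions with a separating set of functionals. -/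
theorem Separates.eq_zero {Λ : Set (Module.Dual A P)} (h : Separates Λ) {Q : Type*} [AddCommGroup Q]
    [Module A Q] {T : TensorProduct A P Q} (hT : ∀ φ ∈ Λ, contract φ Q T = 0) : T = 0 := by
  obtain ⟨l, hl, hl'⟩ := h
  have hspan : ∀ φ ∈ Submodule.span A Λ, contract φ Q T = 0 := by
    intro φ hφ
    induction hφ using Submodule.span_induction with
    | mem φ h => exact hT φ h
    | zero => simp [contract]
    | add φ ψ _ _ h1 h2 =>
      have : contract (φ + ψ) Q T = contract φ Q T + contract ψ Q T := by
        simp [contract, LinearMap.rTensor_add]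
      rw [this, h1, h2, add_zero]
    | smul r φ _ h1 =>
      have : contract (r • φ) Q T = r • contract φ Q T := by
        simp [contract, LinearMap.rTensor_smul]
      rw [this, h1, smul_zero]
  -- The approximate identity of `P`, tensored with `Q`, is eventually the identity on each tensor.
  have key : ∀ T : TensorProduct A P Q, ∃ N₀, ∀ N, N₀ ≤ N →
      T = ((l N).map fun p => p.2 ⊗ₜ[A] contract p.1 Q T).sum := by
    intro T
    induction T using TensorProduct.induction_on with
    | zero => exact ⟨0, fun N _ => by simp⟩
    | tmul p q =>
      obtain ⟨N₀, hN₀⟩ := hl' p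
      refine ⟨N₀, fun N hN => ?_⟩
      conv_lhs => rw [hN₀ N hN]
      induction l N with
      | nil => simp
      | cons a l ih =>
        rw [List.map_cons, List.sum_cons, List.map_cons, List.sum_cons, TensorProduct.add_tmul, ih,
          contract_tmul, TensorProduct.tmul_smul, TensorProduct.smul_tmul']
    | add T T' h h' =>
      obtain ⟨N₁, h₁⟩ := h
      obtain ⟨N₂, h₂⟩ := h'
      refine ⟨max N₁ N₂, fun N hN => ?_⟩
      conv_lhs => rw [h₁ N ((le_max_left _ _).trans hN), h₂ N ((le_max_right _ _).trans hN)]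
      rw [← List.sum_map_add]
      simp only [map_add, TensorProduct.tmul_add]
  obtain ⟨N₀, hN₀⟩ := key T
  rw [hN₀ N₀ le_rfl]
  refine List.sum_eq_zero fun q hq => ?_
  obtain ⟨p, hp, rfl⟩ := List.mem_map.1 hq
  rw [hspan _ (hl _ _ hp), TensorProduct.tmul_zero]

theorem Separates.eq_zero' {Λ : Set (Module.Dual A P)} (h : Separates Λ) {a : P}
    (ha : ∀ φ ∈ Λ, φ a = 0) : a = 0 := by
  have : a ⊗ₜ[A] (1 : A) = 0 := h.eq_zero fun φ hφ => by rw [contract_tmul, ha φ hφ, zero_smul]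
  simpa using congrArg (TensorProduct.rid A P) this

/-- The pairing of a tensor with two functionals. -/
def pair (φ ψ : Module.Dual A P) : TensorProduct A P P →ₗ[A] A := ψ ∘ₗ contract φ P

theorem pair_tmul (φ ψ : Module.Dual A P) (p q : P) : pair φ ψ (p ⊗ₜ[A] q) = φ p * ψ q := by
  rw [pair, LinearMap.comp_apply, contract_tmul, map_smul, smul_eq_mul]

theorem Separates.eq_of_pair {Λ : Set (Module.Dual A P)} (h : Separates Λ)
    {T T' : TensorProduct A P P} (hT : ∀ φ ∈ Λ, ∀ ψ ∈ Λ, pair φ ψ T = pair φ ψ T') : T = T' :=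
  sub_eq_zero.1 <| h.eq_zero fun φ hφ => h.eq_zero' fun ψ hψ => by
    rw [map_sub, map_sub, sub_eq_zero]; exact hT φ hφ ψ hψ

theorem Separates.eq_of_pair₃ {Λ : Set (Module.Dual A P)} (h : Separates Λ)
    {T T' : TensorProduct A P (TensorProduct A P P)}
    (hT : ∀ φ ∈ Λ, ∀ ψ ∈ Λ, ∀ χ ∈ Λ, pair ψ χ (contract φ _ T) = pair ψ χ (contract φ _ T')) :
    T = T' :=
  sub_eq_zero.1 <| h.eq_zero fun φ hφ => h.eq_of_pair fun ψ hψ χ hχ => by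
    rw [map_sub, map_sub, map_zero, sub_eq_zero]; exact hT φ hφ ψ hψ χ hχ

/-- A coalgebra structure dual to a multiplication on a separating family of functionals. -/
theorem exists_coalgebra_of_separates {S : Type*} (ev : S → Module.Dual A P)
    (hsep : Separates (Set.range ev)) (m : S → S → S) (one : S)
    (hassoc : ∀ s t r, ev (m (m s t) r) = ev (m s (m t r)))
    (hone : ∀ s, ev (m one s) = ev s) (hone' : ∀ s, ev (m s one) = ev s)
    (hex : ∀ a : P, ∃ T : TensorProduct A P P, ∀ s t, pair (ev s) (ev t) T = ev (m s t) a) :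
    ∃ C : Coalgebra A P, (∀ a s t, pair (ev s) (ev t) (C.comul a) = ev (m s t) a) ∧
      C.counit = ev one := by
  -- The choice of `Δ a` is unique, hence linear in `a`.
  choose T hT using hex
  have uniq : ∀ {a : P} {T' : TensorProduct A P P}, (∀ s t, pair (ev s) (ev t) T' = ev (m s t) a) →
      T a = T' := by
    intro a T' h
    refine hsep.eq_of_pair ?_
    rintro _ ⟨s, rfl⟩ _ ⟨t, rfl⟩
    rw [hT, h]
  let Δ : P →ₗ[A] TensorProduct A P P :=
    { toFun := T
      map_add' := fun a b => uniq fun s t => by rw [map_add, map_add, hT, hT]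
      map_smul' := fun r a => uniq fun s t => by
        rw [map_smul, map_smul, hT, RingHom.id_apply] }
  have hΔ : ∀ a s t, pair (ev s) (ev t) (Δ a) = ev (m s t) a := hT
  refine ⟨
    { comul := Δ
      counit := ev one
      coassoc := ?_
      rTensor_counit_comp_comul := ?_
      lTensor_counit_comp_comul := ?_ }, hΔ, rfl⟩
  · refine LinearMap.ext fun a => hsep.eq_of_pair₃ ?_
    rintro _ ⟨s, rfl⟩ _ ⟨t, rfl⟩ _ ⟨r, rfl⟩
    -- The two sides of coassociativity pair with `s`, `t`, `r` to `(s t) r` and `s (t r)`.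
    have h1 : ∀ T : TensorProduct A P P, pair (ev t) (ev r) (contract (ev s) _
        (TensorProduct.assoc A P P P (Δ.rTensor P T))) = pair (ev (m s t)) (ev r) T := by
      intro T
      induction T using TensorProduct.induction_on with
      | zero => simp only [map_zero]
      | add T T' h h' => simp only [map_add, h, h']
      | tmul p q =>
        rw [LinearMap.rTensor_tmul, pair_tmul, ← hΔ]
        generalize Δ p = D
        induction D using TensorProduct.induction_on with
        | zero => simp only [TensorProduct.zero_tmul, map_zero, zero_mul]
        | add D D' h h' => simp only [TensorProduct.add_tmul, map_add, h, h', add_mul]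
        | tmul p' q' =>
          rw [TensorProduct.assoc_tmul, contract_tmul, map_smul, pair_tmul, pair_tmul, smul_eq_mul,
            mul_assoc]
    have h2 : ∀ T : TensorProduct A P P, pair (ev t) (ev r) (contract (ev s) _ (Δ.lTensor P T)) =
        pair (ev s) (ev (m t r)) T := by
      intro T
      induction T using TensorProduct.induction_on with
      | zero => simp only [map_zero]
      | add T T' h h' => simp only [map_add, h, h']
      | tmul p q => rw [LinearMap.lTensor_tmul, contract_tmul, map_smul, hΔ, pair_tmul, smul_eq_mul]
    refine (h1 (Δ a)).trans (Eq.trans ?_ (h2 (Δ a)).symm)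
    rw [hΔ, hΔ, hassoc]
  · refine LinearMap.ext fun a => (TensorProduct.lid A P).injective ?_
    refine sub_eq_zero.1 (hsep.eq_zero' ?_)
    rintro _ ⟨s, rfl⟩
    rw [map_sub, sub_eq_zero]
    change pair (ev one) (ev s) (Δ a) = ev s ((1 : A) • a)
    rw [hΔ, hone, one_smul]
  · refine LinearMap.ext fun a => (TensorProduct.rid A P).injective ?_
    refine sub_eq_zero.1 (hsep.eq_zero' ?_)
    rintro _ ⟨s, rfl⟩
    have h1 : ∀ T : TensorProduct A P P,
        ev s (TensorProduct.rid A P ((ev one).lTensor P T)) = pair (ev s) (ev one) T := by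
      intro T
      induction T using TensorProduct.induction_on with
      | zero => simp only [map_zero]
      | add T T' h h' => simp only [map_add, h, h']
      | tmul p q =>
        rw [LinearMap.lTensor_tmul, TensorProduct.rid_tmul, map_smul, pair_tmul, smul_eq_mul, mul_comm]
    rw [map_sub, sub_eq_zero]
    refine (h1 (Δ a)).trans ?_
    rw [hΔ, hone']
    change ev s a = ev s ((1 : A) • a)
    rw [one_smul]

end Separates

/-! ### The rings of sections -/

section Rings

variable {d n : ℕ} {M : Type u} [TopologicalSpace M] [ChartedSpace (EuclideanSpace ℂ (Fin d)) M]

variable (d n) in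
/-- The ring of sections of `O_M ⊗ R`, as a type that does not unfold to a tensor product. -/
def FunR (U : Opens M) : Type u := HolR d n U

variable (d n) in
/-- The ring of sections of `D_M ⊗ R`, as a type that does not unfold to a tensor product. -/
def DOpR (U : Opens M) : Type u := DiffOpR d n U

instance (U : Opens M) : CommRing (FunR d n U) := inferInstanceAs (CommRing (HolR d n U))
instance (U : Opens M) : Algebra (Base n) (FunR d n U) :=
  inferInstanceAs (Algebra (Base n) (HolR d n U))
instance (U : Opens M) : Ring (DOpR d n U) := inferInstanceAs (Ring (DiffOpR d n U))
instance (U : Opens M) : Algebra (Base n) (DOpR d n U) :=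
  inferInstanceAs (Algebra (Base n) (DiffOpR d n U))
instance (F : PresheafOfModules.{u} (DR d n M)) (U : Opens M) : Module (DOpR d n U) (sec F U) :=
  inferInstanceAs (Module (DiffOpR d n U) (sec F U))

/-- A function as a section of `O_M ⊗ R`. -/
def ofHol {U : Opens M} : Hol d U →+* FunR d n U :=
  (Algebra.TensorProduct.includeRight : Hol d U →ₐ[ℂ] HolR d n U).toRingHom

/-- An operator as a section of `D_M ⊗ R`. -/
def ofOp {U : Opens M} : DiffOp d U →+* DOpR d n U :=
  (Algebra.TensorProduct.includeRight : DiffOp d U →ₐ[ℂ] DiffOpR d n U).toRingHom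

/-- Restriction of sections of `O_M ⊗ R`. -/
def fres {U V : Opens M} (h : V ≤ U) : FunR d n U →ₐ[Base n] FunR d n V := holRRes d n h

/-- Restriction of sections of `D_M ⊗ R`. -/
def dres {U V : Opens M} (h : V ≤ U) : DOpR d n U →ₐ[Base n] DOpR d n V := diffOpRRes d n h

/-- Sections of `O_M ⊗ R` as operators of order zero. -/
def ofFun {U : Opens M} : FunR d n U →ₐ[Base n] DOpR d n U := orToDRSec U

/-- The action of `D_M ⊗ R` on `O_M ⊗ R` on sections. -/
def dact {U : Opens M} : DOpR d n U →ₐ[Base n] Module.End (Base n) (FunR d n U) :=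
  act d n U ⟨U, le_rfl⟩

/-- Germs of sections of `O_M ⊗ R`. -/
def fgerm {U : Opens M} {x : M} (hx : x ∈ U) : FunR d n U →+* StalkOR d n M x := germOR d n U x hx

/-- Reduction of functions modulo `ħ`. -/
def fred {U : Opens M} : FunR d n U →+* Hol d U := (red n (Hol d U)).toRingHom

/-- Reduction of operators modulo `ħ`. -/
def dred {U : Opens M} : DOpR d n U →+* DiffOp d U := (red n (DiffOp d U)).toRingHom

theorem fres_self (U : Opens M) (f : FunR d n U) : fres le_rfl f = f :=
  DFunLike.congr_fun (holRRes_self d n U) f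

theorem fres_fres {U V W : Opens M} (h : V ≤ U) (h' : W ≤ V) (f : FunR d n U) :
    fres h' (fres h f) = fres (h'.trans h) f :=
  DFunLike.congr_fun (holRRes_comp d n h h') f

theorem dres_self (U : Opens M) (t : DOpR d n U) : dres le_rfl t = t :=
  DFunLike.congr_fun (diffOpRRes_self d n U) t

theorem dres_dres {U V W : Opens M} (h : V ≤ U) (h' : W ≤ V) (t : DOpR d n U) :
    dres h' (dres h t) = dres (h'.trans h) t :=
  DFunLike.congr_fun (diffOpRRes_comp d n h h') t

theorem fres_ofHol {U V : Opens M} (h : V ≤ U) (f : Hol d U) :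
    fres h (ofHol f : FunR d n U) = ofHol (holRes d h f) := rfl

theorem dres_ofOp {U V : Opens M} (h : V ≤ U) (P : DiffOp d U) :
    dres h (ofOp P : DOpR d n U) = ofOp (diffOpRes d h P) := rfl

theorem fred_ofHol {U : Opens M} (f : Hol d U) : fred (ofHol f : FunR d n U) = f := red_one_tmul f

theorem dred_ofOp {U : Opens M} (P : DiffOp d U) : dred (ofOp P : DOpR d n U) = P := red_one_tmul P

theorem fred_fres {U V : Opens M} (h : V ≤ U) (f : FunR d n U) :
    fred (fres h f) = holRes d h (fred f) := red_holRRes h f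

theorem dred_dres {U V : Opens M} (h : V ≤ U) (t : DOpR d n U) :
    dred (dres h t) = diffOpRes d h (dred t) := red_diffOpRRes h t

theorem fred_hbar_smul {U : Opens M} (f : FunR d n U) : fred (hbar n • f) = 0 := red_hbar_smul f

theorem eq_hbar_smul_of_fred_eq {U : Opens M} {f g : FunR d n U} (h : fred f = fred g) :
    ∃ q : FunR d n U, f = g + hbar n • q := eq_hbar_smul_of_red_eq h

theorem eq_hbar_smul_of_dred_eq {U : Opens M} {t t' : DOpR d n U} (h : dred t = dred t') :
    ∃ q : DOpR d n U, t = t' + hbar n • q := eq_hbar_smul_of_red_eq (A := DiffOp d U) h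

theorem dact_dres {U V : Opens M} (h : V ≤ U) (t : DOpR d n U) (f : FunR d n V) :
    dact (dres h t) f = act d n U ⟨V, h⟩ t f :=
  DFunLike.congr_fun (act_diffOpRRes h t ⟨V, le_rfl⟩) f

theorem fres_dact {U V : Opens M} (h : V ≤ U) (t : DOpR d n U) (f : FunR d n U) :
    fres h (dact t f) = dact (dres h t) (fres h f) :=
  (act_res t ⟨U, le_rfl⟩ ⟨V, h⟩ h f).trans (dact_dres h t _).symm

theorem dact_mul {U : Opens M} (t t' : DOpR d n U) (f : FunR d n U) :
    dact (t * t') f = dact t (dact t' f) := DFunLike.congr_fun (map_mul dact t t') f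

theorem dact_add {U : Opens M} (t t' : DOpR d n U) (f : FunR d n U) :
    dact (t + t') f = dact t f + dact t' f := DFunLike.congr_fun (map_add dact t t') f

theorem dact_ofFun {U : Opens M} (s f : FunR d n U) : dact (ofFun s) f = s * f :=
  (act_orToDRSec (n := n) s ⟨U, le_rfl⟩ f).trans (congrArg (· * f) (fres_self U s))

theorem fred_dact {U : Opens M} (t : DOpR d n U) (f : FunR d n U) :
    fred (dact t f) = (dred t).1 ⟨U, le_rfl⟩ (fred f) := red_act t ⟨U, le_rfl⟩ f

theorem dact_ofOp {U : Opens M} (P : DiffOp d U) (f : Hol d U) :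
    dact (ofOp P : DOpR d n U) (ofHol f) = ofHol (P.1 ⟨U, le_rfl⟩ f) :=
  (congrArg (fun Q : Module.End (Base n) (HolR d n U) => Q ((1 : Base n) ⊗ₜ[ℂ] f))
    (act_tmul d n U ⟨U, le_rfl⟩ 1 P)).trans
    (DFunLike.congr_fun (one_smul (Base n) ((P.1 ⟨U, le_rfl⟩).baseChange (Base n))) _)

/-- Sections of `O_M ⊗ R` are combinations of functions. -/
theorem funR_linear_ext {B : Type*} [AddCommGroup B] [Module (Base n) B] {U : Opens M}
    {Q Q' : FunR d n U →ₗ[Base n] B} (h : ∀ f : Hol d U, Q (ofHol f) = Q' (ofHol f)) : Q = Q' :=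
  tmul_linear_ext h

theorem dact_injective {U : Opens M} {t t' : DOpR d n U}
    (h : ∀ V (h : V ≤ U) (f : Hol d V), dact (dres h t) (ofHol f) = dact (dres h t') (ofHol f)) :
    t = t' :=
  act_injective fun V f => by
    have := h V.1 V.2 f
    rw [dact_dres, dact_dres] at this
    exact this

theorem exists_dact_eq {U : Opens M}
    (B : ∀ V : {V : Opens M // V ≤ U}, Module.End (Base n) (FunR d n V.1))
    (hres : ∀ (V W : {V : Opens M // V ≤ U}) (h : W.1 ≤ V.1) (f : FunR d n V.1),
      fres h (B V f) = B W (fres h f))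
    (hord : ∀ x ∈ U, ∃ W ≤ U, x ∈ W ∧ ∃ N : ℕ, ∀ V : {V : Opens M // V ≤ U}, V.1 ≤ W →
      Killed (mulPairs (Base n) (FunR d n V.1)) N (B V)) :
    ∃ t : DOpR d n U, ∀ V, dact (dres V.2 t) = B V := by
  obtain ⟨t, ht⟩ := exists_act_eq (n := n) (U := U) B hres hord
  exact ⟨t, fun V => LinearMap.ext fun f => (dact_dres V.2 t f).trans (DFunLike.congr_fun (ht V) f)⟩

theorem killed_dact {U : Opens M} (t : DOpR d n U) {x : M} (hx : x ∈ U) :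
    ∃ W ≤ U, x ∈ W ∧ ∃ N : ℕ, ∀ V : {V : Opens M // V ≤ U}, V.1 ≤ W →
      Killed (mulPairs (Base n) (FunR d n V.1)) N (dact (dres V.2 t)) := by
  obtain ⟨W, hW, hxW, N, hN⟩ := act_order t x hx
  refine ⟨W, hW, hxW, N, fun V hV => ?_⟩
  have e : dact (dres V.2 t) = act d n U V t := act_diffOpRRes V.2 t ⟨V.1, le_rfl⟩
  rw [e]
  exact hN V hV

theorem sheafLike_funR : SheafLike (fun U : Opens M => FunR d n U) (fun h f => fres h f) :=
  sheafLike_holR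

theorem sheafLike_dOpR : SheafLike (fun U : Opens M => DOpR d n U) (fun h t => dres h t) :=
  sheafLike_diffOpR

/-- A bound for the order, uniform in the coefficients of the powers of `ħ`. -/
def DOpR.OrderLT {U : Opens M} (N : ℕ) (t : DOpR d n U) : Prop :=
  ∀ i, StarQuant.OrderLT N (coef i (show DiffOpR d n U from t))

theorem DOpR.exists_orderLT {U : Opens M} (t : DOpR d n U) {x : M} (hx : x ∈ U) :
    ∃ (V : Opens M) (h : V ≤ U), x ∈ V ∧ ∃ N, (dres h t).OrderLT N := exists_orderLT_coef t hx

theorem DOpR.OrderLT.mono {U : Opens M} {N N' : ℕ} {t : DOpR d n U} (h : t.OrderLT N)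
    (hN : N ≤ N') : t.OrderLT N' := fun i => (h i).mono hN

/-- The Taylor expansion of operators with coefficients in `R`. -/
theorem Coordinates.eq_sum_taylorList_dOpR {U V : Opens M} (C : Coordinates (d := d) U) (h : V ≤ U)
    {N : ℕ} {t : DOpR d n V} (ht : t.OrderLT N) :
    t = ∑ α ∈ boxIndex (Fin d) N, ofFun (((C.taylorList α).map fun p =>
      fres h (ofHol p.1) * dact t (fres h (ofHol p.2))).sum) * dres h (ofOp (C.e α)) :=
  C.eq_sum_taylorList_coef h ht

section Modules

variable (F : PresheafOfModules.{u} (DR d n M))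

theorem secRes_dsmul {U V : Opens M} (h : V ≤ U) (t : DOpR d n U) (a : sec F U) :
    secRes F h (t • a) = dres h t • secRes F h a := secRes_smul F h t a

theorem germ_ofFun_smul {U : Opens M} {x : M} (hx : x ∈ U) (s : FunR d n U) (a : sec F U) :
    germ F U x hx (ofFun s • a) = fgerm hx s • germ F U x hx a := germ_smul F U x hx s a

theorem fgerm_algebraMap {U : Opens M} {x : M} (hx : x ∈ U) (r : Base n) :
    fgerm (d := d) hx (algebraMap (Base n) (FunR d n U) r) =
      algebraMap (Base n) (StalkOR d n M x) r := by
  have h1 := TopCat.Presheaf.germ_res_apply (OR d n M) (homOfLE (le_top : U ≤ ⊤)) x hx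
    (algebraMap (Base n) (HolR d n (⊤ : Opens M)) r)
  refine Eq.trans ?_ h1
  exact congrArg (germOR d n U x hx) ((holRRes d n (le_top : U ≤ ⊤)).commutes r).symm

theorem fgerm_smul {U : Opens M} {x : M} (hx : x ∈ U) (r : Base n) (f : FunR d n U) :
    fgerm hx (r • f) = r • fgerm hx f := by
  rw [Algebra.smul_def, map_mul, fgerm_algebraMap, Algebra.smul_def]

theorem germ_algebraMap_smul {U : Opens M} {x : M} (hx : x ∈ U) (r : Base n) (a : sec F U) :
    germ F U x hx (algebraMap (Base n) (DOpR d n U) r • a) = r • germ F U x hx a := by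
  rw [← ofFun.commutes, germ_ofFun_smul, fgerm_algebraMap]
  rfl

end Modules

end Rings

/-! ### Germs -/

section Stalks

variable {d n : ℕ} {M : Type u} [TopologicalSpace M] [ChartedSpace (EuclideanSpace ℂ (Fin d)) M]

section Sec

variable (F : PresheafOfModules.{u} (DR d n M))

theorem secRes_self (U : Opens M) (a : sec F U) : secRes F le_rfl a = a := by
  have : F.presheaf.map (ophom (le_refl U)) = 𝟙 _ := F.presheaf.map_id _
  change F.presheaf.map (ophom (le_refl U)) a = a
  rw [this]
  rfl

theorem secRes_res {U V W : Opens M} (h : V ≤ U) (h' : W ≤ V) (a : sec F U) :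
    secRes F h' (secRes F h a) = secRes F (h'.trans h) a := by
  have : F.presheaf.map (ophom (h'.trans h)) = F.presheaf.map (ophom h) ≫ F.presheaf.map (ophom h') :=
    F.presheaf.map_comp (ophom h) (ophom h')
  exact (DFunLike.congr_fun (congrArg AddCommGrpCat.Hom.hom this) a).symm

theorem germ_res {U V : Opens M} (h : V ≤ U) {x : M} (hx : x ∈ V) (a : sec F U) :
    germ F V x hx (secRes F h a) = germ F U x (h hx) a :=
  TopCat.Presheaf.germ_res_apply (X := TopCat.of M) (asO F).presheaf (homOfLE h) x hx a

theorem exists_germ_eq {x : M} (a : Stalk F x) {U : Opens M} (hx : x ∈ U) :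
    ∃ (V : Opens M) (_ : V ≤ U) (hxV : x ∈ V) (b : sec F V), germ F V x hxV b = a := by
  obtain ⟨V, hV, hxV, b, hb⟩ := TopCat.Presheaf.exists_le_germ_eq (X := TopCat.of M)
    (asO F).presheaf (x := x) a (V := U) hx
  exact ⟨V, hV, hxV, b, hb⟩

theorem exists_secRes_eq {x : M} {U V : Opens M} (hU : x ∈ U) (hV : x ∈ V) (a : sec F U) (b : sec F V)
    (h : germ F U x hU a = germ F V x hV b) :
    ∃ (W : Opens M) (h : W ≤ U) (h' : W ≤ V), x ∈ W ∧ secRes F h a = secRes F h' b := by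
  obtain ⟨W, hW, i, j, e⟩ := TopCat.Presheaf.germ_eq (X := TopCat.of M) (asO F).presheaf x hU hV a b h
  exact ⟨W, leOfHom i, leOfHom j, hW, e⟩

end Sec

theorem fgerm_fres {U V : Opens M} (h : V ≤ U) {x : M} (hx : x ∈ V) (f : FunR d n U) :
    fgerm hx (fres h f) = fgerm (h hx) f :=
  TopCat.Presheaf.germ_res_apply (OR d n M) (homOfLE h) x hx f

theorem exists_fgerm_eq {x : M} (f : StalkOR d n M x) {U : Opens M} (hx : x ∈ U) :
    ∃ (V : Opens M) (_ : V ≤ U) (hxV : x ∈ V) (g : FunR d n V), fgerm hxV g = f := by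
  obtain ⟨V, hV, hxV, b, hb⟩ := TopCat.Presheaf.exists_le_germ_eq (OR d n M) (x := x) f (V := U) hx
  exact ⟨V, hV, hxV, b, hb⟩

theorem exists_fres_eq {x : M} {U V : Opens M} (hU : x ∈ U) (hV : x ∈ V) (f : FunR d n U)
    (g : FunR d n V) (h : fgerm hU f = fgerm hV g) :
    ∃ (W : Opens M) (h : W ≤ U) (h' : W ≤ V), x ∈ W ∧ fres h f = fres h' g := by
  obtain ⟨W, hW, i, j, e⟩ := TopCat.Presheaf.germ_eq (OR d n M) x hU hV f g h
  exact ⟨W, leOfHom i, leOfHom j, hW, e⟩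

theorem funR_ext {U : Opens M} {f g : FunR d n U}
    (h : ∀ x (hx : x ∈ U), fgerm hx f = fgerm hx g) : f = g :=
  sheafLike_funR.sep U f g fun x hx => by
    obtain ⟨W, h1, _, hxW, e⟩ := exists_fres_eq hx hx f g (h x hx)
    exact ⟨W, h1, hxW, e⟩

/-- Linear maps out of a stalk, from compatible linear maps on sections near the point. -/
theorem exists_stalk_lift {F : PresheafOfModules.{u} (DR d n M)} {A : Type*} [AddCommGroup A] {x : M}
    [Module (StalkOR d n M x) A] {U : Opens M} (hx : x ∈ U)
    (φ : ∀ V : Opens M, V ≤ U → x ∈ V → sec F V → A)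
    (hadd : ∀ V h hx a b, φ V h hx (a + b) = φ V h hx a + φ V h hx b)
    (hres : ∀ V W (hV : V ≤ U) (h : W ≤ V) (hxW : x ∈ W) (a : sec F V),
      φ W (h.trans hV) hxW (secRes F h a) = φ V hV (h hxW) a)
    (hsmul : ∀ V h hx (s : FunR d n V) a,
      φ V h hx (ofFun s • a) = fgerm hx s • φ V h hx a) :
    ∃ L : Stalk F x →ₗ[StalkOR d n M x] A, ∀ V h hxV a, L (germ F V x hxV a) = φ V h hxV a := by
  -- The value at a germ is defined by a chosen representative; `key` is the independence of the choice.
  choose V hV hxV b hb using fun a : Stalk F x => exists_germ_eq F a hx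
  have key : ∀ W (h : W ≤ U) (hxW : x ∈ W) (a : sec F W),
      φ _ (hV (germ F W x hxW a)) (hxV _) (b (germ F W x hxW a)) = φ W h hxW a := by
    intro W h hxW a
    obtain ⟨W', h1, h2, hxW', e⟩ := exists_secRes_eq F _ _ _ _ (hb (germ F W x hxW a))
    rw [← hres _ W' _ h1 hxW', ← hres _ W' h h2 hxW', e]
  refine ⟨⟨⟨fun a => φ (V a) (hV a) (hxV a) (b a), fun a₁ a₂ => ?_⟩, fun r a => ?_⟩, key⟩
  · obtain ⟨W, hW, hxW, c, rfl⟩ := exists_germ_eq F a₁ hx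
    obtain ⟨W', hW', hxW', c', rfl⟩ := exists_germ_eq F a₂ hxW
    rw [← germ_res F hW' hxW' c, ← map_add, key W' (hW'.trans hW), key W' (hW'.trans hW),
      key W' (hW'.trans hW), hadd]
  · obtain ⟨W, hW, hxW, c, rfl⟩ := exists_germ_eq F a hx
    obtain ⟨W', hW', hxW', s, rfl⟩ := exists_fgerm_eq r hxW
    rw [← germ_res F hW' hxW' c, ← germ_ofFun_smul]
    exact (key W' (hW'.trans hW) hxW' _).trans ((hsmul W' (hW'.trans hW) hxW' s _).trans
      (congrArg (fgerm hxW' s • ·) (key W' (hW'.trans hW) hxW' _).symm))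

/-! ### Free generators -/

/-- The section `ε` over `U` is a free generator of the left `D_M ⊗ R`-module `F` over `U`. -/
def IsGen (F : PresheafOfModules.{u} (DR d n M)) (U : Opens M) (ε : sec F U) : Prop :=
  ∀ (V : Opens M) (h : V ≤ U), Function.Bijective fun t : DOpR d n V => t • secRes F h ε

theorem IsGen.restrict {F : PresheafOfModules.{u} (DR d n M)} {U : Opens M} {ε : sec F U}
    (hε : IsGen F U ε) {V : Opens M} (h : V ≤ U) : IsGen F V (secRes F h ε) := fun W hW => by
  have := hε W (hW.trans h)
  rwa [← secRes_res F h hW] at this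

/-- The functional `t • ε ↦ t(f)` on the stalk of a module with free generator `ε`. -/
theorem IsGen.exists_eval {F : PresheafOfModules.{u} (DR d n M)} {U : Opens M} {ε : sec F U}
    (hε : IsGen F U ε) {x : M} (hx : x ∈ U) (f : FunR d n U) :
    ∃ L : Module.Dual (StalkOR d n M x) (Stalk F x), ∀ (V : Opens M) (h : V ≤ U) (hxV : x ∈ V)
      (t : DOpR d n V), L (germ F V x hxV (t • secRes F h ε)) = fgerm hxV (dact t (fres h f)) := by
  choose c hc using fun (V : Opens M) (h : V ≤ U) (a : sec F V) => (hε V h).2 a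
  have key : ∀ V h (a : sec F V) (t : DOpR d n V), t • secRes F h ε = a → c V h a = t :=
    fun V h a t e => (hε V h).1 ((hc V h a).trans e.symm)
  have hc' : ∀ V h (a : sec F V), c V h a • secRes F h ε = a := hc
  obtain ⟨L, hL⟩ := exists_stalk_lift (F := F) (A := StalkOR d n M x) hx
    (fun V h hxV a => fgerm hxV (dact (c V h a) (fres h f)))
    (fun V h hxV a b => by
      rw [key V h (a + b) (c V h a + c V h b) (by rw [add_smul, hc', hc']), dact_add, map_add])
    (fun V W hV h hxW a => by
      rw [key W (h.trans hV) (secRes F h a) (dres h (c V hV a))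
        (by rw [← secRes_res F hV h, ← secRes_dsmul, hc']), ← fgerm_fres h hxW, fres_dact, fres_fres])
    (fun V h hxV s a => by
      rw [key V h (ofFun s • a) (ofFun s * c V h a) (by rw [mul_smul, hc']), dact_mul, dact_ofFun,
        map_mul, smul_eq_mul])
  exact ⟨L, fun V h hxV t => by rw [hL V h hxV, key V h _ t rfl]⟩

/-- The functionals `t • ε ↦ t(g)` separate, by the Taylor expansion. -/
theorem IsGen.separates {F : PresheafOfModules.{u} (DR d n M)} {U : Opens M} {ε : sec F U}
    (hε : IsGen F U ε) (C : Coordinates (d := d) U) {x : M} (hx : x ∈ U)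
    (Λ : Set (Module.Dual (StalkOR d n M x) (Stalk F x)))
    (hΛ : ∀ g : Hol d U, ∃ L ∈ Λ, ∀ (V : Opens M) (h : V ≤ U) (hxV : x ∈ V) (t : DOpR d n V),
      L (germ F V x hxV (t • secRes F h ε)) = fgerm hxV (dact t (fres h (ofHol g)))) :
    Separates Λ := by
  choose L hL hLe using hΛ
  -- The approximate identity is the Taylor expansion truncated at order `N`.
  refine ⟨fun N => (boxIndex (Fin d) N).toList.map fun α =>
    (((C.taylorList α).map fun p => fgerm (n := n) hx (ofHol p.1) • L p.2).sum,
      germ F U x hx ((ofOp (C.e α) : DOpR d n U) • ε)), fun N p hp => ?_, fun a => ?_⟩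
  · obtain ⟨α, -, rfl⟩ := List.mem_map.1 hp
    refine list_sum_mem fun q hq => ?_
    obtain ⟨p, -, rfl⟩ := List.mem_map.1 hq
    exact Submodule.smul_mem _ _ (Submodule.subset_span (hL _))
  · obtain ⟨V', hV', hxV', b, rfl⟩ := exists_germ_eq F a hx
    obtain ⟨t', rfl⟩ := (hε V' hV').2 b
    obtain ⟨V, hV, hxV, N₀, hN₀⟩ := t'.exists_orderLT hxV'
    have hVU := hV.trans hV'
    refine ⟨N₀, fun N hN => ?_⟩
    have e1 : germ F V' x hxV' (t' • secRes F hV' ε) =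
        germ F V x hxV (dres hV t' • secRes F hVU ε) := by
      rw [← germ_res F hV hxV, secRes_dsmul, secRes_res]
    beta_reduce
    rw [e1]
    generalize dres hV t' = t at hN₀
    have h2 := C.eq_sum_taylorList_dOpR hVU (hN₀.mono hN)
    rw [List.map_map, Finset.sum_map_toList]
    refine (congrArg (fun t => germ F V x hxV (t • secRes F hVU ε)) h2).trans ?_
    beta_reduce
    rw [Finset.sum_smul, map_sum]
    refine Finset.sum_congr rfl fun α _ => ?_
    rw [mul_smul, germ_ofFun_smul, ← secRes_dsmul, germ_res]
    refine congrArg (fun r => r • germ F U x (hVU hxV) ((ofOp (C.e α) : DOpR d n U) • ε)) ?_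
    beta_reduce
    generalize C.taylorList α = l
    induction l with
    | nil => rw [List.map_nil, List.sum_nil, List.map_nil, List.sum_nil, map_zero,
        LinearMap.zero_apply]
    | cons p l ih =>
      rw [List.map_cons, List.sum_cons, List.map_cons, List.sum_cons, map_add, ih,
        LinearMap.add_apply, LinearMap.smul_apply, hLe p.2 V hVU hxV t, map_mul, smul_eq_mul,
        fgerm_fres hVU hxV]

end Stalks

/-! ### Quantizations in a trivialization -/

/-- The converse of `exists_killed_perturbed`: an operator of finite order with respect to the perturbed
multiplications `L f = f + ħ Q` is of finite order. -/
theorem exists_killed_of_perturbed (n N k m : ℕ) : ∃ c : ℕ, ∀ (A : Type u) [CommRing A]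
    [Algebra (Base n) A] (L : A → Module.End (Base n) A),
    (∀ f, ∃ Q : Module.End (Base n) A, Killed (mulPairs (Base n) A) N Q ∧
      L f = LinearMap.mulLeft (Base n) f + hbar n • Q) →
    ∀ B : Module.End (Base n) A,
      Killed (Set.range fun f => (L f, LinearMap.mulLeft (Base n) f)) m B →
        Killed (mulPairs (Base n) A) c (hbar n ^ k • B) := by
  -- `c₀` bounds the order of the perturbation `Q` with respect to the perturbed multiplications.
  obtain ⟨c₀, hc₀⟩ := exists_killed_perturbed.{u} n N 0 N
  obtain ⟨j, hj⟩ : ∃ j, n + 1 ≤ k + j := ⟨n + 1, by omega⟩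
  induction j generalizing k m with
  | zero =>
    refine ⟨0, fun A _ _ L _ B _ => ?_⟩
    rw [hbar_pow_eq_zero n k (by omega), zero_smul]
    exact Killed.zero _ 0
  | succ j ihj =>
    induction m with
    | zero =>
      refine ⟨0, fun A _ _ L _ B hB => ?_⟩
      have hB0 : B = 0 := hB
      rw [hB0, smul_zero]
      exact Killed.zero _ 0
    | succ m ihm =>
      obtain ⟨c₁, hc₁⟩ := ihm
      obtain ⟨c₂, hc₂⟩ := ihj (k + 1) (c₀ + (m + 1)) (by omega)
      refine ⟨max c₁ c₂ + 1, fun A _ _ L hL B hB => ?_⟩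
      rintro _ ⟨f, rfl⟩
      obtain ⟨Q, hQ, hLf⟩ := hL f
      -- `[f, ħ^k B]` is `ħ^k (f B - B L f)`, of lower order, plus the multiple `ħ^(k+1) B Q`.
      have key : LinearMap.mulLeft (Base n) f ∘ₗ (hbar n ^ k • B) -
          (hbar n ^ k • B) ∘ₗ LinearMap.mulLeft (Base n) f =
          hbar n ^ k • (LinearMap.mulLeft (Base n) f ∘ₗ B - B ∘ₗ L f) +
          hbar n ^ (k + 1) • (B ∘ₗ Q) := by
        rw [hLf]
        simp only [LinearMap.comp_add, LinearMap.smul_comp, LinearMap.comp_smul,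
          smul_sub, smul_smul, smul_add, pow_succ]
        abel
      rw [key]
      refine Killed.add ((hc₁ A L hL _ (hB _ ⟨f, rfl⟩)).mono (le_max_left _ _))
        ((hc₂ A L hL _ ?_).mono (le_max_right _ _))
      have h1 := hc₀ A (Set.range fun g => (L g, L g)) (by
        rintro _ ⟨g, rfl⟩
        obtain ⟨Q', hQ', e⟩ := hL g
        exact ⟨g, Q', Q', hQ', hQ', by rw [← e]⟩) Q hQ
      rw [pow_zero, one_smul] at h1
      refine Killed.comp ?_ h1 hB
      rintro _ ⟨g, rfl⟩
      exact ⟨L g, ⟨g, rfl⟩, ⟨g, rfl⟩⟩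

section Quantization

variable {d n : ℕ} {M : Type u} [TopologicalSpace M] [ChartedSpace (EuclideanSpace ℂ (Fin d)) M]

theorem fred_smul {U : Opens M} (r : Base n) (f : FunR d n U) : fred (r • f) = aug n r • fred f :=
  red_smul r f

theorem ofHol_smul {U : Opens M} (c : ℂ) (f : Hol d U) :
    (ofHol (c • f) : FunR d n U) = algebraMap ℂ (Base n) c • ofHol f := by
  change (1 : Base n) ⊗ₜ[ℂ] (c • f) = algebraMap ℂ (Base n) c • ((1 : Base n) ⊗ₜ[ℂ] f)
  rw [TensorProduct.smul_tmul', smul_eq_mul, mul_one, TensorProduct.tmul_smul,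
    TensorProduct.smul_tmul', Algebra.algebraMap_eq_smul_one]

theorem fred_linear {U V : Opens M} (Q : FunR d n U →ₗ[Base n] FunR d n V) {f g : FunR d n U}
    (h : fred f = fred g) : fred (Q f) = fred (Q g) := by
  obtain ⟨q, rfl⟩ := eq_hbar_smul_of_fred_eq h
  rw [map_add, map_smul, map_add, fred_hbar_smul, add_zero]

namespace Trivialization

variable {𝒜 : AlgSheaf n M} {U : Opens M} (T : Trivialization d 𝒜 U)

/-- The trivialization on sections. -/
def tr {V : Opens M} (h : V ≤ U) : FunR d n V ≃ₗ[Base n] asec 𝒜 V := T.equiv V h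

theorem ares_tr {V W : Opens M} (hV : V ≤ U) (h : W ≤ V) (f : FunR d n V) :
    ares 𝒜 h (T.tr hV f) = T.tr (h.trans hV) (fres h f) := T.res_equiv V W hV h f

theorem tr_symm_ares {V W : Opens M} (hV : V ≤ U) (h : W ≤ V) (s : asec 𝒜 V) :
    (T.tr (h.trans hV)).symm (ares 𝒜 h s) = fres h ((T.tr hV).symm s) := by
  rw [LinearEquiv.symm_apply_eq, ← ares_tr T hV h, LinearEquiv.apply_symm_apply]

/-- Restriction of a trivialization. -/
def restrict {V : Opens M} (h : V ≤ U) : Trivialization d 𝒜 V where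
  star :=
    { coeff := fun i => (T.star.coeff i).restrict h
      coeff_zero := fun W hW => T.star.coeff_zero W (hW.trans h)
      mul := fun W hW => T.star.mul W (hW.trans h)
      mul_tmul := fun W hW => T.star.mul_tmul W (hW.trans h)
      assoc := fun W hW => T.star.assoc W (hW.trans h) }
  equiv W hW := T.equiv W (hW.trans h)
  res_equiv W W' hW := T.res_equiv W W' (hW.trans h)
  equiv_mul W hW := T.equiv_mul W (hW.trans h)

/-- Left multiplication in the star product. -/
def starLeft {V : Opens M} (h : V ≤ U) (f : FunR d n V) : Module.End (Base n) (FunR d n V) :=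
  T.star.mul V h f

theorem tr_starLeft {V : Opens M} (h : V ≤ U) (f g : FunR d n V) :
    T.tr h (T.starLeft h f g) = T.tr h f * T.tr h g := T.equiv_mul V h f g

/-- Locally the star product differs from the product of functions by `ħ` times an operator of bounded
order. -/
theorem exists_starLeft_eq {x : M} (hx : x ∈ U) : ∃ W ≤ U, x ∈ W ∧ ∃ N : ℕ,
    ∀ (V : Opens M) (hV : V ≤ U), V ≤ W → ∀ f : FunR d n V, ∃ Q : Module.End (Base n) (FunR d n V),
      Killed (mulPairs (Base n) (FunR d n V)) N Q ∧
        T.starLeft hV f = LinearMap.mulLeft (Base n) f + hbar n • Q := by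
  choose W hW hxW N hN using fun i => (T.star.coeff i).order x hx
  have hmem : x ∈ Finset.univ.inf W := by
    refine Finset.inf_induction (p := fun W : Opens M => x ∈ W) trivial (fun _ h _ h' => ⟨h, h'⟩)
      fun i _ => hxW i
  refine ⟨Finset.univ.inf W, (Finset.inf_le (Finset.mem_univ 0)).trans (hW 0), hmem,
    Finset.univ.sup N, fun V hV hVW f => ?_⟩
  induction f using TensorProduct.induction_on with
  | zero =>
    refine ⟨0, Killed.zero _ _, ?_⟩
    rw [smul_zero, add_zero]
    exact (map_zero (T.star.mul V hV)).trans (LinearMap.mulLeft_zero_eq_zero _ _).symm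
  | add f f' h h' =>
    obtain ⟨Q, hQ, e⟩ := h
    obtain ⟨Q', hQ', e'⟩ := h'
    refine ⟨Q + Q', hQ.add hQ', (map_add (T.star.mul V hV) f f').trans ?_⟩
    refine (congrArg₂ (· + ·) e e').trans ?_
    have key : ∀ f f' : FunR d n V, LinearMap.mulLeft (Base n) f + hbar n • Q +
        (LinearMap.mulLeft (Base n) f' + hbar n • Q') =
        LinearMap.mulLeft (Base n) (f + f') + hbar n • (Q + Q') := fun f f' => by
      refine LinearMap.ext fun g => ?_
      simp only [LinearMap.add_apply, LinearMap.mulLeft_apply, LinearMap.smul_apply, smul_add, add_mul]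
      abel
    exact key f f'
  | tmul r f =>
    -- `ħ Q` is the part of the star product given by the coefficients of `ħ, …, ħⁿ`.
    let Q : Module.End (Base n) (HolR d n V) := ∑ i : Fin n, hbar n ^ (i : ℕ) •
      ((T.star.coeff i.succ).app V hV f).baseChange (Base n)
    refine ⟨r • Q, Killed.smul _ (Killed.sum _ fun i _ => ?_), ?_⟩
    · refine Killed.smul _ (Killed.baseChange ?_)
      exact ((hN i.succ V hV (hVW.trans (Finset.inf_le (Finset.mem_univ _))) f).1).mono
        (Finset.le_sup (Finset.mem_univ _))
    · have key : T.star.mul V hV (1 ⊗ₜ f) =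
          LinearMap.mulLeft (Base n) ((1 : Base n) ⊗ₜ[ℂ] f : HolR d n V) + hbar n • Q := by
        refine tmul_linear_ext fun g => ?_
        rw [T.star.mul_tmul, Fin.sum_univ_succ, T.star.coeff_zero, LinearMap.add_apply,
          LinearMap.mulLeft_apply, Algebra.TensorProduct.tmul_mul_tmul, one_mul, Fin.val_zero,
          pow_zero, LinearMap.smul_apply, LinearMap.sum_apply, Finset.smul_sum]
        refine congrArg _ (Finset.sum_congr rfl fun i _ => ?_)
        rw [LinearMap.smul_apply, LinearMap.baseChange_tmul, TensorProduct.smul_tmul',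
          TensorProduct.smul_tmul', smul_eq_mul, smul_eq_mul, mul_one, Fin.val_succ, pow_succ']
      have e1 : (r ⊗ₜ[ℂ] f : HolR d n V) = r • ((1 : Base n) ⊗ₜ[ℂ] f) := by
        rw [TensorProduct.smul_tmul', smul_eq_mul, mul_one]
      have e2 : T.star.mul V hV (r ⊗ₜ[ℂ] f) = r • T.star.mul V hV (1 ⊗ₜ[ℂ] f) := by
        rw [e1, map_smul]
      refine e2.trans ?_
      rw [key]
      refine LinearMap.ext fun g => ?_
      change r • (((1 : Base n) ⊗ₜ[ℂ] f : HolR d n V) * g + hbar n • Q g) =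
        (r ⊗ₜ[ℂ] f : HolR d n V) * g + hbar n • (r • Q g)
      rw [e1, smul_add, smul_mul_assoc, smul_comm]

theorem fred_starLeft {V : Opens M} (h : V ≤ U) (f g : FunR d n V) :
    fred (T.starLeft h f g) = fred f * fred g := by
  refine sheafLike_hol.sep _ _ _ fun x hx => ?_
  obtain ⟨W, hW, hxW, N, hN⟩ := T.exists_starLeft_eq (h hx)
  refine ⟨V ⊓ W, inf_le_left, ⟨hx, hxW⟩, ?_⟩
  obtain ⟨Q, -, e⟩ := hN (V ⊓ W) (inf_le_left.trans h) inf_le_right (fres inf_le_left f)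
  have e1 : fres (inf_le_left : V ⊓ W ≤ V) (T.starLeft h f g) =
      T.starLeft (inf_le_left.trans h) (fres inf_le_left f) (fres inf_le_left g) := by
    apply (T.tr (inf_le_left.trans h)).injective
    rw [← ares_tr T h inf_le_left, tr_starLeft, tr_starLeft, ← ares_tr T h inf_le_left,
      ← ares_tr T h inf_le_left, map_mul]
  change holRes d _ _ = holRes d _ _
  rw [← fred_fres, e1, e, LinearMap.add_apply, LinearMap.mulLeft_apply, LinearMap.smul_apply,
    map_add, fred_hbar_smul, add_zero, ← map_mul, fred_fres, map_mul]

theorem fred_tr_symm_mul {V : Opens M} (h : V ≤ U) (s s' : asec 𝒜 V) :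
    fred ((T.tr h).symm (s * s')) = fred ((T.tr h).symm s) * fred ((T.tr h).symm s') := by
  rw [← fred_starLeft T h]
  congr 1
  rw [LinearEquiv.symm_apply_eq, tr_starLeft, LinearEquiv.apply_symm_apply,
    LinearEquiv.apply_symm_apply]

theorem fred_tr_symm_one {V : Opens M} (h : V ≤ U) : fred ((T.tr h).symm 1) = 1 := by
  have := T.fred_tr_symm_mul h 1 (T.tr h (ofHol 1))
  rw [one_mul, LinearEquiv.symm_apply_apply, fred_ofHol, mul_one] at this
  exact this.symm

/-- The comparison of two trivializations modulo `ħ` is an automorphism of the sheaf of algebras `O_M`,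
hence trivial: a function vanishes at a point if and only if it is not invertible near it. -/
theorem fred_tr_symm_tr (T' : Trivialization d 𝒜 U) {V : Opens M} (h : V ≤ U) (f : FunR d n V) :
    fred ((T.tr h).symm (T'.tr h f)) = fred f := by
  -- `comp`, `mul` and `one`: modulo `ħ` the comparison is an algebra map with an inverse.
  have comp : ∀ (T T' : Trivialization d 𝒜 U) (V : Opens M) (h : V ≤ U) (a : Hol d V),
      fred ((T'.tr h).symm (T.tr h (ofHol (fred ((T.tr h).symm (T'.tr h (ofHol a))))))) = a := by
    intro T T' V h a
    have h1 : fred (ofHol (fred ((T.tr h).symm (T'.tr h (ofHol a)))) : FunR d n V) =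
        fred ((T.tr h).symm (T'.tr h (ofHol a))) := fred_ofHol _
    refine (fred_linear ((T'.tr h).symm.toLinearMap ∘ₗ (T.tr h).toLinearMap) h1).trans ?_
    change fred ((T'.tr h).symm (T.tr h _)) = a
    rw [LinearEquiv.apply_symm_apply, LinearEquiv.symm_apply_apply, fred_ofHol]
  have mul : ∀ (V : Opens M) (h : V ≤ U) (a b : Hol d V),
      fred ((T'.tr h).symm (T.tr h (ofHol (a * b)))) =
        fred ((T'.tr h).symm (T.tr h (ofHol a))) * fred ((T'.tr h).symm (T.tr h (ofHol b))) := by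
    intro V h a b
    rw [← fred_tr_symm_mul, ← tr_starLeft]
    refine fred_linear ((T'.tr h).symm.toLinearMap ∘ₗ (T.tr h).toLinearMap) ?_
    rw [fred_starLeft, fred_ofHol, fred_ofHol, fred_ofHol]
  have one : ∀ (T T' : Trivialization d 𝒜 U) (V : Opens M) (h : V ≤ U),
      fred ((T'.tr h).symm (T.tr h (ofHol 1))) = 1 := by
    intro T T' V h
    refine Eq.trans ?_ (T'.fred_tr_symm_one h)
    have h1 : fred (ofHol 1 : FunR d n V) = fred ((T.tr h).symm 1) := by
      rw [fred_ofHol, T.fred_tr_symm_one h]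
    refine (fred_linear ((T'.tr h).symm.toLinearMap ∘ₗ (T.tr h).toLinearMap) h1).trans ?_
    change fred ((T'.tr h).symm (T.tr h ((T.tr h).symm 1))) = _
    rw [LinearEquiv.apply_symm_apply]
  refine (fred_linear ((T.tr h).symm.toLinearMap ∘ₗ (T'.tr h).toLinearMap)
    (fred_ofHol (n := n) (fred f)).symm).trans ?_
  change fred ((T.tr h).symm (T'.tr h (ofHol (fred f)))) = fred f
  generalize fred f = a
  refine hol_ext fun y => ?_
  set c : ℂ := a y
  -- `b` is the image of `a - c`, which vanishes at `y`
  set b := fred ((T.tr h).symm (T'.tr h (ofHol a))) - c • 1 with hb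
  -- If `b y ≠ 0`, then `b` is invertible near `y`, hence so is its preimage `a - c`; but
  -- `(a - c)(y) = 0`.
  by_contra hne
  have hby : b y ≠ 0 := by
    intro h0
    refine hne ?_
    have h1 : fred ((T.tr h).symm (T'.tr h (ofHol a))) y - c • (1 : ℂ) = 0 := h0
    rw [smul_eq_mul, mul_one, sub_eq_zero] at h1
    exact h1
  obtain ⟨W, hW, hyW, g, hg⟩ := exists_hol_inverse b y.2 hby
  have e1 : fred ((T'.tr h).symm (T.tr h (ofHol b))) = a - c • 1 := by
    rw [hb, map_sub, ofHol_smul, map_sub, map_sub, map_sub, comp, map_smul, map_smul, fred_smul, one,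
      AlgHom.commutes]
    rfl
  have e3 := mul W (hW.trans h) (holRes d hW b) g
  rw [hg, one] at e3
  have e4 : fred ((T'.tr (hW.trans h)).symm (T.tr (hW.trans h) (ofHol (holRes d hW b)))) =
      holRes d hW (a - c • 1) := by
    rw [← fres_ofHol, ← ares_tr T h hW, tr_symm_ares T' h hW, fred_fres, e1]
  rw [e4] at e3
  have e5 := congrArg (fun q : Hol d W => q ⟨y.1, hyW⟩) e3
  have e6 : (1 : ℂ) = (a y - c • (1 : ℂ)) * _ := e5
  rw [smul_eq_mul, mul_one, sub_self, zero_mul] at e6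
  exact one_ne_zero e6

/-- The reduction modulo `ħ` may be computed in any trivialization. -/
theorem eqModHbar_iff {V : Opens M} (h : V ≤ U) (s : asec 𝒜 V) (f : FunR d n V) :
    EqModHbar 𝒜 V s (show HolR d n V from f) ↔ fred ((T.tr h).symm s) = fred f := by
  constructor
  · intro H
    refine sheafLike_hol.sep _ _ _ fun x hx => ?_
    obtain ⟨W, hW, hxW, T', e⟩ := H x hx
    refine ⟨W, hW, hxW, ?_⟩
    have e1 : fred ((T'.tr le_rfl).symm (ares 𝒜 hW s)) = fred (fres hW f) := e
    change holRes d hW _ = holRes d hW _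
    rw [← fred_fres, ← fred_fres, ← e1, ← tr_symm_ares]
    have := (T.restrict (hW.trans h)).fred_tr_symm_tr T' le_rfl ((T'.tr le_rfl).symm (ares 𝒜 hW s))
    rw [LinearEquiv.apply_symm_apply] at this
    exact this
  · intro H x hx
    refine ⟨V, le_rfl, hx, T.restrict h, ?_⟩
    change fred (((T.restrict h).tr le_rfl).symm (ares 𝒜 le_rfl s)) = fred (fres le_rfl f)
    rw [fres_self, (sheafLike_asec 𝒜).res_self]
    exact H

end Trivialization

end Quantization

/-! ### Differential operators on a quantization -/

section DiffModule

variable {d n : ℕ} {M : Type u} [TopologicalSpace M] [ChartedSpace (EuclideanSpace ℂ (Fin d)) M]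
  {𝒜 : AlgSheaf n M}

/-- The value over `V` of a section of `Diff_M(𝒜; O_M ⊗ R)`. -/
def dval {U : Opens M} (A : sec (diffModule d 𝒜) U) {V : Opens M} (h : V ≤ U) :
    asec 𝒜 V →ₗ[Base n] FunR d n V :=
  (show DiffSec d 𝒜 U from A).1 ⟨V, h⟩

theorem dval_ext {U : Opens M} {A B : sec (diffModule d 𝒜) U}
    (H : ∀ V (h : V ≤ U) s, dval A h s = dval B h s) : A = B :=
  diffSec_ext fun V s => H V.1 V.2 s

theorem fres_dval {U V W : Opens M} (A : sec (diffModule d 𝒜) U) (h : V ≤ U) (h' : W ≤ V)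
    (s : asec 𝒜 V) : fres h' (dval A h s) = dval A (h'.trans h) (ares 𝒜 h' s) :=
  (show DiffSec d 𝒜 U from A).2.1 ⟨V, h⟩ ⟨W, h'.trans h⟩ h' s

theorem dval_secRes {U V W : Opens M} (A : sec (diffModule d 𝒜) U) (h : V ≤ U) (h' : W ≤ V) :
    dval (secRes _ h A) h' = dval A (h'.trans h) := rfl

theorem dval_add {U V : Opens M} (A B : sec (diffModule d 𝒜) U) (h : V ≤ U) (s : asec 𝒜 V) :
    dval (A + B) h s = dval A h s + dval B h s := rfl

theorem dval_smul {U V : Opens M} (t : DOpR d n U) (A : sec (diffModule d 𝒜) U) (h : V ≤ U)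
    (s : asec 𝒜 V) : dval (t • A) h s = dact (dres h t) (dval A h s) :=
  (dact_dres h t _).symm

/-- Families of maps that are locally of finite order are sections of `Diff_M(𝒜; O_M ⊗ R)`. -/
def diffMk {U : Opens M} (A : ∀ V : {V : Opens M // V ≤ U}, asec 𝒜 V.1 →ₗ[Base n] FunR d n V.1)
    (hres : ∀ (V W : {V : Opens M // V ≤ U}) (h : W.1 ≤ V.1) (s : asec 𝒜 V.1),
      fres h (A V s) = A W (ares 𝒜 h s))
    (hord : ∀ x ∈ U, ∃ W ≤ U, x ∈ W ∧ ∃ N : ℕ, ∀ V : {V : Opens M // V ≤ U}, V.1 ≤ W →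
      Killed (quantPairs d 𝒜 V.1) N (show asec 𝒜 V.1 →ₗ[Base n] HolR d n V.1 from A V)) :
    sec (diffModule d 𝒜) U :=
  (show DiffSec d 𝒜 U from ⟨A, hres, hord⟩)

theorem dval_order {U : Opens M} (A : sec (diffModule d 𝒜) U) {x : M} (hx : x ∈ U) :
    ∃ W ≤ U, x ∈ W ∧ ∃ N : ℕ, ∀ (V : Opens M) (h : V ≤ U), V ≤ W →
      Killed (quantPairs d 𝒜 V) N (show asec 𝒜 V →ₗ[Base n] HolR d n V from dval A h) := by
  obtain ⟨W, hW, hxW, N, hN⟩ := (show DiffSec d 𝒜 U from A).2.2 x hx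
  exact ⟨W, hW, hxW, N, fun V h => hN ⟨V, h⟩⟩

theorem sheafLike_diffModule (𝒜 : AlgSheaf n M) :
    SheafLike (fun U => sec (diffModule d 𝒜) U) (fun h A => secRes (diffModule d 𝒜) h A) where
  res_self _ _ := rfl
  res_res _ _ _ := rfl
  sep U A B H := dval_ext fun V h s => sheafLike_funR.sep _ _ _ fun x hx => by
    obtain ⟨W, hW, hxW, e⟩ := H x (h hx)
    refine ⟨V ⊓ W, inf_le_left, ⟨hx, hxW⟩, ?_⟩
    rw [fres_dval, fres_dval]
    exact DFunLike.congr_fun (congrArg (fun A => dval A (inf_le_right : V ⊓ W ≤ W)) e) _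
  glue U V hV hx A hA := by
    obtain ⟨B, hB, hBA⟩ := sheafLike_funR.glue_linear (k := Base n)
      (fun {U V : Opens M} (h : V ≤ U) => (ares 𝒜 h).toLinearMap)
      (fun {U V : Opens M} (h : V ≤ U) => (fres h : FunR d n U →ₐ[Base n] _).toLinearMap)
      (fun h h' a => ares_ares 𝒜 h h' a) U V hV hx
      (fun x W => dval (A x) W.2) (fun x W W' h a => fres_dval (A x) W.2 h a) (fun x y W h h' =>
        congrArg (fun A => dval A (le_refl W)) (hA x y W h h'))
    refine ⟨diffMk B hB fun x hxU => ?_, fun x h => dval_ext fun W h' s =>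
      DFunLike.congr_fun (hBA x W h') s⟩
    obtain ⟨W, hW, hxW, N, hN⟩ := dval_order (A ⟨x, hxU⟩) (hx ⟨x, hxU⟩)
    refine ⟨W, hW.trans (hV _), hxW, N, fun V' hV' => ?_⟩
    exact (congrArg (Killed (P := asec 𝒜 V'.1) (Q := HolR d n V'.1) (quantPairs d 𝒜 V'.1) N)
      (hBA ⟨x, hxU⟩ V'.1 (hV'.trans hW))).mpr (hN V'.1 (hV'.trans hW) hV')

theorem isSheaf_diffModule (𝒜 : AlgSheaf n M) :
    TopCat.Presheaf.IsSheaf (X := TopCat.of M) (diffModule d 𝒜).presheaf :=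
  isSheaf_of_sheafLike _ (sheafLike_diffModule 𝒜)

/-- The functional `A ↦ A(s)` on the stalk. -/
theorem exists_ev {V : Opens M} {x : M} (hx : x ∈ V) (s : asec 𝒜 V) :
    ∃ L : Module.Dual (StalkOR d n M x) (Stalk (diffModule d 𝒜) x), ∀ W (h : W ≤ V) (hxW : x ∈ W) A,
      L (germ _ W x hxW A) = fgerm hxW (dval A le_rfl (ares 𝒜 h s)) := by
  refine exists_stalk_lift hx (fun W h hxW A => fgerm hxW (dval A le_rfl (ares 𝒜 h s)))
    (fun W h hxW A B => ?_) (fun V W hV h hxW A => ?_) (fun W h hxW r A => ?_)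
  · rw [dval_add, map_add]
  · rw [dval_secRes, ← ares_ares 𝒜 hV h, ← fres_dval, fgerm_fres]
  · rw [dval_smul, dres_self, dact_ofFun, map_mul, smul_eq_mul]

/-- Evaluation of germs of differential operators at a section of the quantization. -/
def ev {V : Opens M} {x : M} (hx : x ∈ V) (s : asec 𝒜 V) :
    Module.Dual (StalkOR d n M x) (Stalk (diffModule d 𝒜) x) := (exists_ev hx s).choose

theorem ev_germ {V W : Opens M} {x : M} (hx : x ∈ V) (s : asec 𝒜 V) (h : W ≤ V) (hxW : x ∈ W)
    (A : sec (diffModule d 𝒜) W) :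
    ev hx s (germ _ W x hxW A) = fgerm hxW (dval A le_rfl (ares 𝒜 h s)) :=
  (exists_ev hx s).choose_spec W h hxW A

theorem ev_ares {V W : Opens M} {x : M} (hx : x ∈ W) (h : W ≤ V) (s : asec 𝒜 V) :
    ev (d := d) hx (ares 𝒜 h s) = ev (h hx) s := by
  refine LinearMap.ext fun a => ?_
  obtain ⟨W', hW', hxW', A, rfl⟩ := exists_germ_eq _ a hx
  rw [ev_germ hx _ hW', ev_germ (h hx) _ (hW'.trans h), ares_ares]

theorem ev_germ' {V W : Opens M} {x : M} (hx : x ∈ V) (s : asec 𝒜 V) (h : V ≤ W)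
    (A : sec (diffModule d 𝒜) W) : ev hx s (germ _ W x (h hx) A) = fgerm hx (dval A h s) := by
  rw [← germ_res _ h hx, ev_germ hx s le_rfl, (sheafLike_asec 𝒜).res_self, dval_secRes]

namespace Trivialization

variable {U : Opens M} (T : Trivialization d 𝒜 U)

/-- Conjugation with the trivialization turns operators of finite order with respect to the quantization
into differential operators, and vice versa. -/
theorem exists_killed_iff {x : M} (hx : x ∈ U) : ∃ W ≤ U, x ∈ W ∧ ∀ N, ∃ N', ∀ (V : Opens M)
    (hV : V ≤ U), V ≤ W → ∀ A : asec 𝒜 V →ₗ[Base n] FunR d n V,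
      (Killed (quantPairs d 𝒜 V) N (show asec 𝒜 V →ₗ[Base n] HolR d n V from A) →
        Killed (mulPairs (Base n) (FunR d n V)) N' (A ∘ₗ (T.tr hV).toLinearMap)) ∧
      (Killed (mulPairs (Base n) (FunR d n V)) N (A ∘ₗ (T.tr hV).toLinearMap) →
        Killed (quantPairs d 𝒜 V) N' (show asec 𝒜 V →ₗ[Base n] HolR d n V from A)) := by
  obtain ⟨W, hW, hxW, N₀, hN₀⟩ := T.exists_starLeft_eq hx
  refine ⟨W, hW, hxW, fun N => ?_⟩
  obtain ⟨c₁, hc₁⟩ := exists_killed_of_perturbed.{u} n N₀ 0 N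
  obtain ⟨c₂, hc₂⟩ := exists_killed_perturbed.{u} n (max N₀ 1) 0 N
  refine ⟨max c₁ c₂, fun V hV hVW A => ⟨fun hA => ?_, fun hA => ?_⟩⟩
  -- Among the pairs of the quantization are the multiplications by `T f` and `f`.
  · have h1 := hc₁ (FunR d n V) (T.starLeft hV) (hN₀ V hV hVW) (A ∘ₗ (T.tr hV).toLinearMap)
    rw [pow_zero, one_smul] at h1
    refine (h1 ?_).mono (le_max_left _ _)
    refine Killed.comp_right (T.tr hV).toLinearMap ?_ hA
    rintro _ ⟨f, rfl⟩
    refine ⟨LinearMap.mulLeft (Base n) (T.tr hV f), LinearMap.ext fun g => T.tr_starLeft hV f g,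
      T.tr hV f, f, ?_, rfl⟩
    exact (T.eqModHbar_iff hV _ f).2 (by rw [LinearEquiv.symm_apply_apply])
  -- Any pair of the quantization is, in the trivialization, a multiplication up to `ħ` times an
    -- operator of bounded order.
  · have h1 := hc₂ (FunR d n V) {p | ∃ (s : asec 𝒜 V) (f : FunR d n V),
      fred ((T.tr hV).symm s) = fred f ∧
        p = (T.starLeft hV ((T.tr hV).symm s), LinearMap.mulLeft (Base n) f)} (by
      rintro _ ⟨s, f, hsf, rfl⟩
      obtain ⟨Q, hQ, e⟩ := hN₀ V hV hVW ((T.tr hV).symm s)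
      obtain ⟨q, hq⟩ := eq_hbar_smul_of_fred_eq hsf
      refine ⟨f, Q + LinearMap.mulLeft (Base n) q, 0, (hQ.mono (le_max_left _ _)).add
        ((killed_mulLeft q).mono (le_max_right _ _)), Killed.zero _ _, ?_⟩
      rw [e, smul_zero, add_zero]
      refine congrArg (·, _) (LinearMap.ext fun g => ?_)
      simp only [LinearMap.add_apply, LinearMap.mulLeft_apply, LinearMap.smul_apply, smul_add]
      rw [hq, add_mul, smul_mul_assoc]
      abel) _ hA
    rw [pow_zero, one_smul] at h1
    have h2 := Killed.comp_right (E' := quantPairs d 𝒜 V) (T.tr hV).symm.toLinearMap ?_ h1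
    · have e : (A ∘ₗ (T.tr hV).toLinearMap) ∘ₗ (T.tr hV).symm.toLinearMap = A :=
        LinearMap.ext fun s => congrArg A ((T.tr hV).apply_symm_apply s)
      exact ((congrArg (Killed (P := asec 𝒜 V) (Q := HolR d n V) (quantPairs d 𝒜 V) c₂) e).mp
        h2).mono (le_max_right _ _)
    · rintro _ ⟨s, f, hsf, rfl⟩
      refine ⟨T.starLeft hV ((T.tr hV).symm s), LinearMap.ext fun s' => ?_, s, f,
        (T.eqModHbar_iff hV s f).1 hsf, rfl⟩
      change (T.tr hV).symm (s * s') = T.starLeft hV ((T.tr hV).symm s) ((T.tr hV).symm s')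
      rw [LinearEquiv.symm_apply_eq, tr_starLeft, LinearEquiv.apply_symm_apply,
        LinearEquiv.apply_symm_apply]

/-- The inverse of a trivialization is a differential operator. -/
def gen : sec (diffModule d 𝒜) U :=
  diffMk (fun V => (T.tr V.2).symm.toLinearMap) (fun V W h s => (T.tr_symm_ares V.2 h s).symm)
    fun x hx => by
      obtain ⟨W, hW, hxW, h⟩ := T.exists_killed_iff hx
      obtain ⟨N', hN'⟩ := h 1
      refine ⟨W, hW, hxW, N', fun V hV => (hN' V.1 V.2 hV _).2 ?_⟩
      have e : (T.tr V.2).symm.toLinearMap ∘ₗ (T.tr V.2).toLinearMap =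
          LinearMap.mulLeft (Base n) 1 := LinearMap.ext fun f =>
        ((T.tr V.2).symm_apply_apply f).trans (one_mul f).symm
      rw [e]
      exact killed_mulLeft 1

theorem dval_gen {V : Opens M} (h : V ≤ U) (s : asec 𝒜 V) : dval T.gen h s = (T.tr h).symm s := rfl

/-- The section `t • T.gen` is the operator `t` in the trivialization. -/
theorem dval_smul_gen {V W : Opens M} (h : V ≤ U) (h' : W ≤ V) (t : DOpR d n V) (s : asec 𝒜 W) :
    dval (t • secRes (diffModule d 𝒜) h T.gen) h' s =
      dact (dres h' t) ((T.tr (h'.trans h)).symm s) := by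
  rw [dval_smul, dval_secRes, dval_gen]

/-- The inverse of a trivialization is a free generator of the `D_M ⊗ R`-module of differential
operators on the quantization. -/
theorem isGen_gen : IsGen (diffModule d 𝒜) U T.gen := by
  refine fun V h => ⟨fun t t' e => dact_injective fun W h' f => ?_, fun A => ?_⟩
  · have e' := congrArg (fun A => dval A h' (T.tr (h'.trans h) (ofHol f))) e
    beta_reduce at e'
    rw [dval_smul_gen, dval_smul_gen, LinearEquiv.symm_apply_apply] at e'
    exact e'
  · obtain ⟨t, ht⟩ := exists_dact_eq (U := V)
      (fun W => dval A W.2 ∘ₗ (T.tr (W.2.trans h)).toLinearMap)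
      (fun W W' h' f => by
        refine (fres_dval A W.2 h' _).trans ?_
        exact congrArg (dval A W'.2) (T.ares_tr (W.2.trans h) h' f))
      fun x hx => by
        obtain ⟨W, hW, hxW, N, hN⟩ := dval_order A hx
        obtain ⟨W', hW', hxW', h'⟩ := T.exists_killed_iff (h hx)
        obtain ⟨N', hN'⟩ := h' N
        exact ⟨W ⊓ W', inf_le_left.trans hW, ⟨hxW, hxW'⟩, N', fun V' hV' =>
          (hN' V'.1 (V'.2.trans h) (hV'.trans inf_le_right) _).1
            (hN V'.1 V'.2 (hV'.trans inf_le_left))⟩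
    refine ⟨t, dval_ext fun W h' s => ?_⟩
    beta_reduce
    rw [dval_smul_gen, ht ⟨W, h'⟩]
    exact congrArg (dval A h') ((T.tr _).apply_symm_apply s)

/-- The evaluations at sections of the quantization separate germs of differential operators. -/
theorem separates (T : Trivialization d 𝒜 U) (C : Coordinates (d := d) U) {x : M} (hx : x ∈ U) :
    Separates (Set.range fun s : asec 𝒜 U => ev (d := d) hx s) := by
  refine T.isGen_gen.separates C hx _ fun g => ⟨_, ⟨T.tr le_rfl (ofHol g), rfl⟩, fun V h hxV t => ?_⟩
  rw [ev_germ hx _ h, dval_smul_gen, dres_self, ares_tr T le_rfl h, LinearEquiv.symm_apply_apply]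

end Trivialization

theorem IsStarQuantization.exists_trivialization [IsManifold 𝓘(ℂ, EuclideanSpace ℂ (Fin d)) ω M]
    (h𝒜 : IsStarQuantization d 𝒜) {x : M} {U : Opens M} (hx : x ∈ U) :
    ∃ V ≤ U, x ∈ V ∧ Nonempty (Trivialization d 𝒜 V) ∧ Nonempty (Coordinates (d := d) V) := by
  obtain ⟨V, hxV, ⟨T⟩⟩ := h𝒜 x
  obtain ⟨W, hxW, ⟨C⟩⟩ := exists_coordinates (d := d) x
  exact ⟨V ⊓ W ⊓ U, inf_le_right, ⟨⟨hxV, hxW⟩, hx⟩, ⟨T.restrict (inf_le_left.trans inf_le_left)⟩,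
    ⟨C.restrict (inf_le_left.trans inf_le_right)⟩⟩

end DiffModule

/-! ### The coproduct of differential operators -/

section Coproduct

variable {d n : ℕ} {M : Type u} [TopologicalSpace M] [ChartedSpace (EuclideanSpace ℂ (Fin d)) M]

/-- The bidifferential operator `(f, g) ↦ P(f g)`. -/
def mulBidiff {U : Opens M} (P : DiffOp d U) : BidiffOp d U where
  app V hV := (LinearMap.mul ℂ (Hol d V)).compr₂ (P.1 ⟨V, hV⟩)
  res_app V W hV h f g := (P.2.1 ⟨V, hV⟩ ⟨W, h.trans hV⟩ h (f * g)).trans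
    (congrArg _ (map_mul (holRes d h) f g))
  order x hx := by
    obtain ⟨W, hW, hxW, N, hN⟩ := P.2.2 x hx
    refine ⟨W, hW, hxW, 1 + N, fun V hV hVW f => ?_⟩
    have h1 := (killed_mulLeft (k := ℂ) f).mulPairs_comp (hN ⟨V, hV⟩ hVW)
    refine ⟨h1, ?_⟩
    have e : ((LinearMap.mul ℂ (Hol d V)).compr₂ (P.1 ⟨V, hV⟩)).flip f =
        P.1 ⟨V, hV⟩ ∘ₗ LinearMap.mulLeft ℂ f :=
      LinearMap.ext fun g => congrArg (P.1 ⟨V, hV⟩) (mul_comm g f)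
    rw [e]
    exact h1

theorem funR_bilinear_ext {U : Opens M} {B B' : FunR d n U →ₗ[Base n] FunR d n U →ₗ[Base n] FunR d n U}
    (h : ∀ f g : Hol d U, B (ofHol f) (ofHol g) = B' (ofHol f) (ofHol g)) : B = B' :=
  funR_linear_ext fun f => funR_linear_ext fun g => h f g

theorem ofHol_add {U : Opens M} (f g : Hol d U) : (ofHol (f + g) : FunR d n U) = ofHol f + ofHol g :=
  map_add ofHol f g

theorem ofHol_mul {U : Opens M} (f g : Hol d U) : (ofHol (f * g) : FunR d n U) = ofHol f * ofHol g :=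
  map_mul ofHol f g

theorem smul_ofHol_list_sum {ι : Type*} {U : Opens M} (r : Base n) (l : List ι) (f : ι → Hol d U) :
    r • (ofHol (l.map f).sum : FunR d n U) = (l.map fun i => r • ofHol (f i)).sum := by
  rw [map_list_sum, List.smul_sum, List.map_map, List.map_map]
  rfl

theorem dact_smul {U : Opens M} (r : Base n) (t : DOpR d n U) (f : FunR d n U) :
    dact (r • t) f = r • dact t f :=
  DFunLike.congr_fun (map_smul (dact : DOpR d n U →ₐ[Base n] _) r t) f

theorem dres_smul {U V : Opens M} (h : V ≤ U) (r : Base n) (t : DOpR d n U) :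
    dres h (r • t) = r • dres h t := map_smul (dres h : DOpR d n U →ₐ[Base n] _) r t

/-- The bilinear operator `(f, g) ↦ ∑ t(f) t'(g)`, for a list of pairs `(t, t')`. -/
def listAct {U : Opens M} (l : List (DOpR d n U × DOpR d n U)) :
    FunR d n U →ₗ[Base n] FunR d n U →ₗ[Base n] FunR d n U :=
  (l.map fun p => (LinearMap.mul (Base n) (FunR d n U)).compl₁₂ (dact p.1) (dact p.2)).sum

theorem listAct_apply {U : Opens M} (l : List (DOpR d n U × DOpR d n U)) (f g : FunR d n U) :
    listAct l f g = (l.map fun p => dact p.1 f * dact p.2 g).sum := by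
  unfold listAct
  induction l with
  | nil => rfl
  | cons p l ih =>
    rw [List.map_cons, List.sum_cons, LinearMap.add_apply, LinearMap.add_apply, ih, List.map_cons,
      List.sum_cons]
    rfl

theorem hbar_smul_ofHol {U : Opens M} (r : Base n) (f : Hol d U) :
    r • (ofHol f : FunR d n U) = (r ⊗ₜ[ℂ] f : HolR d n U) :=
  (TensorProduct.smul_tmul' r (1 : Base n) f).trans (congrArg (· ⊗ₜ[ℂ] f) (mul_one r))

theorem coef_sum_smul_ofHol {U : Opens M} (a : Fin (n + 1) → Hol d U) (i : Fin (n + 1)) :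
    coef i (show HolR d n U from
      ∑ j : Fin (n + 1), hbar n ^ (j : ℕ) • (ofHol (a j) : FunR d n U)) = a i :=
  (congrArg (coef i) (Finset.sum_congr rfl fun j _ => hbar_smul_ofHol _ (a j))).trans (coef_sum a i)

/-- An `R`-bilinear operator whose coefficients are bidifferential operators is, locally, a sum of
products of sections of `D_M ⊗ R`. -/
theorem exists_listAct_eq [IsManifold 𝓘(ℂ, EuclideanSpace ℂ (Fin d)) ω M] {U : Opens M}
    (B : ∀ V : Opens M, V ≤ U → (FunR d n V →ₗ[Base n] FunR d n V →ₗ[Base n] FunR d n V))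
    (b : Fin (n + 1) → BidiffOp d U) (hB : ∀ V hV (f g : Hol d V),
      B V hV (ofHol f) (ofHol g) = ∑ i : Fin (n + 1), hbar n ^ (i : ℕ) • ofHol ((b i).app V hV f g))
    {x : M} (hx : x ∈ U) : ∃ (W : Opens M) (hW : W ≤ U), x ∈ W ∧
      ∃ l : List (DOpR d n W × DOpR d n W), ∀ (V : Opens M) (hV : V ≤ W),
        B V (hV.trans hW) = listAct (l.map fun p => (dres hV p.1, dres hV p.2)) := by
  choose W hW hxW l hl using fun i => (b i).exists_factor hx
  have hmem : x ∈ Finset.univ.inf W :=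
    Finset.inf_induction (p := fun W : Opens M => x ∈ W) trivial (fun _ h _ h' => ⟨h, h'⟩)
      fun i _ => hxW i
  have hle : ∀ i, Finset.univ.inf W ≤ W i := fun i => Finset.inf_le (Finset.mem_univ i)
  refine ⟨Finset.univ.inf W, (hle 0).trans (hW 0), hmem,
    (Finset.univ : Finset (Fin (n + 1))).toList.flatMap fun i => (l i).map fun p =>
      (hbar n ^ (i : ℕ) • ofOp (diffOpRes d (hle i) p.1), ofOp (diffOpRes d (hle i) p.2)),
    fun V hV => funR_bilinear_ext fun f g => ?_⟩
  rw [hB, listAct_apply, List.map_map, List.map_flatMap, List.flatMap_def, List.sum_flatten,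
    List.map_map, Finset.sum_map_toList]
  refine Finset.sum_congr rfl fun i _ => ?_
  rw [hl i V (hV.trans (hle i)) f g, Function.comp_apply, List.map_map]
  rw [smul_ofHol_list_sum]
  refine congrArg List.sum (List.map_congr_left fun p _ => ?_)
  change _ = dact (dres hV (hbar n ^ (i : ℕ) • ofOp (diffOpRes d (hle i) p.1))) (ofHol f) *
    dact (dres hV (ofOp (diffOpRes d (hle i) p.2))) (ofHol g)
  rw [dres_smul, dact_smul, dres_ofOp, dres_ofOp, dact_ofOp, dact_ofOp, smul_mul_assoc, ofHol_mul]
  rfl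

/-- The coproduct of `D_M ⊗ R`: locally `t(f g) = ∑ t'(f) t''(g)`. -/
theorem DOpR.exists_coproduct [IsManifold 𝓘(ℂ, EuclideanSpace ℂ (Fin d)) ω M] {U : Opens M}
    (t : DOpR d n U) {x : M} (hx : x ∈ U) : ∃ (W : Opens M) (hW : W ≤ U), x ∈ W ∧
      ∃ l : List (DOpR d n W × DOpR d n W), ∀ (V : Opens M) (hV : V ≤ W) (f g : FunR d n V),
        dact (dres (hV.trans hW) t) (f * g) =
          (l.map fun p => dact (dres hV p.1) f * dact (dres hV p.2) g).sum := by
  have key : ∀ V (hV : V ≤ U) (f g : Hol d V), dact (dres hV t) (ofHol f * ofHol g) =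
      ∑ i : Fin (n + 1), hbar n ^ (i : ℕ) •
        (ofHol ((mulBidiff (coef i (show DiffOpR d n U from t))).app V hV f g) : FunR d n V) := by
    intro V hV f g
    rw [← ofHol_mul, dact_dres]
    refine coef_ext fun i => (coef_act t ⟨V, hV⟩ (f * g) i).trans ?_
    exact (coef_sum_smul_ofHol (fun j => (coef j (show DiffOpR d n U from t)).1 ⟨V, hV⟩ (f * g))
      i).symm
  obtain ⟨W, hW, hxW, l, hl⟩ := exists_listAct_eq
    (fun V hV => (LinearMap.mul (Base n) (FunR d n V)).compr₂ (dact (dres hV t)))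
    (fun i => mulBidiff (coef i (show DiffOpR d n U from t))) key hx
  refine ⟨W, hW, hxW, l, fun V hV f g => ?_⟩
  have := DFunLike.congr_fun (DFunLike.congr_fun (hl V hV) f) g
  rw [listAct_apply, List.map_map] at this
  exact this

/-- Vector fields act on `O_M ⊗ R` by derivations. -/
theorem IsVectorField.dact_mul {U : Opens M} {τ : DiffOp d U} (hτ : IsVectorField τ)
    (f g : FunR d n U) : dact (ofOp τ) (f * g) = dact (ofOp τ) f * g + f * dact (ofOp τ) g := by
  have key : (LinearMap.mul (Base n) (FunR d n U)).compr₂ (dact (ofOp τ)) =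
      (LinearMap.mul (Base n) (FunR d n U)).compl₁₂ (dact (ofOp τ)) LinearMap.id +
      (LinearMap.mul (Base n) (FunR d n U)).compl₁₂ LinearMap.id (dact (ofOp τ)) := by
    refine funR_bilinear_ext fun f g => ?_
    change dact (ofOp τ) (ofHol f * ofHol g) =
      dact (ofOp τ) (ofHol f) * ofHol g + ofHol f * dact (ofOp τ) (ofHol g)
    rw [← ofHol_mul, dact_ofOp, dact_ofOp, dact_ofOp, hτ, ofHol_add, ofHol_mul, ofHol_mul]
  exact DFunLike.congr_fun (DFunLike.congr_fun key f) g

end Coproduct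

section Canonical

variable {d n : ℕ} {M : Type u} [TopologicalSpace M] [ChartedSpace (EuclideanSpace ℂ (Fin d)) M]
  {𝒜 : AlgSheaf n M}

/-- The section `∑ p ⊗ q`, `(p, q) ∈ l`, is the coproduct of the operator `A` on the quantization. -/
def CanRep {U : Opens M} (A : sec (diffModule d 𝒜) U)
    (l : List (sec (diffModule d 𝒜) U × sec (diffModule d 𝒜) U)) : Prop :=
  ∀ (V : Opens M) (h : V ≤ U) (s t : asec 𝒜 V),
    dval A h (s * t) = (l.map fun p => dval p.1 h s * dval p.2 h t).sum

theorem CanRep.res {U V : Opens M} {A : sec (diffModule d 𝒜) U} {l} (H : CanRep A l) (h : V ≤ U) :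
    CanRep (secRes _ h A) (l.map fun p => (secRes _ h p.1, secRes _ h p.2)) := fun W h' s t => by
  rw [List.map_map]
  exact H W (h'.trans h) s t

/-- The germ at a point of the section `∑ p ⊗ q`, `(p, q) ∈ l`, of a tensor square. -/
def germList (F : PresheafOfModules.{u} (DR d n M)) {U : Opens M} (l : List (sec F U × sec F U)) {x : M}
    (hx : x ∈ U) : TensorProduct (StalkOR d n M x) (Stalk F x) (Stalk F x) :=
  (l.map fun p => germ F U x hx p.1 ⊗ₜ[StalkOR d n M x] germ F U x hx p.2).sum

theorem germList_res (F : PresheafOfModules.{u} (DR d n M)) {U V : Opens M}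
    (l : List (sec F U × sec F U)) {x : M} (h : V ≤ U) (hx : x ∈ V) :
    germList F (l.map fun p => (secRes F h p.1, secRes F h p.2)) hx = germList F l (h hx) := by
  rw [germList, List.map_map]
  refine congrArg List.sum (List.map_congr_left fun p _ => ?_)
  rw [Function.comp_apply, germ_res, germ_res]

theorem pair_germList {U V : Opens M} {x : M} (l : List (sec (diffModule d 𝒜) U × sec (diffModule d 𝒜) U))
    (h : V ≤ U) (hx : x ∈ V) (s t : asec 𝒜 V) :
    pair (ev hx s) (ev hx t) (germList (diffModule d 𝒜) l (h hx)) =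
      fgerm hx ((l.map fun p => dval p.1 h s * dval p.2 h t).sum) := by
  rw [germList]
  induction l with
  | nil => simp only [List.map_nil, List.sum_nil, map_zero]
  | cons p l ih =>
    rw [List.map_cons, List.sum_cons, map_add, ih, pair_tmul, List.map_cons, List.sum_cons, map_add,
      map_mul, ev_germ' hx s h, ev_germ' hx t h]

theorem CanRep.pair_eq {U V : Opens M} {A : sec (diffModule d 𝒜) U} {l} (H : CanRep A l) (h : V ≤ U)
    {x : M} (hx : x ∈ V) (s t : asec 𝒜 V) :
    pair (ev hx s) (ev hx t) (germList _ l (h hx)) = fgerm hx (dval A h (s * t)) := by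
  rw [pair_germList, H]

section

variable [IsManifold 𝓘(ℂ, EuclideanSpace ℂ (Fin d)) ω M] (h𝒜 : IsStarQuantization d 𝒜)
include h𝒜

/-- The coproduct of an operator is unique, since the evaluations separate. -/
theorem CanRep.germList_eq {U : Opens M} {A : sec (diffModule d 𝒜) U} {l l'} (H : CanRep A l)
    (H' : CanRep A l') {x : M} (hx : x ∈ U) :
    germList (diffModule d 𝒜) l hx = germList (diffModule d 𝒜) l' hx := by
  obtain ⟨V, hV, hxV, ⟨T⟩, ⟨C⟩⟩ := h𝒜.exists_trivialization hx
  refine (T.separates C hxV).eq_of_pair ?_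
  rintro _ ⟨s, rfl⟩ _ ⟨t, rfl⟩
  rw [H.pair_eq hV hxV, H'.pair_eq hV hxV]

/-- Locally the coproduct of an operator `A` exists: in a trivialization, `A` is an operator `t` on
functions, and `(f, g) ↦ t(f ⋆ g)` is a bidifferential operator. -/
theorem exists_canRep {U : Opens M} (A : sec (diffModule d 𝒜) U) {x : M} (hx : x ∈ U) :
    ∃ (V : Opens M) (h : V ≤ U), x ∈ V ∧ ∃ l, CanRep (secRes _ h A) l := by
  obtain ⟨V, hV, hxV, ⟨T⟩, -⟩ := h𝒜.exists_trivialization hx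
  obtain ⟨t, ht⟩ := (T.isGen_gen V le_rfl).2 (secRes _ hV A)
  obtain ⟨W₁, hW₁, hxW₁, l₁, h₁⟩ := exists_listAct_eq (n := n) (U := V)
    (fun W hW => T.star.mul W hW) T.star.coeff (fun W hW f g =>
      (T.star.mul_tmul W hW f g).trans (Finset.sum_congr rfl fun i _ =>
        (hbar_smul_ofHol _ _).symm)) hxV
  obtain ⟨W₂, hW₂, hxW₂, l₂, h₂⟩ := t.exists_coproduct hxV
  let W := W₁ ⊓ W₂
  have hW : W ≤ V := inf_le_left.trans hW₁
  refine ⟨W, hW.trans hV, ⟨hxW₁, hxW₂⟩, l₁.flatMap fun p => l₂.map fun q =>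
    ((dres inf_le_right q.1 * dres inf_le_left p.1) • secRes _ hW T.gen,
      (dres inf_le_right q.2 * dres inf_le_left p.2) • secRes _ hW T.gen), fun W' h s s' => ?_⟩
  have hA : secRes _ (hW.trans hV) A = dres hW t • secRes _ hW T.gen := by
    rw [← secRes_res _ hV hW, ← ht, secRes_dsmul, secRes_res]
  -- `l₁` represents the star product and `l₂` the coproduct of `t`; composing them
  -- represents `t(f ⋆ g)`.
  have h3 : (T.tr (h.trans hW)).symm (s * s') = T.starLeft (h.trans hW)
      ((T.tr (h.trans hW)).symm s) ((T.tr (h.trans hW)).symm s') := by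
    rw [LinearEquiv.symm_apply_eq, T.tr_starLeft, LinearEquiv.apply_symm_apply,
      LinearEquiv.apply_symm_apply]
  have h4 : ∀ f g, T.starLeft (h.trans hW) f g =
      (l₁.map fun p => dact (dres (h.trans inf_le_left) p.1) f *
        dact (dres (h.trans inf_le_left) p.2) g).sum := fun f g => by
    have := DFunLike.congr_fun (DFunLike.congr_fun (h₁ W' (h.trans inf_le_left)) f) g
    rw [listAct_apply, List.map_map] at this
    exact this
  rw [hA, T.dval_smul_gen, h3, h4, List.map_flatMap, List.flatMap_def, List.sum_flatten, List.map_map,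
    dres_dres]
  simp only [List.map_map, Function.comp_def, T.dval_smul_gen, map_mul, dres_dres]
  generalize (T.tr (h.trans hW)).symm s = f
  generalize (T.tr (h.trans hW)).symm s' = g
  clear h₁ h4
  induction l₁ with
  | nil => simp only [List.map_nil, List.sum_nil, map_zero]
  | cons p l₁ ih =>
    rw [List.map_cons, List.sum_cons, map_add, ih, List.map_cons, List.sum_cons,
      h₂ W' (h.trans inf_le_right)]
    rfl

/-- The coalgebra structure on the stalk dual to the multiplication of the quantization. -/
theorem exists_stalk_coalgebra (x : M) :
    ∃ C : Coalgebra (StalkOR d n M x) (Stalk (diffModule d 𝒜) x),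
      (∀ (U : Opens M) (hx : x ∈ U) (A : sec (diffModule d 𝒜) U) l, CanRep A l →
        C.comul (germ _ U x hx A) = germList _ l hx) ∧
      ∀ (U : Opens M) (hx : x ∈ U) (A : sec (diffModule d 𝒜) U),
        C.counit (germ _ U x hx A) = fgerm hx (dval A le_rfl 1) := by
  obtain ⟨U, -, hx, ⟨T⟩, ⟨C⟩⟩ := h𝒜.exists_trivialization (U := ⊤) (x := x) trivial
  have hsep := T.separates C hx
  obtain ⟨Co, h1, h2⟩ := exists_coalgebra_of_separates (fun s : asec 𝒜 U => ev (d := d) hx s) hsep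
    (· * ·) 1 (fun s t r => by rw [mul_assoc]) (fun s => by rw [one_mul]) (fun s => by rw [mul_one])
    (fun a => by
      obtain ⟨V, hV, hxV, A, rfl⟩ := exists_germ_eq _ a hx
      obtain ⟨W, hW, hxW, l, hl⟩ := exists_canRep h𝒜 A hxV
      refine ⟨germList _ l hxW, fun s t => ?_⟩
      have e := hl.pair_eq le_rfl hxW (ares 𝒜 (hW.trans hV) s) (ares 𝒜 (hW.trans hV) t)
      rw [ev_ares hxW, ev_ares hxW] at e
      rw [e, ← map_mul, ← germ_res _ hW hxW, ev_germ hx _ (hW.trans hV)])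
  refine ⟨Co, fun V hxV A l hl => ?_, fun V hxV A => ?_⟩
  · refine hsep.eq_of_pair ?_
    rintro _ ⟨s, rfl⟩ _ ⟨t, rfl⟩
    have hxW : x ∈ U ⊓ V := ⟨hx, hxV⟩
    have e := hl.pair_eq (inf_le_right : U ⊓ V ≤ V) hxW (ares 𝒜 inf_le_left s) (ares 𝒜 inf_le_left t)
    rw [ev_ares hxW, ev_ares hxW] at e
    rw [h1, e, ← map_mul, ← germ_res _ inf_le_right hxW, ev_germ hx _ inf_le_left, dval_secRes]
  · have hxW : x ∈ U ⊓ V := ⟨hx, hxV⟩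
    rw [h2, ← germ_res _ inf_le_right hxW, ev_germ hx _ inf_le_left, dval_secRes,
      map_one (ares 𝒜 _), ← fgerm_fres (inf_le_right : U ⊓ V ≤ V) hxW, fres_dval, map_one (ares 𝒜 _)]

end

end Canonical

/-! ### The canonical structure -/

section Flat

variable {d n : ℕ} {M : Type u} [TopologicalSpace M] [ChartedSpace (EuclideanSpace ℂ (Fin d)) M]

theorem flat_base_tensorProduct (n : ℕ) (A : Type*) [AddCommGroup A] [Module ℂ A] :
    Module.Flat (Base n) (Base n ⊗[ℂ] A) := inferInstance

instance (U : Opens M) : Module.Flat (Base n) (DOpR d n U) :=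
  flat_base_tensorProduct n (DiffOp d U)

theorem exists_germ_eq_fintype {F : PresheafOfModules.{u} (DR d n M)} {ι : Type*} [Finite ι] {x : M}
    {U : Opens M} (hx : x ∈ U) (a : ι → Stalk F x) :
    ∃ (V : Opens M) (_ : V ≤ U) (hxV : x ∈ V) (b : ι → sec F V), ∀ i, germ F V x hxV (b i) = a i := by
  cases nonempty_fintype ι
  choose V hV hxV b hb using fun i => exists_germ_eq F (a i) hx
  have hmem : x ∈ Finset.univ.inf V ⊓ U := ⟨Finset.inf_induction (p := fun W : Opens M => x ∈ W)
    trivial (fun _ h _ h' => ⟨h, h'⟩) fun i _ => hxV i, hx⟩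
  have hle : ∀ i, Finset.univ.inf V ⊓ U ≤ V i := fun i =>
    inf_le_left.trans (Finset.inf_le (Finset.mem_univ i))
  exact ⟨_, inf_le_right, hmem, fun i => secRes F (hle i) (b i), fun i => by rw [germ_res, hb]⟩

/-- A filtered union of images of flat modules, with relations detected at finite stages, is flat. -/
theorem flat_of_stages {R N J : Type*} [CommRing R] [AddCommGroup N] [Module R N] (T : J → Type*)
    [∀ j, AddCommGroup (T j)] [∀ j, Module R (T j)] [∀ j, Module.Flat R (T j)]
    (g : ∀ j, T j →ₗ[R] N) (cover : ∀ (m : ℕ) (a : Fin m → N), ∃ (j : J) (t : Fin m → T j),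
      ∀ i, g j (t i) = a i)
    (zero : ∀ j s, g j s = 0 → ∃ k, ∃ φ : T j →ₗ[R] T k, φ s = 0 ∧ ∀ s', g k (φ s') = g j s') :
    Module.Flat R N := by
  refine Module.Flat.iff_forall_isTrivialRelation.2 fun {m f a} hfa => ?_
  obtain ⟨j, t, ht⟩ := cover m a
  have h0 : g j (∑ i, f i • t i) = 0 := by
    rw [map_sum, ← hfa]
    exact Finset.sum_congr rfl fun i _ => by rw [map_smul, ht]
  obtain ⟨k, φ, e, hφ⟩ := zero j _ h0
  have h1 : ∑ i, f i • φ (t i) = 0 := by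
    rw [← e, map_sum]
    exact Finset.sum_congr rfl fun i _ => (map_smul φ (f i) (t i)).symm
  obtain ⟨κ, c, y, h2, h3⟩ := Module.Flat.isTrivialRelation_of_sum_smul_eq_zero h1
  refine ⟨κ, c, fun k' => g k (y k'), fun i => ?_, h3⟩
  rw [← ht, ← hφ, show φ (t i) = _ from h2 i, map_sum]
  exact Finset.sum_congr rfl fun k' _ => map_smul (g k) _ _

theorem germ_smul_dsmul {F : PresheafOfModules.{u} (DR d n M)} {W : Opens M} {x : M} (hx : x ∈ W)
    (r : Base n) (s : DOpR d n W) (a : sec F W) :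
    germ F W x hx ((r • s) • a) = r • germ F W x hx (s • a) := by
  rw [← germ_algebraMap_smul, ← mul_smul, Algebra.smul_def]

/-- A module with free local generators is flat over `R`. -/
theorem IsGen.flat {F : PresheafOfModules.{u} (DR d n M)} {U : Opens M} {ε : sec F U}
    (hε : IsGen F U ε) {x : M} (hx : x ∈ U) : Module.Flat (Base n) (Stalk F x) := by
  refine flat_of_stages (J := {W : Opens M // W ≤ U ∧ x ∈ W}) (fun W => DOpR d n W.1)
    (fun W => { toFun := fun s => germ F W.1 x W.2.2 (s • secRes F W.2.1 ε)
                map_add' := fun s s' => by rw [add_smul, map_add]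
                map_smul' := fun r s => germ_smul_dsmul W.2.2 r s _ }) (fun m a => ?_)
    (fun W s hs => ?_)
  · obtain ⟨V, hV, hxV, b, hb⟩ := exists_germ_eq_fintype hx a
    choose t ht using fun i => (hε V hV).2 (b i)
    exact ⟨⟨V, hV, hxV⟩, t, fun i => (congrArg (germ F V x hxV) (ht i)).trans (hb i)⟩
  · obtain ⟨W, hW, hxW⟩ := W
    obtain ⟨W', hW', _, hxW', e⟩ := exists_secRes_eq F hxW hxW (s • secRes F hW ε) 0
      (Eq.trans hs (map_zero _).symm)
    refine ⟨⟨W', hW'.trans hW, hxW'⟩, (dres hW').toLinearMap, (hε W' (hW'.trans hW)).1 ?_,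
      fun s' => ?_⟩
    · rw [secRes_dsmul, map_zero, secRes_res] at e
      exact e.trans (zero_smul _ _).symm
    · change germ F W' x hxW' (dres hW' s' • secRes F (hW'.trans hW) ε) =
        germ F W x hxW (s' • secRes F hW ε)
      rw [← germ_res F hW' hxW', secRes_dsmul, secRes_res]

end Flat

theorem coalgebra_ext {R A : Type*} [CommSemiring R] [AddCommMonoid A] [Module R A]
    (C C' : Coalgebra R A) (h : C.comul = C'.comul) (h' : C.counit = C'.counit) : C = C' := by
  obtain @⟨⟨_, _⟩, _, _, _⟩ := C
  obtain @⟨⟨_, _⟩, _, _, _⟩ := C'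
  congr

/-- The Leibniz rule for sums of products of values of linear maps. -/
theorem IsVectorField.dact_list_sum {d n : ℕ} {M : Type u} [TopologicalSpace M]
    [ChartedSpace (EuclideanSpace ℂ (Fin d)) M] {V : Opens M} {τ : DiffOp d V} (hτ : IsVectorField τ)
    {P T : Type*} [SMul T P] {t : T} (l : List (P × P)) (f g : P → FunR d n V)
    (hf : ∀ a, f (t • a) = dact (ofOp τ) (f a)) (hg : ∀ a, g (t • a) = dact (ofOp τ) (g a)) :
    dact (ofOp τ) (l.map fun p => f p.1 * g p.2).sum =
      ((l.flatMap fun p => [(t • p.1, p.2), (p.1, t • p.2)]).map fun p => f p.1 * g p.2).sum := by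
  induction l with
  | nil => exact map_zero _
  | cons p l ih =>
    rw [List.map_cons, List.sum_cons, map_add, ih, hτ.dact_mul, List.flatMap_cons,
      List.map_append, List.sum_append]
    refine congrArg (· + _) ?_
    simp only [List.map_cons, List.map_nil, List.sum_cons, List.sum_nil, add_zero, hf, hg]

section Canonical

variable {d n : ℕ} {M : Type u} [TopologicalSpace M] [ChartedSpace (EuclideanSpace ℂ (Fin d)) M]
  {𝒜 : AlgSheaf n M}

theorem EqModHbar.res {V W : Opens M} {s : asec 𝒜 V} {f : FunR d n V}
    (H : EqModHbar 𝒜 V s (show HolR d n V from f)) (h : W ≤ V) :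
    EqModHbar 𝒜 W (ares 𝒜 h s) (show HolR d n W from fres h f) := by
  intro x hx
  obtain ⟨W', hW', hxW', T, e⟩ := H x (h hx)
  refine ⟨W ⊓ W', inf_le_left, ⟨hx, hxW'⟩, T.restrict inf_le_right, ?_⟩
  change fred ((T.tr inf_le_right).symm (ares 𝒜 inf_le_left (ares 𝒜 h s))) =
    fred (fres inf_le_left (fres h f))
  have e' : fred ((T.tr le_rfl).symm (ares 𝒜 hW' s)) = fred (fres hW' f) := e
  have e2 := congrArg (holRes d (inf_le_right : W ⊓ W' ≤ W')) e'
  rw [← fred_fres, ← fred_fres, ← T.tr_symm_ares le_rfl inf_le_right, ares_ares, fres_fres] at e2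
  rw [ares_ares, fres_fres]
  exact e2

/-- The operator `P` is the reduction modulo `ħ` of the operator `A` on the quantization. -/
def IsRed {U : Opens M} (A : sec (diffModule d 𝒜) U) (P : DiffOp d U) : Prop :=
  ∀ (V : Opens M) (h : V ≤ U) (s : asec 𝒜 V) (f : FunR d n V),
    EqModHbar 𝒜 V s (show HolR d n V from f) → P.1 ⟨V, h⟩ (fred f) = fred (dval A h s)

theorem IsRed.res {U V : Opens M} {A : sec (diffModule d 𝒜) U} {P : DiffOp d U} (H : IsRed A P)
    (h : V ≤ U) : IsRed (secRes _ h A) (diffOpRes d h P) := fun W h' => H W (h'.trans h)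

theorem IsRed.add {U : Opens M} {A B : sec (diffModule d 𝒜) U} {P Q : DiffOp d U} (H : IsRed A P)
    (H' : IsRed B Q) : IsRed (A + B) (P + Q) := fun V h s f e => by
  rw [dval_add, map_add, ← H V h s f e, ← H' V h s f e]
  rfl

theorem IsRed.smul {U : Opens M} {A : sec (diffModule d 𝒜) U} {P : DiffOp d U} (H : IsRed A P)
    (t : DOpR d n U) : IsRed (t • A) (dred t * P) := fun V h s f e => by
  rw [dval_smul, fred_dact, ← H V h s f e, dred_dres]
  rfl

theorem Trivialization.isRed_gen {U : Opens M} (T : Trivialization d 𝒜 U) : IsRed T.gen 1 :=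
  fun _ h s f e => ((T.eqModHbar_iff h s f).1 e).symm

theorem Trivialization.eqModHbar_tr {U V : Opens M} (T : Trivialization d 𝒜 U) (h : V ≤ U)
    (f : FunR d n V) : EqModHbar 𝒜 V (T.tr h f) (show HolR d n V from f) :=
  (T.eqModHbar_iff h _ f).2 (by rw [LinearEquiv.symm_apply_apply])

section

variable [IsManifold 𝓘(ℂ, EuclideanSpace ℂ (Fin d)) ω M] (h𝒜 : IsStarQuantization d 𝒜)
include h𝒜

/-- Identities between functions may be checked where the functions lift to the quantization. -/
theorem hol_ext_of_lift {U : Opens M} {f g : Hol d U}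
    (H : ∀ (V : Opens M) (h : V ≤ U), Nonempty (Trivialization d 𝒜 V) → holRes d h f = holRes d h g) :
    f = g :=
  sheafLike_hol.sep U f g fun x hx => by
    obtain ⟨V, hV, hxV, hT, -⟩ := h𝒜.exists_trivialization hx
    exact ⟨V, hV, hxV, H V hV hT⟩

theorem IsRed.eq {U : Opens M} {A : sec (diffModule d 𝒜) U} {P Q : DiffOp d U} (H : IsRed A P)
    (H' : IsRed A Q) : P = Q := by
  refine diffOp_ext fun V f => hol_ext_of_lift h𝒜 fun W h ⟨T⟩ => ?_
  have e := T.eqModHbar_tr le_rfl (ofHol (holRes d h f))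
  have e1 := (H W (h.trans V.2) _ _ e).trans (H' W (h.trans V.2) _ _ e).symm
  rw [fred_ofHol] at e1
  exact (P.2.1 V ⟨W, h.trans V.2⟩ h f).trans (e1.trans (Q.2.1 V ⟨W, h.trans V.2⟩ h f).symm)

/-- An operator on the quantization is `R`-linear, so it induces an operator on functions modulo `ħ`. -/
theorem exists_isRed {U : Opens M} (A : sec (diffModule d 𝒜) U) : ∃ P : DiffOp d U, IsRed A P := by
  obtain ⟨P, hP⟩ := sheafLike_diffOp.exists_of_locally (U := U)
    (fun V h P => IsRed (secRes _ h A) P) (fun _ _ _ h _ H => H.res h) (fun _ _ _ _ => IsRed.eq h𝒜)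
    (fun x hx => by
      obtain ⟨V, hV, hxV, ⟨T⟩, -⟩ := h𝒜.exists_trivialization hx
      obtain ⟨t, ht⟩ := (T.isGen_gen V le_rfl).2 (secRes _ hV A)
      refine ⟨V, hV, hxV, dred t * diffOpRes d le_rfl 1, ?_⟩
      rw [← ht]
      exact (T.isRed_gen.res le_rfl).smul t)
  refine ⟨P, fun V h s f e => sheafLike_hol.sep _ _ _ fun x hx => ?_⟩
  obtain ⟨W, hW, hxW, H⟩ := hP x (h hx)
  refine ⟨V ⊓ W, inf_le_left, ⟨hx, hxW⟩, ?_⟩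
  change holRes d _ _ = holRes d _ _
  have e1 := H (V ⊓ W) inf_le_right _ _ (e.res inf_le_left)
  rw [← fred_fres, fres_dval]
  refine Eq.trans ?_ e1
  rw [fred_fres]
  exact P.2.1 ⟨V, h⟩ ⟨V ⊓ W, inf_le_left.trans h⟩ inf_le_left (fred f)

theorem eqModHbar_one (V : Opens M) : EqModHbar 𝒜 V 1 (show HolR d n V from (1 : FunR d n V)) := by
  intro x hx
  obtain ⟨W, hW, hxW, ⟨T⟩, -⟩ := h𝒜.exists_trivialization hx
  refine ⟨W, hW, hxW, T, ?_⟩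
  have h1 : fred ((T.tr le_rfl).symm 1) = fred (1 : FunR d n W) := by
    rw [T.fred_tr_symm_one, map_one]
  change fred ((T.tr le_rfl).symm (ares 𝒜 hW 1)) = fred (fres hW 1)
  rw [map_one (ares 𝒜 hW), map_one (fres hW)]
  exact h1

/-- Representing the coproduct on stalks is the same as computing the values on products. -/
theorem comulRep_iff_canRep {C : ∀ x : M, Coalgebra (StalkOR d n M x) (Stalk (diffModule d 𝒜) x)}
    (hC : ∀ x (U : Opens M) (hx : x ∈ U) (A : sec (diffModule d 𝒜) U) l, CanRep A l →
        (C x).comul (germ _ U x hx A) = germList _ l hx) {U : Opens M}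
    (A : sec (diffModule d 𝒜) U) (l) : ComulRep (diffModule d 𝒜) C A l ↔ CanRep A l := by
  refine ⟨fun H V h s t => funR_ext fun x hx => ?_, fun H x hx => hC x U hx A l H⟩
  obtain ⟨W, hW, hxW, l', hl'⟩ := exists_canRep h𝒜 A (h hx)
  have hxVW : x ∈ V ⊓ W := ⟨hx, hxW⟩
  have e1 : germList (diffModule d 𝒜) l (h hx) = germList (diffModule d 𝒜) l' hxW := by
    rw [← hC x W hxW _ _ hl', germ_res]
    exact (H x (h hx)).symm
  have e2 := congrArg (pair (ev (d := d) hxVW (ares 𝒜 inf_le_left s))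
    (ev hxVW (ares 𝒜 inf_le_left t))) e1
  rw [hl'.pair_eq inf_le_right hxVW, ev_ares hxVW, ev_ares hxVW, pair_germList l h hx] at e2
  rw [e2, ← map_mul, dval_secRes, ← fres_dval A h, fgerm_fres]

/-- The reduction modulo `ħ` of the coproduct is the coproduct of the reduction. -/
theorem CanRep.reduce_mul {U : Opens M} {R : ∀ U : Opens M, sec (diffModule d 𝒜) U → DiffOp d U}
    (hR : ∀ (U : Opens M) (A : sec (diffModule d 𝒜) U), IsRed A (R U A))
    {A : sec (diffModule d 𝒜) U} {l} (H : CanRep A l) (V : {V : Opens M // V ≤ U})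
    (f g : Hol d V.1) :
    (R U A).1 V (f * g) = (l.map fun p => (R U p.1).1 V f * (R U p.2).1 V g).sum := by
  -- Locally `f` and `g` lift to the quantization, where the coproduct identity holds.
  refine hol_ext_of_lift h𝒜 fun W h ⟨T⟩ => ?_
  have hW : W ≤ U := h.trans V.2
  have ef := T.eqModHbar_tr le_rfl (ofHol (holRes d h f))
  have eg := T.eqModHbar_tr le_rfl (ofHol (holRes d h g))
  have efg : EqModHbar 𝒜 W (T.tr le_rfl (ofHol (holRes d h f)) * T.tr le_rfl (ofHol (holRes d h g)))
      (show HolR d n W from ofHol (holRes d h f * holRes d h g)) := by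
    refine (T.eqModHbar_iff le_rfl _ _).2 ?_
    rw [T.fred_tr_symm_mul, LinearEquiv.symm_apply_apply, LinearEquiv.symm_apply_apply, fred_ofHol,
      fred_ofHol, fred_ofHol]
  have e1 : (R U A).1 ⟨W, hW⟩ (holRes d h f * holRes d h g) = fred (dval A hW
      (T.tr le_rfl (ofHol (holRes d h f)) * T.tr le_rfl (ofHol (holRes d h g)))) := by
    have := hR U A W hW _ _ efg
    rwa [fred_ofHol] at this
  have e2 : ∀ B, (R U B).1 ⟨W, hW⟩ (holRes d h f) =
      fred (dval B hW (T.tr le_rfl (ofHol (holRes d h f)))) := fun B => by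
    have := hR U B W hW _ _ ef
    rwa [fred_ofHol] at this
  have e3 : ∀ B, (R U B).1 ⟨W, hW⟩ (holRes d h g) =
      fred (dval B hW (T.tr le_rfl (ofHol (holRes d h g)))) := fun B => by
    have := hR U B W hW _ _ eg
    rwa [fred_ofHol] at this
  have e4 : ∀ B k, holRes d h ((R U B).1 V k) = (R U B).1 ⟨W, hW⟩ (holRes d h k) := fun B k =>
    (R U B).2.1 V ⟨W, hW⟩ h k
  have e5 : holRes d h (f * g) = holRes d h f * holRes d h g := map_mul _ _ _
  rw [e4, e5, e1, H W hW]
  clear H efg e1 e5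
  induction l with
  | nil =>
    simp only [List.map_nil, List.sum_nil]
    rw [map_zero fred, map_zero (holRes d h)]
  | cons p l ih =>
    simp only [List.map_cons, List.sum_cons]
    rw [map_add fred, ih, map_add (holRes d h), map_mul fred, map_mul (holRes d h), e4, e4, e2, e3]

omit [IsManifold 𝓘(ℂ, EuclideanSpace ℂ (Fin d)) ω M] h𝒜 in
/-- The coproduct is linear over vector fields, acting on tensors by the Leibniz rule. -/
theorem CanRep.leibniz {U : Opens M} {A : sec (diffModule d 𝒜) U} {l} (H : CanRep A l)
    {τ : DiffOp d U} (hτ : IsVectorField τ) :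
    CanRep ((ofOp τ : DOpR d n U) • A) (l.flatMap fun p =>
      [((ofOp τ : DOpR d n U) • p.1, p.2), (p.1, (ofOp τ : DOpR d n U) • p.2)]) := fun V h s t => by
  rw [dval_smul, H V h s t, dres_ofOp]
  exact (hτ.res h).dact_list_sum l (fun A => dval A h s) (fun A => dval A h t)
    (fun A => dval_smul _ A h s) fun A => dval_smul _ A h t

/-- Operators that vanish modulo `ħ` are locally divisible by `ħ`. -/
theorem exists_eq_hbar_smul_of_isRed {U : Opens M} {A : sec (diffModule d 𝒜) U} (hA : IsRed A 0)
    {x : M} (hx : x ∈ U) : ∃ (V : Opens M) (h : V ≤ U), x ∈ V ∧ ∃ B : sec (diffModule d 𝒜) V,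
      secRes _ h A = algebraMap (Base n) (DOpR d n V) (hbar n) • B := by
  obtain ⟨V, hV, hxV, ⟨T⟩, -⟩ := h𝒜.exists_trivialization hx
  obtain ⟨t, ht⟩ := (T.isGen_gen V le_rfl).2 (secRes _ hV A)
  have ht' : t • T.gen = secRes _ hV A := ht
  have h0 : dred t = dred (0 : DOpR d n V) := by
    have h1 := (T.isRed_gen.smul t).eq h𝒜 (ht' ▸ hA.res hV)
    rw [mul_one, map_zero] at h1
    rw [h1, map_zero]
  obtain ⟨q, hq⟩ := eq_hbar_smul_of_dred_eq h0
  refine ⟨V, hV, hxV, q • T.gen, ?_⟩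
  rw [← ht', hq, zero_add, Algebra.smul_def, mul_smul]

/-- Differential operators on functions lift locally to the quantization. -/
theorem exists_isRed_eq {U : Opens M} (P : DiffOp d U) {x : M} (hx : x ∈ U) :
    ∃ (V : Opens M) (h : V ≤ U), x ∈ V ∧ ∃ A : sec (diffModule d 𝒜) V, IsRed A (diffOpRes d h P) := by
  obtain ⟨V, hV, hxV, ⟨T⟩, -⟩ := h𝒜.exists_trivialization hx
  refine ⟨V, hV, hxV, (ofOp (diffOpRes d hV P) : DOpR d n V) • T.gen, ?_⟩
  have := T.isRed_gen.smul (ofOp (diffOpRes d hV P))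
  rwa [dred_ofOp, mul_one] at this

theorem flat_stalk_diffModule (x : M) : Module.Flat (Base n) (Stalk (diffModule d 𝒜) x) := by
  obtain ⟨V, -, hxV, ⟨T⟩, -⟩ := h𝒜.exists_trivialization (U := ⊤) (x := x) trivial
  exact T.isGen_gen.flat hxV

/-- The differential operators on a quantization form a deformation of the coalgebra `D_M`. -/
theorem exists_isCanonical : ∃ S : Deformation (diffModule d 𝒜), IsCanonical 𝒜 S := by
  choose C hC hC' using exists_stalk_coalgebra h𝒜
  have hrep : ∀ {U : Opens M} (A : sec (diffModule d 𝒜) U) (l),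
      ComulRep (diffModule d 𝒜) C A l ↔ CanRep A l := comulRep_iff_canRep h𝒜 hC
  have hcounit : ∀ {U : Opens M} (A : sec (diffModule d 𝒜) U) (e : FunR d n U),
      CounitRep (diffModule d 𝒜) C A e ↔ e = dval A le_rfl 1 := fun A e =>
    ⟨fun H => funR_ext fun x hx => (H x hx).symm.trans (hC' x _ hx A), fun H x hx =>
      (hC' x _ hx A).trans (congrArg (fgerm hx) H.symm)⟩
  choose R hR using fun (U : Opens M) (A : sec (diffModule d 𝒜) U) => exists_isRed h𝒜 A
  have huniq : ∀ {U : Opens M} {A : sec (diffModule d 𝒜) U} {P : DiffOp d U}, IsRed A P → R U A = P :=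
    fun H => (hR _ _).eq h𝒜 H
  refine ⟨
    { isSheaf := isSheaf_diffModule 𝒜
      coalg := C
      comul_local := fun U A x hx => ?_
      counit_local := fun U A x hx => ⟨U, le_rfl, hx, dval A le_rfl 1, (hcounit _ _).2 rfl⟩
      comul_leibniz := fun U τ hτ A l H => (hrep _ _).2 (((hrep A l).1 H).leibniz hτ)
      counit_linear := fun U t A e H => ?_
      flat := flat_stalk_diffModule h𝒜
      reduce := fun U => AddMonoidHom.mk' (R U) fun A B => huniq ((hR U A).add (hR U B))
      reduce_res := fun U V h A => huniq ((hR U A).res h)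
      reduce_smul := fun U t A => huniq ((hR U A).smul t)
      reduce_surj := fun U P x hx => ?_
      reduce_ker := fun U A hA x hx =>
        exists_eq_hbar_smul_of_isRed h𝒜 ((show R U A = 0 from hA) ▸ hR U A) hx
      reduce_comul := fun U A l H V f g => ((hrep A l).1 H).reduce_mul h𝒜 hR V f g
      reduce_counit := fun U A e H => ?_ },
    { comul := fun U A l H V f g => (hrep A l).1 H V.1 V.2 f g
      counit := fun U A e H => (hcounit A e).1 H
      reduce := fun U A V s f e => hR U A V.1 V.2 s f e }⟩
  · obtain ⟨V, hV, hxV, l, hl⟩ := exists_canRep h𝒜 A hx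
    exact ⟨V, hV, hxV, l, (hrep _ _).2 hl⟩
  · refine (hcounit _ _).2 ?_
    have H' := (hcounit A e).1 H
    have e1 : dval ((show DOpR d n U from t) • A) le_rfl 1 = dact t (dval A le_rfl 1) := by
      rw [dval_smul, dres_self]
    exact (congrArg (dact (show DOpR d n U from t)) H').trans e1.symm
  · obtain ⟨V, hV, hxV, A, hA⟩ := exists_isRed_eq h𝒜 P hx
    exact ⟨V, hV, hxV, A, huniq hA⟩
  · have e1 := hR U A U le_rfl _ _ (eqModHbar_one h𝒜 U)
    rw [map_one fred, ← (hcounit A e).1 H] at e1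
    exact e1

omit [IsManifold 𝓘(ℂ, EuclideanSpace ℂ (Fin d)) ω M] h𝒜 in
theorem IsCanonical.canRep {S : Deformation (diffModule d 𝒜)} (hS : IsCanonical 𝒜 S) {U : Opens M}
    {A : sec (diffModule d 𝒜) U} {l} (H : ComulRep _ S.coalg A l) : CanRep A l :=
  fun V h s t => hS.comul U A l H ⟨V, h⟩ s t

/-- The coproduct of a canonical structure is determined by the values of operators on products. -/
theorem IsCanonical.comul_germ {S : Deformation (diffModule d 𝒜)} (hS : IsCanonical 𝒜 S) {U : Opens M}
    {A : sec (diffModule d 𝒜) U} {l} (H : CanRep A l) {x : M} (hx : x ∈ U) :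
    (S.coalg x).comul (germ _ U x hx A) = germList _ l hx := by
  obtain ⟨V, hV, hxV, l', hl'⟩ := S.comul_local U A x hx
  rw [← germ_res _ hV hxV, ← germList_res _ l hV hxV,
    (H.res hV).germList_eq h𝒜 (hS.canRep hl') hxV]
  exact hl' x hxV

omit [IsManifold 𝓘(ℂ, EuclideanSpace ℂ (Fin d)) ω M] h𝒜 in
theorem IsCanonical.counit_germ {S : Deformation (diffModule d 𝒜)} (hS : IsCanonical 𝒜 S)
    {U : Opens M} (A : sec (diffModule d 𝒜) U) {x : M} (hx : x ∈ U) :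
    (S.coalg x).counit (germ _ U x hx A) = fgerm hx (dval A le_rfl 1) := by
  obtain ⟨V, hV, hxV, e, he⟩ := S.counit_local U A x hx
  rw [← germ_res _ hV hxV, he x hxV, hS.counit V _ e he]
  have e1 := fres_dval A le_rfl hV 1
  rw [map_one (ares 𝒜 hV)] at e1
  rw [← fgerm_fres hV hxV, e1]
  rfl

omit [IsManifold 𝓘(ℂ, EuclideanSpace ℂ (Fin d)) ω M] h𝒜 in
theorem IsCanonical.isRed {S : Deformation (diffModule d 𝒜)} (hS : IsCanonical 𝒜 S) {U : Opens M}
    (A : sec (diffModule d 𝒜) U) : IsRed A (S.reduce U A) := fun V h s f e =>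
  hS.reduce U A ⟨V, h⟩ s f e

/-- The canonical structure is unique: coproduct, counit and reduction are determined by evaluations. -/
theorem IsCanonical.eq {S S' : Deformation (diffModule d 𝒜)} (hS : IsCanonical 𝒜 S)
    (hS' : IsCanonical 𝒜 S') : S = S' := by
  have h1 : S.coalg = S'.coalg := by
    funext x
    have hcomul : (S.coalg x).comul = (S'.coalg x).comul := LinearMap.ext fun a => by
      obtain ⟨U, -, hx, A, rfl⟩ := exists_germ_eq _ a (U := ⊤) (x := x) trivial
      obtain ⟨V, hV, hxV, l, hl⟩ := exists_canRep h𝒜 A hx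
      rw [← germ_res _ hV hxV, hS.comul_germ h𝒜 hl, hS'.comul_germ h𝒜 hl]
    have hcounit : (S.coalg x).counit = (S'.coalg x).counit := LinearMap.ext fun a => by
      obtain ⟨U, -, hx, A, rfl⟩ := exists_germ_eq _ a (U := ⊤) (x := x) trivial
      rw [hS.counit_germ, hS'.counit_germ]
    exact coalgebra_ext _ _ hcomul hcounit
  have h2 : S.reduce = S'.reduce := funext fun U => AddMonoidHom.ext fun A =>
    (hS.isRed A).eq h𝒜 (hS'.isRed A)
  -- The remaining fields are propositions.
  obtain ⟨⟨_, c, _, _, _, _⟩, _, r, _, _, _, _, _, _⟩ := S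
  obtain ⟨⟨_, c', _, _, _, _⟩, _, r', _, _, _, _, _, _⟩ := S'
  obtain rfl : c = c' := h1
  obtain rfl : r = r' := h2
  rfl

end

end Canonical

/-! ### Local generators of deformations -/

theorem exists_eq_hbar_mul {n k : ℕ} (hk : k ≤ n) {a : Base n} (h : hbar n ^ k * a = 0) :
    ∃ b, a = hbar n * b := by
  obtain ⟨p, rfl⟩ := Ideal.Quotient.mk_surjective a
  have h1 : (Polynomial.X : Polynomial ℂ) ^ (n + 1) ∣ Polynomial.X ^ k * p :=
    Ideal.mem_span_singleton.1 (Ideal.Quotient.eq_zero_iff_mem.1 h)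
  rw [show n + 1 = k + ((n - k) + 1) by omega, pow_add] at h1
  obtain ⟨q, rfl⟩ := (Dvd.intro_left _ (pow_succ _ _).symm).trans
    ((mul_dvd_mul_iff_left (pow_ne_zero k Polynomial.X_ne_zero)).1 h1)
  exact ⟨Ideal.Quotient.mk _ q, rfl⟩

/-- In a flat `R`-module, an element killed by a power of `ħ` that is not zero is divisible by `ħ`. -/
theorem exists_eq_hbar_smul {n k : ℕ} (hk : k ≤ n) {N : Type*} [AddCommGroup N] [Module (Base n) N]
    [Module.Flat (Base n) N] {a : N} (h : hbar n ^ k • a = 0) : ∃ b, a = hbar n • b := by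
  -- By flatness the relation `ħ^k a = 0` comes from relations in `R`.
  obtain ⟨κ, c, y, h1, h2⟩ := Module.Flat.isTrivialRelation_of_sum_smul_eq_zero (ι := Fin 1)
    (f := fun _ => hbar n ^ k) (x := fun _ => a) (by rw [Fin.sum_univ_one, h])
  have h3 : ∀ j, ∃ b, c 0 j = hbar n * b := fun j =>
    exists_eq_hbar_mul hk ((Fin.sum_univ_one _).symm.trans (h2 j))
  choose b hb using h3
  refine ⟨∑ j, b j • y j, ?_⟩
  rw [show a = _ from h1 0, Finset.smul_sum]
  exact Finset.sum_congr rfl fun j _ => by rw [hb, mul_smul]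

section Deformation

variable {d n : ℕ} {M : Type u} [TopologicalSpace M] [ChartedSpace (EuclideanSpace ℂ (Fin d)) M]
  {F : PresheafOfModules.{u} (DR d n M)} (S : Deformation F)

include S

theorem Deformation.reduce_dsmul {U : Opens M} (t : DOpR d n U) (a : sec F U) :
    S.reduce U (t • a) = dred t * S.reduce U a := S.reduce_smul U t a

theorem Deformation.reduce_hbar_smul {U : Opens M} (a : sec F U) :
    S.reduce U (algebraMap (Base n) (DOpR d n U) (hbar n) • a) = 0 := by
  have e : dred (algebraMap (Base n) (DOpR d n U) (hbar n)) = 0 := by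
    rw [Algebra.algebraMap_eq_smul_one]
    exact red_hbar_smul (A := DiffOp d U) _
  rw [S.reduce_dsmul, e, zero_mul]

variable {U : Opens M} {ε : sec F U} (hε : S.reduce U ε = 1)
include hε

theorem Deformation.reduce_smul_gen {V : Opens M} (h : V ≤ U) (t : DOpR d n V) :
    S.reduce V (t • secRes F h ε) = dred t := by
  rw [S.reduce_dsmul, S.reduce_res, hε, map_one, mul_one]

/-- The inductive step of the injectivity: if `ħ^k t` kills a lift `ε` of `1`, then by flatness `t • ε` is
locally divisible by `ħ`, so its reduction, which is that of `t`, vanishes. -/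
theorem Deformation.dred_eq_zero {V : Opens M} (h : V ≤ U) (t : DOpR d n V) {k : ℕ} (hk : k ≤ n)
    (ht : (hbar n ^ k • t) • secRes F h ε = 0) : dred t = 0 := by
  refine sheafLike_diffOp.sep _ _ _ fun x hx => ?_
  have := S.flat x
  have h0 : hbar n ^ k • germ F V x hx (t • secRes F h ε) = 0 := by
    rw [← germ_smul_dsmul, ht, map_zero]
  obtain ⟨m, hm⟩ := exists_eq_hbar_smul hk h0
  obtain ⟨W, hW, hxW, b, rfl⟩ := exists_germ_eq F m hx
  rw [← germ_algebraMap_smul] at hm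
  obtain ⟨W', h1, h2, hxW', e⟩ := exists_secRes_eq F hx hxW _ _ hm
  refine ⟨W', h1, hxW', ?_⟩
  have e1 := congrArg (S.reduce W') e
  rw [S.reduce_res, S.reduce_res, S.reduce_hbar_smul, S.reduce_smul_gen hε] at e1
  exact e1.trans ((map_zero (diffOpRes d h2)).trans (map_zero (diffOpRes d h1)).symm)

theorem Deformation.smul_gen_injective {V : Opens M} (h : V ≤ U) (t : DOpR d n V)
    (ht : t • secRes F h ε = 0) : t = 0 := by
  have key : ∀ k ≤ n + 1, ∃ q : DOpR d n V, t = hbar n ^ k • q := fun k => by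
    induction k with
    | zero => exact fun _ => ⟨t, by rw [pow_zero, one_smul]⟩
    | succ k ih =>
      intro hk
      obtain ⟨q, rfl⟩ := ih (by omega)
      obtain ⟨q', rfl⟩ := eq_hbar_smul_of_dred_eq (t := q) (t' := 0)
        ((S.dred_eq_zero hε h q (by omega) ht).trans (map_zero _).symm)
      exact ⟨q', by rw [zero_add, smul_smul, ← pow_succ]⟩
  obtain ⟨q, rfl⟩ := key (n + 1) le_rfl
  rw [hbar_pow_eq_zero n _ le_rfl, zero_smul]

/-- The multiples of a lift `ε` of `1` exhaust the deformation modulo each power of `ħ`. -/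
theorem Deformation.exists_smul_gen_add {V : Opens M} (h : V ≤ U) (a : sec F V) {x : M} (hx : x ∈ V)
    (k : ℕ) : ∃ (W : Opens M) (hW : W ≤ V), x ∈ W ∧ ∃ (t : DOpR d n W) (b : sec F W),
      secRes F hW a = t • secRes F (hW.trans h) ε +
        algebraMap (Base n) (DOpR d n W) (hbar n ^ k) • b := by
  induction k with
  | zero => exact ⟨V, le_rfl, hx, 0, a, by rw [pow_zero, map_one, one_smul, zero_smul, zero_add,
      secRes_self]⟩
  | succ k ih =>
    obtain ⟨W, hW, hxW, t, b, e⟩ := ih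
    have h0 : S.reduce W (b - (ofOp (S.reduce W b) : DOpR d n W) • secRes F (hW.trans h) ε) = 0 := by
      rw [map_sub, S.reduce_smul_gen hε, dred_ofOp, sub_self]
    obtain ⟨W', hW', hxW', c, hc⟩ := S.reduce_ker W _ h0 x hxW
    have hc' : secRes F hW' b - dres hW' (ofOp (S.reduce W b) : DOpR d n W) •
        secRes F ((hW'.trans hW).trans h) ε =
        algebraMap (Base n) (DOpR d n W') (hbar n) • c := by
      rw [map_sub, secRes_dsmul, secRes_res] at hc
      exact hc
    rw [sub_eq_iff_eq_add] at hc'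
    refine ⟨W', hW'.trans hW, hxW', dres hW' t + algebraMap _ _ (hbar n ^ k) *
      dres hW' (ofOp (S.reduce W b) : DOpR d n W), c, ?_⟩
    rw [← secRes_res F hW hW', e, map_add, secRes_dsmul, secRes_dsmul, secRes_res, hc', smul_add,
      AlgHom.commutes, pow_succ, map_mul, mul_smul, add_smul, mul_smul]
    abel

/-- A section of a deformation that lifts the unit of `D_M` is a free generator: the injectivity is
the flatness, the surjectivity is the nilpotence of `ħ`. -/
theorem Deformation.isGen : IsGen F U ε := by
  have inj : ∀ (V : Opens M) (h : V ≤ U) (t t' : DOpR d n V),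
      t • secRes F h ε = t' • secRes F h ε → t = t' := fun V h t t' e =>
    sub_eq_zero.1 (S.smul_gen_injective hε h _ (by rw [sub_smul, e, sub_self]))
  refine fun V h => ⟨fun t t' e => inj V h t t' e, fun a => ?_⟩
  obtain ⟨t, ht⟩ := sheafLike_dOpR.exists_of_locally (U := V)
    (fun W hW t => t • secRes F (hW.trans h) ε = secRes F hW a)
    (fun W W' hW hW' t e => by
      rw [← secRes_res F hW hW', ← e, secRes_dsmul, secRes_res])
    (fun W hW t t' e e' => inj W (hW.trans h) t t' (e.trans e'.symm)) (fun x hx => by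
      obtain ⟨W, hW, hxW, t, b, e⟩ := S.exists_smul_gen_add hε h a hx (n + 1)
      refine ⟨W, hW, hxW, t, ?_⟩
      rw [e, hbar_pow_eq_zero n _ le_rfl, map_zero, zero_smul, add_zero])
  refine ⟨t, (sheafLike_sec F S.isSheaf).sep _ _ _ fun x hx => ?_⟩
  obtain ⟨W, hW, hxW, e⟩ := ht x hx
  refine ⟨W, hW, hxW, ?_⟩
  rw [← e]
  beta_reduce
  rw [secRes_dsmul, secRes_res]

omit hε ε in
theorem Deformation.exists_gen {x : M} (hx : x ∈ U) : ∃ (V : Opens M) (_ : V ≤ U), x ∈ V ∧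
    ∃ ε : sec F V, S.reduce V ε = 1 := by
  obtain ⟨V, hV, hxV, ε, h⟩ := S.reduce_surj U 1 x hx
  exact ⟨V, hV, hxV, ε, h.trans (map_one _)⟩

end Deformation

/-! ### Double duality -/

section Duality

variable {d n : ℕ} {M : Type u} [TopologicalSpace M] [ChartedSpace (EuclideanSpace ℂ (Fin d)) M]

theorem homSec_res {F G : PresheafOfModules.{u} (DR d n M)} (f : F ⟶ G) {U V : Opens M} (h : V ≤ U)
    (a : sec F U) : homSec f V (secRes F h a) = secRes G h (homSec f U a) :=
  PresheafOfModules.naturality_apply f (ophom h) a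

theorem homSec_dsmul {F G : PresheafOfModules.{u} (DR d n M)} (f : F ⟶ G) {U : Opens M}
    (t : DOpR d n U) (a : sec F U) : homSec f U (t • a) = t • homSec f U a :=
  (f.app (opn U)).hom.map_smul t a

variable {𝒜 ℬ : AlgSheaf n M}

theorem dval_diffCongr (e : 𝒜 ≅ ℬ) {U V : Opens M} (A : sec (diffModule d 𝒜) U) (h : V ≤ U)
    (s : asec ℬ V) : dval (homSec (diffCongr e) U A) h s = dval A h ((isoApp e V).symm s) := rfl

theorem CanRep.diffCongr (e : 𝒜 ≅ ℬ) {U : Opens M} {A : sec (diffModule d 𝒜) U} {l}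
    (H : CanRep A l) : CanRep (homSec (diffCongr e) U A)
      (l.map fun p => (homSec (StarQuant.diffCongr e) U p.1, homSec (StarQuant.diffCongr e) U p.2)) :=
  fun V h s t => by
    rw [dval_diffCongr, map_mul, H, List.map_map]
    rfl

theorem IsRed.diffCongr (e : 𝒜 ≅ ℬ) {U : Opens M} {A : sec (diffModule d 𝒜) U} {P : DiffOp d U}
    (H : IsRed A P) : IsRed (homSec (diffCongr e) U A) P := fun V h _ f hsf =>
  H V h _ f (EqModHbar.congr e.symm hsf)

theorem IsCanonical.isDeformationHom_diffCongr [IsManifold 𝓘(ℂ, EuclideanSpace ℂ (Fin d)) ω M]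
    (hℬ : IsStarQuantization d ℬ) {S : Deformation (diffModule d 𝒜)}
    {T : Deformation (diffModule d ℬ)} (hS : IsCanonical 𝒜 S) (hT : IsCanonical ℬ T) (e : 𝒜 ≅ ℬ) :
    IsDeformationHom S T (diffCongr e) where
  comul U A l H x hx := hT.comul_germ hℬ ((hS.canRep H).diffCongr e) hx
  counit U A f H x hx := by
    have h1 : dval (homSec (diffCongr e) U A) le_rfl 1 = dval A le_rfl 1 := by
      rw [dval_diffCongr, map_one]
    rw [hT.counit_germ, h1]
    exact congrArg (fgerm hx) (hS.counit U A f H).symm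
  reduce U A := IsRed.eq hℬ (hT.isRed _) ((hS.isRed A).diffCongr e)

/-- Sections of a quantization are determined by the values of the differential operators. -/
theorem asec_ext [IsManifold 𝓘(ℂ, EuclideanSpace ℂ (Fin d)) ω M] (h𝒜 : IsStarQuantization d 𝒜)
    {U : Opens M} {s t : asec 𝒜 U} (H : ∀ (V : Opens M) (h : V ≤ U) (A : sec (diffModule d 𝒜) V),
      dval A le_rfl (ares 𝒜 h s) = dval A le_rfl (ares 𝒜 h t)) : s = t := by
  refine (sheafLike_asec 𝒜).sep _ _ _ fun x hx => ?_
  obtain ⟨V, hV, hxV, ⟨T⟩, -⟩ := h𝒜.exists_trivialization hx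
  exact ⟨V, hV, hxV, (T.tr le_rfl).symm.injective (H V hV T.gen)⟩

/-- Families of `D_M ⊗ R`-linear maps from the differential operators on a quantization to the functions
are evaluations at sections of the quantization. -/
theorem exists_dval_eq [IsManifold 𝓘(ℂ, EuclideanSpace ℂ (Fin d)) ω M] (h𝒜 : IsStarQuantization d 𝒜)
    {U : Opens M} (φ : ∀ V : Opens M, V ≤ U → sec (diffModule d 𝒜) V → FunR d n V)
    (hres : ∀ V W (hV : V ≤ U) (h : W ≤ V) A, fres h (φ V hV A) = φ W (h.trans hV) (secRes _ h A))
    (hsmul : ∀ V (hV : V ≤ U) (t : DOpR d n V) A, φ V hV (t • A) = dact t (φ V hV A)) :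
    ∃ s : asec 𝒜 U, ∀ V (h : V ≤ U) A, φ V h A = dval A le_rfl (ares 𝒜 h s) := by
  obtain ⟨s, hs⟩ := (sheafLike_asec 𝒜).exists_of_locally (U := U)
    (fun V hV s => ∀ W (h : W ≤ V) A, φ W (h.trans hV) A = dval A le_rfl (ares 𝒜 h s))
    (fun V W hV h s H W' h' A => by rw [ares_ares]; exact H W' (h'.trans h) A)
    (fun V hV s t H H' => asec_ext h𝒜 fun W h A => (H W h A).symm.trans (H' W h A)) (fun x hx => by
      obtain ⟨V, hV, hxV, ⟨T⟩, -⟩ := h𝒜.exists_trivialization hx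
      -- The section whose image under the generator is the value of `φ` at the generator.
      refine ⟨V, hV, hxV, T.tr le_rfl (φ V hV T.gen), fun W h A => ?_⟩
      obtain ⟨t, rfl⟩ := (T.isGen_gen W h).2 A
      beta_reduce
      rw [hsmul, ← hres, T.dval_smul_gen, dres_self, T.tr_symm_ares le_rfl h,
        LinearEquiv.symm_apply_apply])
  refine ⟨s, fun V hV A => sheafLike_funR.sep _ _ _ fun x hx => ?_⟩
  obtain ⟨W, hW, hxW, H⟩ := hs x (hV hx)
  refine ⟨V ⊓ W, inf_le_left, ⟨hx, hxW⟩, ?_⟩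
  rw [hres, H (V ⊓ W) inf_le_right, ares_ares, fres_dval, ares_ares, dval_secRes]

/-- An isomorphism of sheaves of algebras, from compatible isomorphisms of algebras. -/
def algSheafIso (e : ∀ U : Opens M, asec 𝒜 U ≃ₐ[Base n] asec ℬ U)
    (he : ∀ (U V : Opens M) (h : V ≤ U) (s : asec 𝒜 U), ares ℬ h (e U s) = e V (ares 𝒜 h s)) : 𝒜 ≅ ℬ :=
  (ObjectProperty.isoMk _ (NatIso.ofComponents
    (fun U : (Opens (TopCat.of M))ᵒᵖ => (e (U.unop : Opens M)).toAlgebraIso) fun {U V} f => by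
      refine AlgCat.hom_ext _ (AlgHom.ext fun s => ?_)
      exact (he _ _ (leOfHom f.unop) s).symm) : 𝒜 ≅ ℬ)

end Duality

section Full

variable {d n : ℕ} {M : Type u} [TopologicalSpace M] [ChartedSpace (EuclideanSpace ℂ (Fin d)) M]
  [IsManifold 𝓘(ℂ, EuclideanSpace ℂ (Fin d)) ω M] {𝒜 ℬ : AlgSheaf n M}

/-- A morphism of deformations `Diff_M(𝒜) → Diff_M(ℬ)` is the composition with a morphism
of algebras `ℬ → 𝒜`. -/
theorem IsDeformationHom.exists_algHom (h𝒜 : IsStarQuantization d 𝒜) {S : Deformation (diffModule d 𝒜)}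
    {T : Deformation (diffModule d ℬ)} (hS : IsCanonical 𝒜 S) (hT : IsCanonical ℬ T)
    {f : diffModule d 𝒜 ⟶ diffModule d ℬ} (hf : IsDeformationHom S T f) (U : Opens M) :
    ∃ e : asec ℬ U →ₐ[Base n] asec 𝒜 U, ∀ t (V : Opens M) (h : V ≤ U) (A : sec (diffModule d 𝒜) V),
      dval (homSec f V A) le_rfl (ares ℬ h t) = dval A le_rfl (ares 𝒜 h (e t)) := by
  choose e he using fun t : asec ℬ U => exists_dval_eq h𝒜 (U := U)
    (fun V h A => dval (homSec f V A) le_rfl (ares ℬ h t))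
    (fun V W hV h A => by rw [fres_dval, homSec_res, ares_ares, dval_secRes])
    (fun V hV t A => by rw [homSec_dsmul, dval_smul, dres_self])
  -- `f` preserves the counit, which is the evaluation at `1`.
  have hone : e 1 = 1 := asec_ext h𝒜 fun V h A => by
    rw [← he, map_one (ares ℬ h), map_one (ares 𝒜 h)]
    refine funR_ext fun x hx => ?_
    obtain ⟨W, hW, hxW, g, hg⟩ := S.counit_local V A x hx
    have e1 := hS.counit W _ g hg
    have e2 := hT.counit W _ g (hf.counit W _ g hg)
    have e3 : dval (homSec f W (secRes _ hW A)) le_rfl 1 = dval (secRes _ hW A) le_rfl 1 :=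
      e2.symm.trans e1
    rw [homSec_res, dval_secRes, dval_secRes] at e3
    have e4 := fres_dval A le_rfl hW 1
    have e5 := fres_dval (homSec f V A) le_rfl hW 1
    rw [map_one (ares 𝒜 hW)] at e4
    rw [map_one (ares ℬ hW)] at e5
    rw [← fgerm_fres hW hxW, ← fgerm_fres hW hxW, e4, e5, e3]
  -- `f` preserves the coproduct, which is dual to the multiplication.
  have hmul : ∀ t t', e (t * t') = e t * e t' := fun t t' => asec_ext h𝒜 fun V h A => by
    rw [← he, map_mul (ares ℬ h), map_mul (ares 𝒜 h)]
    refine funR_ext fun x hx => ?_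
    obtain ⟨W, hW, hxW, l, hl⟩ := S.comul_local V A x hx
    have e1 := (hS.canRep hl) W le_rfl (ares 𝒜 (hW.trans h) (e t)) (ares 𝒜 (hW.trans h) (e t'))
    have e2 := (hT.canRep (hf.comul W _ l hl)) W le_rfl (ares ℬ (hW.trans h) t)
      (ares ℬ (hW.trans h) t')
    rw [List.map_map] at e2
    have e3 : ∀ p : sec (diffModule d 𝒜) W × sec (diffModule d 𝒜) W,
        dval (homSec f W p.1) le_rfl (ares ℬ (hW.trans h) t) *
          dval (homSec f W p.2) le_rfl (ares ℬ (hW.trans h) t') =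
        dval p.1 le_rfl (ares 𝒜 (hW.trans h) (e t)) * dval p.2 le_rfl (ares 𝒜 (hW.trans h) (e t')) :=
      fun p => congrArg₂ (· * ·) (he _ _ _ _) (he _ _ _ _)
    have e4 := e2.trans ((congrArg List.sum (List.map_congr_left fun p _ => e3 p)).trans e1.symm)
    rw [homSec_res, dval_secRes, dval_secRes, ← ares_ares 𝒜 h hW, ← ares_ares 𝒜 h hW,
      ← ares_ares ℬ h hW, ← ares_ares ℬ h hW, ← map_mul (ares 𝒜 hW), ← map_mul (ares ℬ hW),
      ← fres_dval _ le_rfl, ← fres_dval _ le_rfl] at e4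
    rw [← fgerm_fres hW hxW, ← fgerm_fres hW hxW, e4]
  refine ⟨AlgHom.ofLinearMap ⟨⟨e, fun t t' => asec_ext h𝒜 fun V h A => ?_⟩, fun r t =>
    asec_ext h𝒜 fun V h A => ?_⟩ hone hmul, fun t V h A => he t V h A⟩
  · rw [← he, map_add, map_add, map_add, map_add, ← he, ← he]
  · change _ = dval A le_rfl (ares 𝒜 h (r • e t))
    rw [← he, map_smul, map_smul, map_smul, map_smul, ← he]

/-- Isomorphic deformations come from isomorphic quantizations. -/
theorem exists_diffCongr_eq (h𝒜 : IsStarQuantization d 𝒜) (hℬ : IsStarQuantization d ℬ)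
    {S : Deformation (diffModule d 𝒜)} {T : Deformation (diffModule d ℬ)} (hS : IsCanonical 𝒜 S)
    (hT : IsCanonical ℬ T) {f : diffModule d 𝒜 ⟶ diffModule d ℬ} (hf : IsDeformationHom S T f)
    {g : diffModule d ℬ ⟶ diffModule d 𝒜} (hg : IsDeformationHom T S g) (hfg : f ≫ g = 𝟙 _)
    (hgf : g ≫ f = 𝟙 _) : ∃ e : 𝒜 ≅ ℬ, diffCongr e = f := by
  choose α hα using hf.exists_algHom h𝒜 hS hT
  choose β hβ using hg.exists_algHom hℬ hT hS
  have h1 : ∀ U A, homSec g U (homSec f U A) = A := fun U A =>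
    DFunLike.congr_fun (congrArg (fun k => homSec k U) hfg) A
  have h2 : ∀ U A, homSec f U (homSec g U A) = A := fun U A =>
    DFunLike.congr_fun (congrArg (fun k => homSec k U) hgf) A
  have hres : ∀ {U V : Opens M} (h : V ≤ U) (t : asec ℬ U), ares 𝒜 h (α U t) = α V (ares ℬ h t) :=
    fun h t => asec_ext h𝒜 fun W h' A => by
      rw [← hα, ares_ares, ← hα, ares_ares]
  have hαβ : ∀ U s, α U (β U s) = s := fun U s => asec_ext h𝒜 fun V h A => by
    rw [← hα, ← hβ, h1]
  have hβα : ∀ U s, β U (α U s) = s := fun U s => asec_ext hℬ fun V h A => by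
    rw [← hβ, ← hα, h2]
  let e : ∀ U : Opens M, asec ℬ U ≃ₐ[Base n] asec 𝒜 U := fun U =>
    AlgEquiv.ofAlgHom (α U) (β U) (AlgHom.ext (hαβ U)) (AlgHom.ext (hβα U))
  refine ⟨(algSheafIso e fun U V h s => hres h s).symm, ?_⟩
  refine PresheafOfModules.hom_ext fun U => ModuleCat.hom_ext (LinearMap.ext fun A => ?_)
  refine dval_ext (𝒜 := ℬ) fun V h t => ?_
  have e1 := hα V t V le_rfl (secRes (diffModule d 𝒜) h A)
  rw [homSec_res, dval_secRes, dval_secRes, (sheafLike_asec ℬ).res_self,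
    (sheafLike_asec 𝒜).res_self] at e1
  exact e1.symm

/-- The functor from quantizations to deformations is faithful. -/
theorem diffCongr_injective (h𝒜 : IsStarQuantization d 𝒜) {e e' : 𝒜 ≅ ℬ}
    (h : diffCongr (d := d) e = diffCongr e') : e = e' := by
  have h1 : ∀ U (t : asec ℬ U), (isoApp e U).symm t = (isoApp e' U).symm t := fun U t =>
    asec_ext h𝒜 fun V h' A => by
      have e1 := congrArg (fun k => dval (homSec k V A) le_rfl (ares ℬ h' t)) h
      beta_reduce at e1
      rw [dval_diffCongr, dval_diffCongr] at e1
      have e2 : ∀ e : 𝒜 ≅ ℬ, ares 𝒜 h' ((isoApp e U).symm t) = (isoApp e V).symm (ares ℬ h' t) :=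
        fun e => isoApp_res e.symm h' t
      rw [e2, e2, e1]
  have h2 : e.inv = e'.inv := by
    refine ObjectProperty.hom_ext _ (NatTrans.ext (funext fun U => AlgCat.hom_ext _ (AlgHom.ext
      fun t => h1 _ t)))
  exact Iso.ext_inv h2

end Full

/-! ### The sheaf of algebras dual to a deformation -/

/-- The convolution ring of functionals on a coalgebra. -/
@[reducible] def convRingOf {R P : Type*} [CommRing R] [AddCommGroup P] [Module R P]
    (C : Coalgebra R P) : Ring (WithConv (P →ₗ[R] R)) := inferInstance

/-- The convolution algebra of functionals on a coalgebra over a smaller base ring. -/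
@[reducible] def convAlgebraOf (k : Type*) {R P : Type*} [CommRing k] [CommRing R] [Algebra k R]
    [AddCommGroup P] [Module R P] (C : Coalgebra R P) :
    letI := convRingOf C
    Algebra k (WithConv (P →ₗ[R] R)) := inferInstance

section StalkDual

variable {d n : ℕ} {M : Type u} [TopologicalSpace M] [ChartedSpace (EuclideanSpace ℂ (Fin d)) M]
  {F : PresheafOfModules.{u} (DR d n M)}

/-- The dual of the coalgebra `F_x` over `(O_M ⊗ R)_x`, an algebra under convolution. -/
def StalkDual (_C : ∀ x : M, Coalgebra (StalkOR d n M x) (Stalk F x)) (x : M) : Type u :=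
  WithConv (Stalk F x →ₗ[StalkOR d n M x] StalkOR d n M x)

variable (C : ∀ x : M, Coalgebra (StalkOR d n M x) (Stalk F x))

instance (x : M) : Ring (StalkDual C x) :=
  convRingOf (C x)

instance (x : M) : Algebra (Base n) (StalkDual C x) :=
  convAlgebraOf (Base n) (C x)

variable {C} {x : M}

/-- Evaluation of functionals on the stalk. -/
def sval (φ : StalkDual C x) : Module.Dual (StalkOR d n M x) (Stalk F x) := φ.ofConv

variable (C) in
/-- Functionals on the stalk as elements of the convolution algebra. -/
def ofDual (L : Module.Dual (StalkOR d n M x) (Stalk F x)) : StalkDual C x := WithConv.toConv L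

theorem sval_ext {φ ψ : StalkDual C x} (h : ∀ a, sval φ a = sval ψ a) : φ = ψ :=
  WithConv.ofConv_injective (LinearMap.ext h)

theorem sval_add (φ ψ : StalkDual C x) (a : Stalk F x) : sval (φ + ψ) a = sval φ a + sval ψ a := rfl

theorem sval_smul (r : Base n) (φ : StalkDual C x) (a : Stalk F x) :
    sval (r • φ) a = r • sval φ a := rfl

theorem sval_one (a : Stalk F x) : sval (1 : StalkDual C x) a = (C x).counit a := rfl

theorem sval_mul (φ ψ : StalkDual C x) (a : Stalk F x) :
    sval (φ * ψ) a = pair (sval φ) (sval ψ) ((C x).comul a) := by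
  let := C x
  have h : LinearMap.mul' (StalkOR d n M x) (StalkOR d n M x) ∘ₗ
      TensorProduct.map (sval φ) (sval ψ) = pair (sval φ) (sval ψ) := by
    refine TensorProduct.ext' fun p q => ?_
    rw [pair_tmul]
    rfl
  exact DFunLike.congr_fun h ((C x).comul a)

end StalkDual

section Dual

theorem DOpR.eq_sum_coef {d n : ℕ} {M : Type u} [TopologicalSpace M]
    [ChartedSpace (EuclideanSpace ℂ (Fin d)) M] {V : Opens M} (t : DOpR d n V) :
    t = ∑ i : Fin (n + 1), algebraMap (Base n) (DOpR d n V) (hbar n ^ (i : ℕ)) *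
      ofOp (coef i (show DiffOpR d n V from t)) :=
  (sum_coef (A := DiffOp d V) t).symm.trans (Finset.sum_congr rfl fun i _ => by
    rw [← Algebra.smul_def]
    exact ((TensorProduct.smul_tmul' _ (1 : Base n) _).trans
      (congrArg (· ⊗ₜ[ℂ] _) (mul_one _))).symm)

variable {d n : ℕ} {M : Type u} [TopologicalSpace M] [ChartedSpace (EuclideanSpace ℂ (Fin d)) M]
  {F : PresheafOfModules.{u} (DR d n M)}

/-- The function `f` over `V` is the value at the section `a` of the family `χ` of functionals. -/
def EvalTo {U : Opens M} (χ : ∀ x : U, Module.Dual (StalkOR d n M x.1) (Stalk F x.1)) {V : Opens M}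
    (h : V ≤ U) (a : sec F V) (f : FunR d n V) : Prop :=
  ∀ x (hx : x ∈ V), χ ⟨x, h hx⟩ (germ F V x hx a) = fgerm hx f

namespace EvalTo

variable {U : Opens M} {χ : ∀ x : U, Module.Dual (StalkOR d n M x.1) (Stalk F x.1)} {V : Opens M}
  {h : V ≤ U} {a b : sec F V} {f g : FunR d n V}

theorem res (H : EvalTo χ h a f) {W : Opens M} (h' : W ≤ V) :
    EvalTo χ (h'.trans h) (secRes F h' a) (fres h' f) := fun x hx => by
  rw [germ_res, fgerm_fres, H]

theorem eq (H : EvalTo χ h a f) (H' : EvalTo χ h a g) : f = g :=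
  funR_ext fun x hx => (H x hx).symm.trans (H' x hx)

theorem add (H : EvalTo χ h a f) (H' : EvalTo χ h b g) : EvalTo χ h (a + b) (f + g) := fun x hx => by
  rw [map_add, map_add, map_add, H, H']

theorem neg (H : EvalTo χ h a f) : EvalTo χ h (-a) (-f) := fun x hx => by
  rw [map_neg, map_neg, map_neg, H]

theorem zero : EvalTo χ h 0 0 := fun x hx => by
  rw [map_zero, map_zero, map_zero]

theorem ofFun_smul (H : EvalTo χ h a f) (s : FunR d n V) : EvalTo χ h (ofFun s • a) (s * f) :=
  fun x hx => by rw [germ_ofFun_smul, map_smul, H, map_mul, smul_eq_mul]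

theorem of_locally (H : ∀ x ∈ V, ∃ (W : Opens M) (h' : W ≤ V), x ∈ W ∧
    EvalTo χ (h'.trans h) (secRes F h' a) (fres h' f)) : EvalTo χ h a f := fun x hx => by
  obtain ⟨W, h', hxW, e⟩ := H x hx
  have := e x hxW
  rwa [germ_res, fgerm_fres] at this

theorem exists_of_locally (H : ∀ x ∈ V, ∃ (W : Opens M) (h' : W ≤ V), x ∈ W ∧
    ∃ f, EvalTo χ (h'.trans h) (secRes F h' a) f) : ∃ f, EvalTo χ h a f := by
  obtain ⟨f, hf⟩ := sheafLike_funR.exists_of_locally (U := V)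
    (fun W h' f => EvalTo χ (h'.trans h) (secRes F h' a) f)
    (fun W W' h' h'' f e => by
      have := e.res h''
      rwa [secRes_res] at this)
    (fun _ _ _ _ e e' => e.eq e') H
  exact ⟨f, of_locally hf⟩

variable (χ h) in
/-- The operators with which evaluation of functionals commutes. -/
def commuting : Subring (DOpR d n V) where
  carrier := {t | ∀ a f, EvalTo χ h a f → EvalTo χ h (t • a) (dact t f)}
  mul_mem' := fun {t t'} ht ht' a f e => by
    rw [mul_smul, dact_mul]
    exact ht _ _ (ht' _ _ e)
  one_mem' := fun a f e => by
    rw [one_smul, map_one dact]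
    exact e
  add_mem' := fun {t t'} ht ht' a f e => by
    rw [add_smul, dact_add]
    exact (ht _ _ e).add (ht' _ _ e)
  zero_mem' := fun a f e => by
    rw [zero_smul, map_zero dact]
    exact zero
  neg_mem' := fun {t} ht a f e => by
    rw [neg_smul, map_neg dact]
    exact (ht _ _ e).neg

theorem ofFun_mem_commuting (s : FunR d n V) : ofFun s ∈ commuting χ h := fun a f e => by
  rw [dact_ofFun]
  exact e.ofFun_smul s

theorem mem_commuting_of_orderLT
    (Hτ : ∀ (τ : DiffOp d V), IsVectorField τ → (ofOp τ : DOpR d n V) ∈ commuting χ h)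
    (C : Coordinates (d := d) V) {N : ℕ} {t : DOpR d n V} (ht : t.OrderLT N) :
    t ∈ commuting χ h := by
  rw [DOpR.eq_sum_coef t]
  refine sum_mem fun i _ => mul_mem (by rw [← ofFun.commutes]; exact ofFun_mem_commuting _) ?_
  exact C.diffOp_mem_of_orderLT ((commuting χ h).comap ofOp) (fun f => ofFun_mem_commuting (ofHol f))
    Hτ (ht i)

/-- Compatibility with vector fields implies linearity over `D_M ⊗ R`. -/
theorem dsmul [IsManifold 𝓘(ℂ, EuclideanSpace ℂ (Fin d)) ω M]
    (Hτ : ∀ (V : Opens M) (h : V ≤ U) (τ : DiffOp d V), IsVectorField τ →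
      (ofOp τ : DOpR d n V) ∈ commuting χ h)
    (H : EvalTo χ h a f) (t : DOpR d n V) : EvalTo χ h (t • a) (dact t f) := by
  refine of_locally fun x hx => ?_
  obtain ⟨V₁, hxV₁, ⟨C⟩⟩ := exists_coordinates (d := d) x
  obtain ⟨W, hW, hxW, N, hN⟩ := (dres (inf_le_right : V₁ ⊓ V ≤ V) t).exists_orderLT ⟨hxV₁, hx⟩
  rw [dres_dres] at hN
  refine ⟨W, hW.trans inf_le_right, hxW, ?_⟩
  rw [secRes_dsmul, fres_dact]
  exact mem_commuting_of_orderLT (Hτ _ _) (C.restrict (hW.trans inf_le_left)) hN _ _ (H.res _)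

end EvalTo

end Dual

section DualSheaf

variable {d n : ℕ} {M : Type u} [TopologicalSpace M] [ChartedSpace (EuclideanSpace ℂ (Fin d)) M]
  {F : PresheafOfModules.{u} (DR d n M)} (S : Deformation F)

/-- The families of functionals on the stalks over `U` that come from `D_M ⊗ R`-linear maps of sheaves
`F|_U → O_U ⊗ R`. -/
def IsEval {U : Opens M} (φ : ∀ x : U, StalkDual S.coalg x.1) : Prop :=
  ∀ (V : Opens M) (h : V ≤ U) (a : sec F V), ∃ f : FunR d n V, ∀ t : DOpR d n V,
    EvalTo (fun x => sval (φ x)) h (t • a) (dact t f)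

variable {S}

/-- Values that exist locally glue, since they are unique. -/
theorem isEval_of_locally {U : Opens M} {φ : ∀ x : U, StalkDual S.coalg x.1}
    (H : ∀ (V : Opens M) (h : V ≤ U) (a : sec F V), ∀ x ∈ V, ∃ (W : Opens M) (h' : W ≤ V), x ∈ W ∧
      ∃ f : FunR d n W, ∀ t : DOpR d n W,
        EvalTo (fun x => sval (φ x)) (h'.trans h) (t • secRes F h' a) (dact t f)) : IsEval S φ := by
  intro V h a
  have one : ∀ {W : Opens M} (h : W ≤ U) {b : sec F W} {f : FunR d n W},
      (∀ t : DOpR d n W, EvalTo (fun x => sval (φ x)) h (t • b) (dact t f)) →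
        EvalTo (fun x => sval (φ x)) h b f := fun h b f e => by
    have := e 1
    rwa [one_smul, map_one dact] at this
  obtain ⟨f, hf⟩ := EvalTo.exists_of_locally (χ := fun x => sval (φ x)) (h := h) (a := a)
    fun x hx => by
      obtain ⟨W, h', hxW, f, e⟩ := H V h a x hx
      exact ⟨W, h', hxW, f, one _ e⟩
  refine ⟨f, fun t => EvalTo.of_locally fun x hx => ?_⟩
  obtain ⟨W, h', hxW, g, e⟩ := H V h a x hx
  have e1 : fres h' f = g := (hf.res h').eq (one _ e)
  refine ⟨W, h', hxW, ?_⟩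
  rw [secRes_dsmul, fres_dact, e1]
  exact e _

theorem IsEval.add {U : Opens M} {φ ψ : ∀ x : U, StalkDual S.coalg x.1} (hφ : IsEval S φ)
    (hψ : IsEval S ψ) : IsEval S (φ + ψ) := fun V h a => by
  obtain ⟨f, hf⟩ := hφ V h a
  obtain ⟨g, hg⟩ := hψ V h a
  refine ⟨f + g, fun t x hx => ?_⟩
  rw [map_add (dact t), map_add, ← hf t x hx, ← hg t x hx]
  exact sval_add _ _ _

theorem isEval_algebraMap {U : Opens M} (r : Base n) :
    IsEval S (algebraMap (Base n) (∀ x : U, StalkDual S.coalg x.1) r) :=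
  isEval_of_locally fun V h a x hx => by
    obtain ⟨W, h', hxW, e, he⟩ := S.counit_local V a x hx
    refine ⟨W, h', hxW, r • (show FunR d n W from e), fun t y hy => ?_⟩
    rw [map_smul (dact t), fgerm_smul]
    change sval (algebraMap (Base n) (StalkDual S.coalg y) r) _ = _
    rw [Algebra.algebraMap_eq_smul_one, sval_smul, sval_one]
    exact congrArg (r • ·) (S.counit_linear W t _ e he y hy)

/-- Convolution of functionals in terms of a representative of the coproduct. -/
theorem EvalTo.mul {U V : Opens M} {φ ψ : ∀ x : U, StalkDual S.coalg x.1} {h : V ≤ U} {a : sec F V} {l}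
    (H : ComulRep F S.coalg a l) {f g : sec F V → FunR d n V}
    (hf : ∀ p ∈ l, EvalTo (fun x => sval (φ x)) h p.1 (f p.1))
    (hg : ∀ p ∈ l, EvalTo (fun x => sval (ψ x)) h p.2 (g p.2)) :
    EvalTo (fun x => sval ((φ * ψ) x)) h a (l.map fun p => f p.1 * g p.2).sum := fun x hx => by
  change sval (φ _ * ψ _) _ = _
  rw [sval_mul, H x hx]
  clear H
  induction l with
  | nil => simp only [List.map_nil, List.sum_nil, map_zero]
  | cons p l ih =>
    rw [List.map_cons, List.sum_cons, map_add, ih (fun q hq => hf q (List.mem_cons_of_mem _ hq))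
      (fun q hq => hg q (List.mem_cons_of_mem _ hq)), pair_tmul, List.map_cons, List.sum_cons, map_add,
      map_mul, hf p List.mem_cons_self x hx, hg p List.mem_cons_self x hx]

theorem IsEval.mul [IsManifold 𝓘(ℂ, EuclideanSpace ℂ (Fin d)) ω M] {U : Opens M}
    {φ ψ : ∀ x : U, StalkDual S.coalg x.1} (hφ : IsEval S φ) (hψ : IsEval S ψ) :
    IsEval S (φ * ψ) := by
  choose f hf using hφ
  choose g hg using hψ
  have hf1 : ∀ V h a, EvalTo (fun x => sval (φ x)) h a (f V h a) := fun V h a => by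
    have := hf V h a 1
    rwa [one_smul, map_one dact] at this
  have hg1 : ∀ V h a, EvalTo (fun x => sval (ψ x)) h a (g V h a) := fun V h a => by
    have := hg V h a 1
    rwa [one_smul, map_one dact] at this
  have hf2 : ∀ V h a (t : DOpR d n V), f V h (t • a) = dact t (f V h a) := fun V h a t =>
    (hf1 V h _).eq (hf V h a t)
  have hg2 : ∀ V h a (t : DOpR d n V), g V h (t • a) = dact t (g V h a) := fun V h a t =>
    (hg1 V h _).eq (hg V h a t)
  -- The value of `φ * ψ` at `a` is `∑ φ(a') ψ(a'')`, where `∑ a' ⊗ a''` is the coproduct of `a`.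
  have key : ∀ V h (a : sec F V) l, ComulRep F S.coalg a l →
      EvalTo (fun x => sval ((φ * ψ) x)) h a (l.map fun p => f V h p.1 * g V h p.2).sum :=
    fun V h a l H => EvalTo.mul H (fun p _ => hf1 V h p.1) (fun p _ => hg1 V h p.2)
  -- The coproduct and the product of functions both satisfy the Leibniz rule, so `φ * ψ` commutes with
  -- vector fields.
  have hτ : ∀ (V : Opens M) (h : V ≤ U) (τ : DiffOp d V), IsVectorField τ →
      (ofOp τ : DOpR d n V) ∈ EvalTo.commuting (F := F) (fun x => sval ((φ * ψ) x)) h := by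
    refine fun V h τ hτ a k e => EvalTo.of_locally fun x hx => ?_
    obtain ⟨W, h', hxW, l, hl⟩ := S.comul_local V a x hx
    refine ⟨W, h', hxW, ?_⟩
    have e1 := (e.res h').eq (key W (h'.trans h) _ l hl)
    have e2 := key W (h'.trans h) _ _ (S.comul_leibniz W _ (hτ.res h') _ l hl)
    rw [secRes_dsmul, fres_dact, e1, dres_ofOp]
    have e3 := (hτ.res h').dact_list_sum (t := (ofOp (diffOpRes d h' τ) : DOpR d n W)) l
      (f W (h'.trans h)) (g W (h'.trans h)) (fun b => hf2 _ _ b _) fun b => hg2 _ _ b _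
    rw [e3]
    exact e2
  refine isEval_of_locally fun V h a x hx => ?_
  obtain ⟨W, h', hxW, l, hl⟩ := S.comul_local V a x hx
  exact ⟨W, h', hxW, _, fun t => EvalTo.dsmul hτ (key W (h'.trans h) _ l hl) t⟩

theorem IsEval.res {U V : Opens M} {φ : ∀ x : U, StalkDual S.coalg x.1} (hφ : IsEval S φ) (h : V ≤ U) :
    IsEval S fun x : V => φ ⟨x.1, h x.2⟩ := fun W h' a => hφ W (h'.trans h) a

variable [IsManifold 𝓘(ℂ, EuclideanSpace ℂ (Fin d)) ω M]

variable (S) in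
/-- The algebra of `D_M ⊗ R`-linear maps of sheaves `F|_U → O_U ⊗ R` under convolution. -/
def dualAlgebra (U : Opens M) : Subalgebra (Base n) (∀ x : U, StalkDual S.coalg x.1) where
  carrier := {φ | IsEval S φ}
  mul_mem' := IsEval.mul
  add_mem' := IsEval.add
  algebraMap_mem' := isEval_algebraMap

variable (S) in
/-- Restriction maps of the dual algebra. -/
def dualRes {U V : Opens M} (h : V ≤ U) : dualAlgebra S U →ₐ[Base n] dualAlgebra S V where
  toFun φ := ⟨fun x => φ.1 ⟨x.1, h x.2⟩, IsEval.res φ.2 h⟩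
  map_one' := rfl
  map_mul' _ _ := rfl
  map_zero' := rfl
  map_add' _ _ := rfl
  commutes' _ := rfl

variable (S) in
/-- The dual algebras as a presheaf of algebras. -/
def dualPresheaf : TopCat.Presheaf (AlgCat.{u} (Base n)) (TopCat.of M) where
  obj U := AlgCat.of (Base n) (dualAlgebra S (U.unop : Opens M))
  map f := AlgCat.ofHom (dualRes S (leOfHom f.unop))
  map_id _ := rfl
  map_comp _ _ := rfl

theorem isSheaf_dualPresheaf : (dualPresheaf S).IsSheaf := by
  refine isSheaf_of_sheafLike (dualPresheaf S)
    { res_self := fun _ _ => rfl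
      res_res := fun _ _ _ => rfl
      sep := fun U (φ ψ : dualAlgebra S U) H => Subtype.ext (funext fun x => ?_)
      glue := fun U V hV hx (φ : ∀ x, dualAlgebra S (V x)) H => ?_ }
  · obtain ⟨V, h, hxV, e⟩ := H x.1 x.2
    exact congrFun (congrArg Subtype.val e) ⟨x.1, hxV⟩
  · have key : ∀ (x : U) (y : V x), (φ ⟨y.1, hV x y.2⟩).1 ⟨y.1, hx ⟨y.1, hV x y.2⟩⟩ = (φ x).1 y :=
      fun x y => congrFun (congrArg Subtype.val (H ⟨y.1, hV x y.2⟩ x (V _ ⊓ V x) inf_le_left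
        inf_le_right)) ⟨y.1, hx ⟨y.1, hV x y.2⟩, y.2⟩
    refine ⟨(⟨fun x => (φ x).1 ⟨x.1, hx x⟩, isEval_of_locally fun W h a x hxW => ?_⟩ :
      dualAlgebra S U), fun x h => Subtype.ext (funext fun y => key x y)⟩
    obtain ⟨f, hf⟩ := (φ ⟨x, h hxW⟩).2 (W ⊓ V ⟨x, h hxW⟩) inf_le_right (secRes F inf_le_left a)
    refine ⟨W ⊓ V ⟨x, h hxW⟩, inf_le_left, ⟨hxW, hx ⟨x, h hxW⟩⟩, f, fun t y hy => ?_⟩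
    refine Eq.trans ?_ (hf t y hy)
    exact congrArg (fun ψ => sval ψ (germ F _ y hy (t • secRes F inf_le_left a)))
      (key ⟨x, h hxW⟩ ⟨y, hy.2⟩)

variable (S) in
/-- The sheaf of algebras dual to a deformation. -/
def dualSheaf : AlgSheaf n M := ⟨dualPresheaf S, isSheaf_dualPresheaf⟩

/-- The pairing of a section of the dual with a section of the deformation. -/
def dpair {U V : Opens M} (φ : asec (dualSheaf S) U) (h : V ≤ U) (a : sec F V) : FunR d n V :=
  ((show dualAlgebra S U from φ).2 V h a).choose

theorem evalTo_dpair {U V : Opens M} (φ : asec (dualSheaf S) U) (h : V ≤ U) (a : sec F V) :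
    EvalTo (fun x => sval ((show dualAlgebra S U from φ).1 x)) h a (dpair φ h a) := by
  have := ((show dualAlgebra S U from φ).2 V h a).choose_spec 1
  rwa [one_smul, map_one dact] at this

theorem dpair_dsmul {U V : Opens M} (φ : asec (dualSheaf S) U) (h : V ≤ U) (t : DOpR d n V)
    (a : sec F V) : dpair φ h (t • a) = dact t (dpair φ h a) :=
  (evalTo_dpair φ h _).eq (((show dualAlgebra S U from φ).2 V h a).choose_spec t)

theorem dpair_add_right {U V : Opens M} (φ : asec (dualSheaf S) U) (h : V ≤ U) (a b : sec F V) :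
    dpair φ h (a + b) = dpair φ h a + dpair φ h b :=
  (evalTo_dpair φ h _).eq ((evalTo_dpair φ h a).add (evalTo_dpair φ h b))

theorem fres_dpair {U V W : Opens M} (φ : asec (dualSheaf S) U) (h : V ≤ U) (h' : W ≤ V) (a : sec F V) :
    fres h' (dpair φ h a) = dpair φ (h'.trans h) (secRes F h' a) :=
  ((evalTo_dpair φ h a).res h').eq (evalTo_dpair φ (h'.trans h) _)

theorem dpair_ares {U V W : Opens M} (φ : asec (dualSheaf S) U) (h : V ≤ U) (h' : W ≤ V) (a : sec F W) :
    dpair (ares _ h φ) h' a = dpair φ (h'.trans h) a :=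
  (evalTo_dpair (ares _ h φ) h' a).eq (evalTo_dpair φ (h'.trans h) a)

theorem dpair_add {U V : Opens M} (φ ψ : asec (dualSheaf S) U) (h : V ≤ U) (a : sec F V) :
    dpair (φ + ψ) h a = dpair φ h a + dpair ψ h a :=
  (evalTo_dpair (φ + ψ) h a).eq fun x hx =>
    (congrArg₂ (· + ·) (evalTo_dpair φ h a x hx) (evalTo_dpair ψ h a x hx)).trans
      (map_add (fgerm hx) _ _).symm

theorem dpair_smul {U V : Opens M} (r : Base n) (φ : asec (dualSheaf S) U) (h : V ≤ U) (a : sec F V) :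
    dpair (r • φ) h a = r • dpair φ h a :=
  (evalTo_dpair (r • φ) h a).eq fun x hx =>
    (congrArg (r • ·) (evalTo_dpair φ h a x hx)).trans (fgerm_smul hx r _).symm

theorem dpair_one {U V : Opens M} (h : V ≤ U) {a : sec F V} {e : FunR d n V}
    (H : CounitRep F S.coalg a e) : dpair (1 : asec (dualSheaf S) U) h a = e :=
  (evalTo_dpair (1 : asec (dualSheaf S) U) h a).eq fun x hx => H x hx

/-- The product of the dual in terms of the coproduct of the deformation. -/
theorem dpair_mul {U V : Opens M} (φ ψ : asec (dualSheaf S) U) (h : V ≤ U) {a : sec F V} {l}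
    (H : ComulRep F S.coalg a l) :
    dpair (φ * ψ) h a = (l.map fun p => dpair φ h p.1 * dpair ψ h p.2).sum :=
  (evalTo_dpair (φ * ψ) h a).eq (EvalTo.mul H (fun p _ => evalTo_dpair φ h p.1)
    fun p _ => evalTo_dpair ψ h p.2)

end DualSheaf

/-! ### The dual of a deformation is a quantization -/

theorem coef_algebraMap_smul {n : ℕ} {A : Type*} [AddCommGroup A] [Module ℂ A] (i : Fin (n + 1))
    (c : ℂ) (t : Base n ⊗[ℂ] A) : coef i (algebraMap ℂ (Base n) c • t) = c • coef i t := by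
  rw [algebraMap_smul, map_smul]

section ListStar

variable {d n : ℕ} {M : Type u} [TopologicalSpace M] [ChartedSpace (EuclideanSpace ℂ (Fin d)) M]

/-- The coefficient of a power of `ħ` in a section of `O_M ⊗ R`. -/
def fcoef (i : Fin (n + 1)) {U : Opens M} : FunR d n U →+ Hol d U :=
  (coef (n := n) (A := Hol d U) i).toAddMonoidHom

theorem fcoef_smul (i : Fin (n + 1)) {U : Opens M} (c : ℂ) (f : FunR d n U) :
    fcoef i (algebraMap ℂ (Base n) c • f) = c • fcoef i f :=
  coef_algebraMap_smul (A := Hol d U) i c f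

theorem fcoef_fres (i : Fin (n + 1)) {U V : Opens M} (h : V ≤ U) (f : FunR d n U) :
    fcoef i (fres h f) = holRes d h (fcoef i f) := coef_holRRes h f i

theorem fcoef_zero {U : Opens M} (f : FunR d n U) : fcoef 0 f = fred f := (red_eq_coef f).symm

theorem eq_sum_fcoef {U : Opens M} (f : FunR d n U) :
    (show HolR d n U from f) = ∑ i : Fin (n + 1), (hbar n ^ (i : ℕ)) ⊗ₜ[ℂ] fcoef i f :=
  (sum_coef (A := Hol d U) f).symm

theorem fres_listAct {U V : Opens M} (h : V ≤ U) (l : List (DOpR d n U × DOpR d n U))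
    (f g : FunR d n U) : fres h (listAct l f g) =
      listAct (l.map fun p => (dres h p.1, dres h p.2)) (fres h f) (fres h g) := by
  rw [listAct_apply, listAct_apply, List.map_map]
  induction l with
  | nil => exact map_zero _
  | cons p l ih =>
    rw [List.map_cons, List.sum_cons, map_add, ih, List.map_cons, List.sum_cons, map_mul, fres_dact,
      fres_dact]
    rfl

theorem killed_listAct {U : Opens M} {N : ℕ} {l : List (DOpR d n U × DOpR d n U)} (f : FunR d n U)
    (h : ∀ p ∈ l, Killed (mulPairs (Base n) (FunR d n U)) N (dact p.2)) :
    Killed (mulPairs (Base n) (FunR d n U)) (N + 1) (listAct l f) := by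
  induction l with
  | nil => exact Killed.zero _ _
  | cons p l ih =>
    have h1 := (h p List.mem_cons_self).mulPairs_comp (killed_mulLeft (k := Base n) (dact p.1 f))
    exact h1.add (ih fun q hq => h q (List.mem_cons_of_mem _ hq))

theorem exists_killed_of_list {U : Opens M} (l : List (DOpR d n U × DOpR d n U)) {x : M} (hx : x ∈ U) :
    ∃ W ≤ U, x ∈ W ∧ ∃ N : ℕ, ∀ (V : Opens M) (hV : V ≤ U), V ≤ W → ∀ p ∈ l,
      Killed (mulPairs (Base n) (FunR d n V)) N (dact (dres hV p.1)) ∧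
      Killed (mulPairs (Base n) (FunR d n V)) N (dact (dres hV p.2)) := by
  induction l with
  | nil => exact ⟨U, le_rfl, hx, 0, fun _ _ _ p hp => absurd hp List.not_mem_nil⟩
  | cons p l ih =>
    obtain ⟨W, hW, hxW, N, hN⟩ := ih
    obtain ⟨W₁, -, hxW₁, N₁, hN₁⟩ := killed_dact p.1 hx
    obtain ⟨W₂, -, hxW₂, N₂, hN₂⟩ := killed_dact p.2 hx
    refine ⟨W ⊓ (W₁ ⊓ W₂), inf_le_left.trans hW, ⟨hxW, hxW₁, hxW₂⟩, max N (max N₁ N₂),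
      fun V hV hVW q hq => ?_⟩
    obtain rfl | hq := List.mem_cons.1 hq
    · exact ⟨(hN₁ ⟨V, hV⟩ (hVW.trans (inf_le_right.trans inf_le_left))).mono
        ((le_max_left _ _).trans (le_max_right _ _)),
        (hN₂ ⟨V, hV⟩ (hVW.trans (inf_le_right.trans inf_le_right))).mono
        ((le_max_right _ _).trans (le_max_right _ _))⟩
    · exact (hN V hV (hVW.trans inf_le_left) q hq).imp (·.mono (le_max_left _ _))
        (·.mono (le_max_left _ _))

theorem listAct_swap {U : Opens M} (l : List (DOpR d n U × DOpR d n U)) (f g : FunR d n U) :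
    listAct (l.map Prod.swap) f g = listAct l g f := by
  rw [listAct_apply, listAct_apply, List.map_map]
  exact congrArg List.sum (List.map_congr_left fun p _ => mul_comm _ _)

/-- The coefficients of the bilinear operator `(f, g) ↦ ∑ t(f) t'(g)` as bidifferential operators. -/
def listBidiff {U : Opens M} (l : List (DOpR d n U × DOpR d n U)) (i : Fin (n + 1)) : BidiffOp d U where
  app V hV := LinearMap.mk₂ ℂ (fun f g =>
      fcoef i (listAct (l.map fun p => (dres hV p.1, dres hV p.2)) (ofHol f) (ofHol g)))
    (fun f f' g => by rw [ofHol_add, map_add, LinearMap.add_apply, map_add])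
    (fun c f g => by rw [ofHol_smul, map_smul, LinearMap.smul_apply, fcoef_smul])
    (fun f g g' => by rw [ofHol_add, map_add, map_add])
    (fun c f g => by rw [ofHol_smul, map_smul, fcoef_smul])
  res_app V W hV h f g := by
    change holRes d h (fcoef i _) = fcoef i _
    rw [← fcoef_fres, fres_listAct, fres_ofHol, fres_ofHol, List.map_map]
    simp only [Function.comp_def, dres_dres]
  order x hx := by
    obtain ⟨W, hW, hxW, N, hN⟩ := exists_killed_of_list l hx
    refine ⟨W, hW, hxW, N + 1, fun V hV hVW f => ⟨?_, ?_⟩⟩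
    · refine killed_coefOp (n := n) (A := Hol d V)
        (Q := listAct (l.map fun p => (dres hV p.1, dres hV p.2)) (ofHol f))
        (killed_listAct _ fun p hp => ?_) i
      obtain ⟨q, hq, rfl⟩ := List.mem_map.1 hp
      exact (hN V hV hVW q hq).2
    · have e : ∀ g : Hol d V, fcoef i (listAct (l.map fun p => (dres hV p.1, dres hV p.2)) (ofHol g)
          (ofHol f)) = coefOp (n := n) (A := Hol d V) i (listAct
            ((l.map fun p => (dres hV p.1, dres hV p.2)).map Prod.swap) (ofHol f)) g := fun g =>
        congrArg (fcoef i) (listAct_swap _ (ofHol f) (ofHol g)).symm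
      refine (congrArg (Killed _ _) (LinearMap.ext e)).mpr
        (killed_coefOp (n := n) (A := Hol d V) (killed_listAct _ fun p hp => ?_) i)
      obtain ⟨q, hq, rfl⟩ := List.mem_map.1 hp
      obtain ⟨r, hr, rfl⟩ := List.mem_map.1 hq
      exact (hN V hV hVW r hr).1

theorem listBidiff_app {U V : Opens M} (l : List (DOpR d n U × DOpR d n U)) (i : Fin (n + 1))
    (hV : V ≤ U) (f g : Hol d V) : (listBidiff l i).app V hV f g =
      fcoef i (listAct (l.map fun p => (dres hV p.1, dres hV p.2)) (ofHol f) (ofHol g)) := rfl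

theorem fred_listAct {U V : Opens M} (l : List (DOpR d n U × DOpR d n U)) (hV : V ≤ U) (f g : Hol d V) :
    fred (listAct (l.map fun p => (dres hV p.1, dres hV p.2)) (ofHol f) (ofHol g)) =
      (l.map fun p => (dred p.1).1 ⟨V, hV⟩ f * (dred p.2).1 ⟨V, hV⟩ g).sum := by
  have h1 : ∀ (t : DOpR d n U) (f : Hol d V),
      fred (dact (dres hV t) (ofHol f)) = (dred t).1 ⟨V, hV⟩ f := fun t f => by
    rw [fred_dact, fred_ofHol, dred_dres]
    rfl
  rw [listAct_apply, List.map_map, map_list_sum, List.map_map]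
  refine congrArg List.sum (List.map_congr_left fun p _ => ?_)
  rw [Function.comp_apply, Function.comp_apply, map_mul, h1, h1]

/-- The star product `(f, g) ↦ ∑ t(f) t'(g)`, for a list of pairs `(t, t')`. -/
def listStar {U : Opens M} (l : List (DOpR d n U × DOpR d n U))
    (h0 : ∀ (V : Opens M) (hV : V ≤ U) (f g : Hol d V),
      (l.map fun p => (dred p.1).1 ⟨V, hV⟩ f * (dred p.2).1 ⟨V, hV⟩ g).sum = f * g)
    (hassoc : ∀ (V : Opens M) (hV : V ≤ U) (f g h : FunR d n V),
      listAct (l.map fun p => (dres hV p.1, dres hV p.2))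
        (listAct (l.map fun p => (dres hV p.1, dres hV p.2)) f g) h =
      listAct (l.map fun p => (dres hV p.1, dres hV p.2)) f
        (listAct (l.map fun p => (dres hV p.1, dres hV p.2)) g h)) : StarProduct d n U where
  coeff := listBidiff l
  coeff_zero V hV f g := by
    rw [← h0 V hV f g, ← fred_listAct l hV f g, ← fcoef_zero, listBidiff_app]
  mul V hV := listAct (l.map fun p => (dres hV p.1, dres hV p.2))
  mul_tmul V hV f g := (eq_sum_fcoef (listAct (l.map fun p => (dres hV p.1, dres hV p.2)) (ofHol f)
    (ofHol g))).trans (Finset.sum_congr rfl fun i _ =>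
      congrArg ((hbar n ^ (i : ℕ)) ⊗ₜ[ℂ] ·) (listBidiff_app l i hV f g).symm)
  assoc := hassoc

end ListStar

section DualTrivialization

variable {d n : ℕ} {M : Type u} [TopologicalSpace M] [ChartedSpace (EuclideanSpace ℂ (Fin d)) M]
  [IsManifold 𝓘(ℂ, EuclideanSpace ℂ (Fin d)) ω M] {F : PresheafOfModules.{u} (DR d n M)}
  {S : Deformation F}

theorem dualSheaf_ext {U : Opens M} {φ ψ : asec (dualSheaf S) U}
    (h : ∀ (V : Opens M) (h : V ≤ U) (a : sec F V), dpair φ h a = dpair ψ h a) : φ = ψ := by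
  refine Subtype.ext (funext fun x => sval_ext fun a => ?_)
  obtain ⟨V, hV, hxV, b, rfl⟩ := exists_germ_eq F a x.2
  exact (evalTo_dpair φ hV b x.1 hxV).trans
    ((congrArg (fgerm hxV) (h V hV b)).trans (evalTo_dpair ψ hV b x.1 hxV).symm)

/-- Functionals are determined by their value at a free generator, which is arbitrary. -/
theorem IsGen.bijective_dpair {U : Opens M} {ε : sec F U} (hε : IsGen F U ε) :
    Function.Bijective fun φ : asec (dualSheaf S) U => dpair φ le_rfl ε := by
  refine ⟨fun φ ψ h => dualSheaf_ext fun V hV a => ?_, fun f => ?_⟩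
  · obtain ⟨t, rfl⟩ := (hε V hV).2 a
    have h' : dpair φ le_rfl ε = dpair ψ le_rfl ε := h
    beta_reduce
    rw [dpair_dsmul, dpair_dsmul, ← fres_dpair φ le_rfl hV, ← fres_dpair ψ le_rfl hV, h']
  · choose L hL using fun x : U => hε.exists_eval x.2 f
    have h1 : ∀ (V : Opens M) (h : V ≤ U) (t : DOpR d n V),
        EvalTo (fun x => sval (ofDual S.coalg (L x))) h (t • secRes F h ε) (dact t (fres h f)) :=
      fun V h t x hx => hL ⟨x, h hx⟩ V h hx t
    let φ : dualAlgebra S U := ⟨fun x => ofDual S.coalg (L x), fun V h a => by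
      obtain ⟨t, rfl⟩ := (hε V h).2 a
      refine ⟨dact t (fres h f), fun t' => ?_⟩
      beta_reduce
      rw [← mul_smul, ← dact_mul]
      exact h1 V h _⟩
    refine ⟨φ, (evalTo_dpair (show asec (dualSheaf S) U from φ) le_rfl ε).eq ?_⟩
    have := h1 U le_rfl 1
    rwa [one_smul, map_one dact, secRes_self, fres_self] at this

/-- A section of the dual as a function, by means of a free generator. -/
def dualEquiv {U : Opens M} {ε : sec F U} (hε : IsGen F U ε) :
    FunR d n U ≃ₗ[Base n] asec (dualSheaf S) U :=
  (LinearEquiv.ofBijective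
    { toFun := fun φ : asec (dualSheaf S) U => dpair φ le_rfl ε
      map_add' := fun φ ψ => dpair_add φ ψ le_rfl ε
      map_smul' := fun r φ => dpair_smul r φ le_rfl ε } hε.bijective_dpair).symm

variable (S) in
/-- The trivialization of the dual by a generator. -/
theorem exists_dualTrivialization {U : Opens M} {ε : sec F U} (h1 : S.reduce U ε = 1)
    {l : List (DOpR d n U × DOpR d n U)}
    (hl : ComulRep F S.coalg ε (l.map fun p => (p.1 • ε, p.2 • ε))) :
    ∃ T : Trivialization d (dualSheaf S) U, ∀ (V : Opens M) (hV : V ≤ U) (φ : asec (dualSheaf S) V),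
      (T.tr hV).symm φ = dpair φ le_rfl (secRes F hV ε) := by
  have hε := S.isGen h1
  have hl' : ∀ (V : Opens M) (hV : V ≤ U), ComulRep F S.coalg (secRes F hV ε)
      (l.map fun p => (dres hV p.1 • secRes F hV ε, dres hV p.2 • secRes F hV ε)) :=
    fun V hV x hx => by
      rw [germ_res, hl x (hV hx), List.map_map, List.map_map]
      refine congrArg List.sum (List.map_congr_left fun p _ => ?_)
      simp only [Function.comp_apply]
      rw [← secRes_dsmul, ← secRes_dsmul, germ_res, germ_res]
  let e : ∀ (V : Opens M), V ≤ U → FunR d n V ≃ₗ[Base n] asec (dualSheaf S) V := fun V hV =>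
    dualEquiv (hε.restrict hV)
  have he : ∀ V hV φ, (e V hV).symm φ = dpair φ le_rfl (secRes F hV ε) := fun V hV φ => rfl
  -- The product transported by the generator is `(f, g) ↦ ∑ t(f) t'(g)`, where `∑ t ε ⊗ t' ε` is the
  -- coproduct of the generator.
  have hmul : ∀ (V : Opens M) (hV : V ≤ U) (f g : FunR d n V),
      e V hV (listAct (l.map fun p => (dres hV p.1, dres hV p.2)) f g) = e V hV f * e V hV g := by
    intro V hV f g
    rw [← LinearEquiv.eq_symm_apply, he, dpair_mul _ _ le_rfl (hl' V hV), listAct_apply, List.map_map,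
      List.map_map]
    refine congrArg List.sum (List.map_congr_left fun p _ => ?_)
    simp only [Function.comp_apply]
    rw [dpair_dsmul, dpair_dsmul, ← he, ← he, LinearEquiv.symm_apply_apply,
      LinearEquiv.symm_apply_apply]
  refine ⟨
    { star := listStar l (fun V hV f g => ?_) fun V hV f g h => (e V hV).injective ?_
      equiv := e
      res_equiv := fun V W hV h f => ?_
      equiv_mul := hmul }, he⟩
  -- Modulo `ħ` the coproduct of the generator is that of `1 ∈ D_M`, so the leading term is `f g`.
  · have h2 := S.reduce_comul U ε _ hl ⟨V, hV⟩ f g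
    rw [h1, List.map_map] at h2
    refine Eq.trans (congrArg List.sum (List.map_congr_left fun p _ => ?_)) h2.symm
    have h3 : ∀ t : DOpR d n U, S.reduce U (t • ε) = dred t := fun t => by
      rw [S.reduce_dsmul, h1, mul_one]
    simp only [Function.comp_apply]
    rw [h3, h3]
  · rw [hmul, hmul, hmul, hmul, mul_assoc]
  · change ares _ h (e V hV f) = e W (h.trans hV) (fres h f)
    rw [← LinearEquiv.symm_apply_eq, he, dpair_ares, ← secRes_res F hV h, ← fres_dpair _ le_rfl h, ← he]
    exact congrArg (fres h) ((e V hV).symm_apply_apply f)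

variable (S) in
theorem exists_dualTrivialization_of_mem {U : Opens M} {x : M} (hx : x ∈ U) :
    ∃ (V : Opens M) (_ : V ≤ U), x ∈ V ∧ ∃ (ε : sec F V) (T : Trivialization d (dualSheaf S) V),
      S.reduce V ε = 1 ∧ ∀ (W : Opens M) (hW : W ≤ V) (φ : asec (dualSheaf S) W),
        (T.tr hW).symm φ = dpair φ le_rfl (secRes F hW ε) := by
  obtain ⟨V, hV, hxV, ε, h1⟩ := S.exists_gen hx
  obtain ⟨W, hW, hxW, l, hl⟩ := S.comul_local V ε x hxV
  have h1' : S.reduce W (secRes F hW ε) = 1 := by rw [S.reduce_res, h1, map_one]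
  choose c hc using fun a => (S.isGen h1 W hW).2 a
  have hl' : (l.map fun p => (c p.1, c p.2)).map
      (fun p => (p.1 • secRes F hW ε, p.2 • secRes F hW ε)) = l := by
    rw [List.map_map]
    exact (List.map_congr_left fun p _ => Prod.ext (hc p.1) (hc p.2)).trans (List.map_id l)
  obtain ⟨T, hT⟩ := exists_dualTrivialization S h1' (l := l.map fun p => (c p.1, c p.2))
    (by rw [hl']; exact hl)
  exact ⟨W, hW.trans hV, hxW, _, T, h1', hT⟩

theorem isStarQuantization_dualSheaf : IsStarQuantization d (dualSheaf S) := fun x => by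
  obtain ⟨V, -, hxV, -, T, -⟩ := exists_dualTrivialization_of_mem S (U := ⊤) (x := x) trivial
  exact ⟨V, hxV, ⟨T⟩⟩

end DualTrivialization

/-! ### Every deformation comes from its dual -/

section Bidual

variable {d n : ℕ} {M : Type u} [TopologicalSpace M] [ChartedSpace (EuclideanSpace ℂ (Fin d)) M]
  [IsManifold 𝓘(ℂ, EuclideanSpace ℂ (Fin d)) ω M] {F : PresheafOfModules.{u} (DR d n M)}
  (S : Deformation F)

/-- Pairing with a section of the deformation, as a map on the dual. -/
def dpairLeft {U V : Opens M} (h : V ≤ U) (a : sec F U) : asec (dualSheaf S) V →ₗ[Base n] FunR d n V where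
  toFun φ := dpair φ le_rfl (secRes F h a)
  map_add' φ ψ := dpair_add φ ψ le_rfl _
  map_smul' r φ := dpair_smul r φ le_rfl _

/-- Over the domain of a trivialization by a generator `ε`, pairing with `t • ε` is `t` applied to the
trivialization. -/
theorem dpairLeft_eq {V : Opens M} {ε : sec F V} {T : Trivialization d (dualSheaf S) V}
    (hT : ∀ (W : Opens M) (hW : W ≤ V) (φ : asec (dualSheaf S) W),
        (T.tr hW).symm φ = dpair φ le_rfl (secRes F hW ε)) {W : Opens M} (hW : W ≤ V)
    (t : DOpR d n V) : dpairLeft S hW (t • ε) = dval (t • T.gen) hW := LinearMap.ext fun φ => by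
  rw [dval_smul, T.dval_gen, hT]
  change dpair φ le_rfl (secRes F hW (t • ε)) = _
  rw [secRes_dsmul, dpair_dsmul]

/-- The section of `Diff_M(𝒜; O_M ⊗ R)`, for the dual `𝒜` of a deformation, given by pairing with a
section of the deformation. -/
def toBidual {U : Opens M} (a : sec F U) : sec (diffModule d (dualSheaf S)) U :=
  diffMk (fun V => dpairLeft S V.2 a)
    (fun V W h φ => by
      change fres h (dpair φ le_rfl (secRes F V.2 a)) = dpair (ares _ h φ) le_rfl (secRes F W.2 a)
      rw [fres_dpair, dpair_ares, secRes_res])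
    (fun x hx => by
      obtain ⟨V, hV, hxV, ε, T, h1, hT⟩ := exists_dualTrivialization_of_mem S hx
      obtain ⟨t, ht⟩ := (S.isGen h1 V le_rfl).2 (secRes F hV a)
      beta_reduce at ht
      rw [secRes_self] at ht
      obtain ⟨W, hW, hxW, N, hN⟩ := dval_order (t • T.gen) hxV
      refine ⟨W, hW.trans hV, hxW, N, fun V' hV' => ?_⟩
      have e : dpairLeft S V'.2 a = dval (t • T.gen) (hV'.trans hW) := by
        rw [← dpairLeft_eq S hT, ht]
        refine LinearMap.ext fun φ => ?_
        change dpair φ le_rfl (secRes F V'.2 a) = dpair φ le_rfl (secRes F _ (secRes F hV a))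
        rw [secRes_res]
      exact (congrArg (Killed (P := asec (dualSheaf S) V'.1) (Q := HolR d n V'.1)
        (quantPairs d (dualSheaf S) V'.1) N) e).mpr (hN V'.1 (hV'.trans hW) hV'))

theorem dval_toBidual {U V : Opens M} (a : sec F U) (h : V ≤ U) (φ : asec (dualSheaf S) V) :
    dval (toBidual S a) h φ = dpair φ le_rfl (secRes F h a) := rfl

theorem toBidual_secRes {U V : Opens M} (h : V ≤ U) (a : sec F U) :
    toBidual S (secRes F h a) = secRes _ h (toBidual S a) := dval_ext fun W h' φ => by
  rw [dval_secRes, dval_toBidual, dval_toBidual, secRes_res]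

theorem toBidual_add {U : Opens M} (a b : sec F U) :
    toBidual S (a + b) = toBidual S a + toBidual S b := dval_ext fun W h' φ => by
  rw [dval_add, dval_toBidual, dval_toBidual, dval_toBidual, map_add, dpair_add_right]

theorem toBidual_dsmul {U : Opens M} (t : DOpR d n U) (a : sec F U) :
    toBidual S (t • a) = t • toBidual S a := dval_ext fun W h' φ => by
  rw [dval_smul, dval_toBidual, dval_toBidual, secRes_dsmul, dpair_dsmul]

theorem toBidual_gen {V : Opens M} {ε : sec F V} {T : Trivialization d (dualSheaf S) V}
    (hT : ∀ (W : Opens M) (hW : W ≤ V) (φ : asec (dualSheaf S) W),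
        (T.tr hW).symm φ = dpair φ le_rfl (secRes F hW ε)) : toBidual S ε = T.gen :=
  dval_ext fun W h φ => by rw [dval_toBidual, T.dval_gen, hT]

theorem toBidual_injective {U : Opens M} {a b : sec F U} (h : toBidual S a = toBidual S b) : a = b := by
  refine (sheafLike_sec F S.isSheaf).sep _ _ _ fun x hx => ?_
  obtain ⟨V, hV, hxV, ε, T, h1, hT⟩ := exists_dualTrivialization_of_mem S hx
  refine ⟨V, hV, hxV, ?_⟩
  obtain ⟨t, ht⟩ := (S.isGen h1 V le_rfl).2 (secRes F hV a)
  obtain ⟨t', ht'⟩ := (S.isGen h1 V le_rfl).2 (secRes F hV b)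
  have h2 := congrArg (secRes _ hV) h
  rw [← toBidual_secRes, ← toBidual_secRes, ← ht, ← ht'] at h2
  beta_reduce at h2
  rw [secRes_self, toBidual_dsmul, toBidual_dsmul, toBidual_gen S hT] at h2
  have h3 : t = t' := (T.isGen_gen V le_rfl).1 h2
  rw [← ht, ← ht', h3]

theorem toBidual_surjective {U : Opens M} (A : sec (diffModule d (dualSheaf S)) U) :
    ∃ a : sec F U, toBidual S a = A := by
  obtain ⟨a, ha⟩ := (sheafLike_sec F S.isSheaf).exists_of_locally (U := U)
    (fun V hV a => toBidual S a = secRes _ hV A)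
    (fun V W hV h a e => by rw [toBidual_secRes, e, secRes_res])
    (fun V hV a b e e' => toBidual_injective S (e.trans e'.symm)) (fun x hx => by
      obtain ⟨V, hV, hxV, ε, T, h1, hT⟩ := exists_dualTrivialization_of_mem S hx
      obtain ⟨t, ht⟩ := (T.isGen_gen V le_rfl).2 (secRes _ hV A)
      refine ⟨V, hV, hxV, t • ε, ?_⟩
      rw [toBidual_dsmul, toBidual_gen S hT]
      exact ht)
  refine ⟨a, (sheafLike_diffModule (dualSheaf S)).sep _ _ _ fun x hx => ?_⟩
  obtain ⟨V, hV, hxV, e⟩ := ha x hx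
  exact ⟨V, hV, hxV, (toBidual_secRes S hV a).symm.trans e⟩

/-- The isomorphism of a deformation with the differential operators on its dual. -/
def bidualHom : F ⟶ diffModule d (dualSheaf S) :=
  PresheafOfModules.homMk
    { app := fun U : (Opens (TopCat.of M))ᵒᵖ => AddCommGrpCat.ofHom
        (AddMonoidHom.mk' (toBidual S (U := (U.unop : Opens M))) (toBidual_add S))
      naturality := fun _ _ f => AddCommGrpCat.hom_ext (AddMonoidHom.ext fun a =>
        toBidual_secRes S (leOfHom f.unop) a) }
    (fun U t a => toBidual_dsmul S (U := (U.unop : Opens M)) t a)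

theorem homSec_bidualHom {U : Opens M} (a : sec F U) : homSec (bidualHom S) U a = toBidual S a := rfl

variable {S} in
/-- The map to the double dual respects coproducts, counits and reductions; the reduction is compared on
a generator. -/
theorem isDeformationHom_bidualHom {T : Deformation (diffModule d (dualSheaf S))}
    (hT : IsCanonical (dualSheaf S) T) : IsDeformationHom S T (bidualHom S) where
  comul U a l H x hx := by
    refine hT.comul_germ isStarQuantization_dualSheaf (fun V h φ ψ => ?_) hx
    have H' : ComulRep F S.coalg (secRes F h a)
        (l.map fun p => (secRes F h p.1, secRes F h p.2)) := fun x hx => by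
      rw [germ_res, H x (h hx), List.map_map]
      refine congrArg List.sum (List.map_congr_left fun p _ => ?_)
      simp only [Function.comp_apply]
      rw [germ_res, germ_res]
    rw [homSec_bidualHom, dval_toBidual, dpair_mul φ ψ le_rfl H', List.map_map, List.map_map]
    rfl
  counit U a e H x hx := by
    rw [hT.counit_germ, homSec_bidualHom, dval_toBidual, secRes_self, dpair_one le_rfl H]
    rfl
  reduce U a := by
    refine sheafLike_diffOp.sep _ _ _ fun x hx => ?_
    obtain ⟨V, hV, hxV, ε, T', h1, hT'⟩ := exists_dualTrivialization_of_mem S hx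
    refine ⟨V, hV, hxV, ?_⟩
    obtain ⟨t, ht⟩ := (S.isGen h1 V le_rfl).2 (secRes F hV a)
    beta_reduce at ht
    rw [secRes_self] at ht
    change diffOpRes d hV _ = diffOpRes d hV _
    rw [← T.reduce_res, ← S.reduce_res, homSec_bidualHom, ← toBidual_secRes, ← ht, toBidual_dsmul,
      toBidual_gen S hT', T.reduce_dsmul, S.reduce_dsmul, h1,
      (hT.isRed T'.gen).eq isStarQuantization_dualSheaf T'.isRed_gen]

end Bidual

section Inverse

variable {d n : ℕ} {M : Type u} [TopologicalSpace M] [ChartedSpace (EuclideanSpace ℂ (Fin d)) M]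
  {F G : PresheafOfModules.{u} (DR d n M)}

/-- The map on stalks induced by a morphism of modules. -/
theorem exists_stalk_hom (g : G ⟶ F) (x : M) : ∃ L : Stalk G x →ₗ[StalkOR d n M x] Stalk F x,
    ∀ (V : Opens M) (hx : x ∈ V) (b : sec G V), L (germ G V x hx b) = germ F V x hx (homSec g V b) := by
  obtain ⟨L, hL⟩ := exists_stalk_lift (F := G) (A := Stalk F x) (x := x) (U := ⊤) trivial
    (fun V _ hx b => germ F V x hx (homSec g V b)) (fun V _ hx a b => by rw [map_add, map_add])
    (fun V W _ h hx a => by rw [homSec_res, germ_res])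
    (fun V _ hx s a => by rw [homSec_dsmul, germ_ofFun_smul])
  exact ⟨L, fun V hx b => hL V le_top hx b⟩

/-- The inverse of a bijective morphism of deformations is a morphism of deformations. -/
theorem IsDeformationHom.inv {S : Deformation F} {T : Deformation G} {f : F ⟶ G}
    (hf : IsDeformationHom S T f) {g : G ⟶ F} (hgf : ∀ U b, homSec f U (homSec g U b) = b)
    (hfg : ∀ U a, homSec g U (homSec f U a) = a) : IsDeformationHom T S g where
  comul U b l H x hx := by
    obtain ⟨L, hL⟩ := exists_stalk_hom g x
    have key : ∀ (V : Opens M) (hx : x ∈ V) (l : List (sec G V × sec G V)),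
        TensorProduct.map L L (germList G l hx) =
          germList F (l.map fun p => (homSec g V p.1, homSec g V p.2)) hx := fun V hx l => by
      rw [germList, germList, map_list_sum, List.map_map, List.map_map]
      refine congrArg List.sum (List.map_congr_left fun p _ => ?_)
      rw [Function.comp_apply, Function.comp_apply, TensorProduct.map_tmul, hL, hL]
    obtain ⟨V, hV, hxV, l', hl'⟩ := S.comul_local U (homSec g U b) x hx
    have e1 := hf.comul V _ _ hl' x hxV
    rw [homSec_res, hgf, germ_res, H x hx] at e1
    -- The inverse on stalks, applied to the identity `e1` of tensors.
    have e2 : germList F (l.map fun p => (homSec g U p.1, homSec g U p.2)) hx = germList F l' hxV := by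
      rw [← key U hx l]
      refine (congrArg (TensorProduct.map L L) e1).trans ((key V hxV _).trans ?_)
      rw [List.map_map]
      refine congrArg (fun l => germList F l hxV) ?_
      refine (List.map_congr_left fun p _ => ?_).trans (List.map_id l')
      exact Prod.ext (hfg V p.1) (hfg V p.2)
    refine Eq.trans ?_ e2.symm
    rw [← germ_res F hV hxV]
    exact hl' x hxV
  counit U b e H x hx := by
    obtain ⟨V, hV, hxV, e', he'⟩ := S.counit_local U (homSec g U b) x hx
    have e1 := hf.counit V _ _ he' x hxV
    rw [homSec_res, hgf, germ_res, H x hx] at e1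
    rw [e1, ← germ_res F hV hxV]
    exact he' x hxV
  reduce U b := by rw [← hf.reduce, hgf]

/-- An isomorphism of deformations, from a bijective morphism. -/
theorem IsDeformationHom.nonempty_iso {X Y : CoalgDeformation d n M} {f : X.carrier ⟶ Y.carrier}
    (hf : IsDeformationHom X.str Y.str f) (h : ∀ U, Function.Bijective (homSec f U)) :
    Nonempty (X ≅ Y) := by
  choose c hc using fun (U : Opens M) (b : sec Y.carrier U) => (h U).2 b
  have hc' : ∀ U a, c U (homSec f U a) = a := fun U a => (h U).1 (hc U _)
  let g : Y.carrier ⟶ X.carrier := PresheafOfModules.homMk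
    { app := fun U : (Opens (TopCat.of M))ᵒᵖ => AddCommGrpCat.ofHom
        (AddMonoidHom.mk' (c (U.unop : Opens M)) fun a b => (h _).1 (by rw [hc, map_add, hc, hc]))
      naturality := fun U V k => AddCommGrpCat.hom_ext (AddMonoidHom.ext fun b =>
        (h (V.unop : Opens M)).1 ((hc _ _).trans
          ((congrArg (secRes Y.carrier (leOfHom k.unop)) (hc _ b)).symm.trans
            (homSec_res f (leOfHom k.unop) _).symm))) }
    (fun U t b => (h (U.unop : Opens M)).1 ((hc _ _).trans
      ((congrArg ((show DOpR d n (U.unop : Opens M) from t) • ·) (hc _ b)).symm.trans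
        (homSec_dsmul f (U := (U.unop : Opens M)) t _).symm)))
  have hg : ∀ U b, homSec g U b = c U b := fun _ _ => rfl
  refine ⟨⟨⟨f, hf⟩, ⟨g, hf.inv (fun U b => ?_) fun U a => ?_⟩, Subtype.ext ?_, Subtype.ext ?_⟩⟩
  · rw [hg, hc]
  · rw [hg, hc']
  · exact PresheafOfModules.hom_ext fun U => ModuleCat.hom_ext (LinearMap.ext fun a => hc' _ a)
  · exact PresheafOfModules.hom_ext fun U => ModuleCat.hom_ext (LinearMap.ext fun b => hc _ b)

end Inverse

section Equivalence

variable {d n : ℕ} {M : Type u} [TopologicalSpace M] [ChartedSpace (EuclideanSpace ℂ (Fin d)) M]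
  [IsManifold 𝓘(ℂ, EuclideanSpace ℂ (Fin d)) ω M]

/-- The functor is fully faithful by double duality, and a deformation is isomorphic to the image of its
dual. -/
theorem isEquivalence_quantFunctor
    {S : ∀ X : StarQuantization d n M, Deformation (diffModule d X.obj)}
    (hS : ∀ X, IsCanonical X.obj (S X)) (h) : (quantFunctor S h).IsEquivalence where
  faithful.map_injective {X Y} φ ψ e := by
    have e1 : diffCongr (d := d) (quantIso d n M φ.iso) = diffCongr (quantIso d n M ψ.iso) :=
      congrArg (fun k => k.iso.hom.1) e
    have e2 := diffCongr_injective X.of.property e1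
    exact Core.hom_ext (ObjectProperty.hom_ext _ (congrArg Iso.hom e2))
  full.map_surjective {X Y} φ := by
    obtain ⟨e, he⟩ := exists_diffCongr_eq X.of.property Y.of.property (hS _) (hS _) φ.iso.hom.2
      φ.iso.inv.2 (congrArg Subtype.val φ.iso.hom_inv_id) (congrArg Subtype.val φ.iso.inv_hom_id)
    refine ⟨⟨ObjectProperty.isoMk _ e⟩, Core.hom_ext (Subtype.ext ?_)⟩
    exact he
  essSurj.mem_essImage Y := by
    let X : StarQuantization d n M := ⟨dualSheaf Y.of.str, isStarQuantization_dualSheaf⟩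
    obtain ⟨e⟩ := IsDeformationHom.nonempty_iso (X := Y.of) (Y := ⟨diffModule d X.obj, S X⟩)
      (isDeformationHom_bidualHom (hS X)) fun U =>
        ⟨fun a b => toBidual_injective Y.of.str, toBidual_surjective Y.of.str⟩
    exact ⟨⟨X⟩, ⟨Core.isoMk e.symm⟩⟩

end Equivalence

end

end StarQuant

theorem mainTheorem7 (d n : ℕ) (M : Type u) [TopologicalSpace M] [T2Space M]
    [ChartedSpace (EuclideanSpace ℂ (Fin d)) M]
    [IsManifold (𝓘(ℂ, EuclideanSpace ℂ (Fin d))) ω M] :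
    (∀ X : StarQuant.StarQuantization d n M,
      ∃! S : StarQuant.Deformation (StarQuant.diffModule d X.obj),
        StarQuant.IsCanonical X.obj S) ∧
    ∀ S : ∀ X : StarQuant.StarQuantization d n M,
        StarQuant.Deformation (StarQuant.diffModule d X.obj),
      (∀ X, StarQuant.IsCanonical X.obj (S X)) →
        ∃ h, (StarQuant.quantFunctor S h).IsEquivalence :=
  ⟨fun X => (StarQuant.exists_isCanonical X.property).elim fun _ hS =>
    ⟨_, hS, fun _ hS' => hS'.eq X.property hS⟩, fun _ hS =>
    ⟨fun X Y _ => (hS X).isDeformationHom_diffCongr Y.property (hS Y) _,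
      StarQuant.isEquivalence_quantFunctor hS _⟩⟩
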